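/- Let $\mathsf H,\mathsf K$ be complex Hilbert spaces and let $\mathsf X\subset B(\mathsf H;\mathsf K)$ be a W*-TRO, that is, a weak$^*$-closed linear subspace with $ab^*c\in\mathsf X$ for all $a,b,c\in\mathsf X$. Writing $\langle\,\cdot\,\rangle$ for the norm closed linear span, put \[ \mathsf A_{\mathsf X}=\begin{pmatrix}\langle \mathsf X\mathsf X^*\rangle & \mathsf X\\ \mathsf X^* & \langle \mathsf X^*\mathsf X\rangle\end{pmatrix}\subset B(\mathsf K\oplus\mathsf H), \] let $\mathsf R_{\mathsf X}=\mathsf A_{\mathsf X}''$ (the double commutant in $B(\mathsf K\oplus\mathsf H)$) be the linking von Neumann algebra of $\mathsf X$, and identify $x\in\mathsf X$ with $\begin{pmatrix}0&x\\0&0\end{pmatrix}\in\mathsf R_{\mathsf X}$. Let $G$ be a locally compact group. A (continuous) action of $G$ on $\mathsf X$ is a homomorphism $s\mapsto\alpha_s$ from $G$ to the group of linear bijections $\mathsf X\to\mathsf X$ such that every $\alpha_s$ is normal (weak$^*$-continuous) and satisfies $\alpha_s(ab^*c)=\alpha_s(a)\alpha_s(b)^*\alpha_s(c)$, and such that for each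 $x\in\mathsf X$ the map $s\mapsto\alpha_s(x)$ is weak$^*$-continuous. A (continuous) action of $G$ on $\mathsf R_{\mathsf X}$ is a homomorphism $s\mapsto\beta_s$ from $G$ to the group of normal $^*$-automorphisms of $\mathsf R_{\mathsf X}$ such that for each $z\in\mathsf R_{\mathsf X}$ the map $s\mapsto\beta_s(z)$ is weak$^*$-continuous. Theorem. For every action $\alpha$ of $G$ on $\mathsf X$ there is exactly one action $\beta$ of $G$ on $\mathsf R_{\mathsf X}$ that extends $\alpha$, i.e. satisfies \[ \beta_s\begin{pmatrix}0&x\\0&0\end{pmatrix}=\begin{pmatrix}0&\alpha_s(x)\\0&0\end{pmatrix}\qquad (s\in G,\ x\in\mathsf X). \] -/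

import Mathlib

noncomputable section

namespace WStarTernary

open scoped InnerProduct Topology

section Ultraweak

variable {H K : Type*} [NormedAddCommGroup H] [InnerProductSpace ℂ H] [CompleteSpace H]
  [NormedAddCommGroup K] [InnerProductSpace ℂ K] [CompleteSpace K]

/-- The functional `T ↦ ∑ₙ ⟪kₙ, T hₙ⟫` on `B(H; K)` given by two square-summable sequences of
vectors; the series converges absolutely. These are exactly the functionals in the predual of
`B(H; K)` (pairings with trace class operators). -/
def normalFunctional (h : lp (fun _ : ℕ => H) 2) (k : lp (fun _ : ℕ => K) 2)
    (T : H →L[ℂ] K) : ℂ :=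
  ∑' n, inner ℂ (k n) (T (h n))

variable (H K) in
/-- The weak* (ultraweak) topology of `B(H; K)`: the coarsest topology making all functionals
in the predual continuous. -/
@[reducible]
def ultraweak : TopologicalSpace (H →L[ℂ] K) :=
  ⨅ (h : lp (fun _ : ℕ => H) 2) (k : lp (fun _ : ℕ => K) 2),
    TopologicalSpace.induced (normalFunctional h k) inferInstance

/-- The weak* topology of a subspace of `B(H; K)`, induced from that of `B(H; K)`. -/
@[reducible]
def ultraweakOn {S : Type*} [SetLike S (H →L[ℂ] K)] (X : S) : TopologicalSpace X :=
  TopologicalSpace.induced (fun x : X => (x : H →L[ℂ] K)) (ultraweak H K)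

end Ultraweak

section TRO

/-- A (concrete) ternary ring of operators: a norm closed subspace of `B(H; K)` closed under the
ternary product `(a, b, c) ↦ a b* c`. -/
structure TRO (H K : Type*) [NormedAddCommGroup H] [InnerProductSpace ℂ H] [CompleteSpace H]
    [NormedAddCommGroup K] [InnerProductSpace ℂ K] [CompleteSpace K]
    extends Submodule ℂ (H →L[ℂ] K) where
  isClosed' : IsClosed carrier
  ternary_mem' : ∀ a ∈ carrier, ∀ b ∈ carrier, ∀ c ∈ carrier, a ∘L b† ∘L c ∈ carrier

/-- A W*-TRO: a TRO that is weak* closed in `B(H; K)`. -/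
structure WStarTRO (H K : Type*) [NormedAddCommGroup H] [InnerProductSpace ℂ H] [CompleteSpace H]
    [NormedAddCommGroup K] [InnerProductSpace ℂ K] [CompleteSpace K]
    extends TRO H K where
  isClosed_ultraweak' : IsClosed[ultraweak H K] carrier

variable {H K : Type*} [NormedAddCommGroup H] [InnerProductSpace ℂ H] [CompleteSpace H]
  [NormedAddCommGroup K] [InnerProductSpace ℂ K] [CompleteSpace K]

/-- The ternary product of a TRO. -/
def TRO.ternary (X : TRO H K) (a b c : X.toSubmodule) : X.toSubmodule :=
  ⟨(a : H →L[ℂ] K) ∘L (b : H →L[ℂ] K)† ∘L (c : H →L[ℂ] K),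
    X.ternary_mem' a a.2 b b.2 c c.2⟩

end TRO

section Linking

variable {H K : Type*} [NormedAddCommGroup H] [InnerProductSpace ℂ H] [CompleteSpace H]
  [NormedAddCommGroup K] [InnerProductSpace ℂ K] [CompleteSpace K]

/-- The operator on the Hilbert space direct sum `K ⊕ H` with matrix `(a, b; c, d)`. -/
def block (a : K →L[ℂ] K) (b : H →L[ℂ] K) (c : K →L[ℂ] H) (d : H →L[ℂ] H) :
    WithLp 2 (K × H) →L[ℂ] WithLp 2 (K × H) :=
  (WithLp.prodContinuousLinearEquiv 2 ℂ K H).symm.toContinuousLinearMap ∘L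
    ((a ∘L WithLp.fstL 2 ℂ K H + b ∘L WithLp.sndL 2 ℂ K H).prod
      (c ∘L WithLp.fstL 2 ℂ K H + d ∘L WithLp.sndL 2 ℂ K H))

theorem star_block (a : K →L[ℂ] K) (b : H →L[ℂ] K) (c : K →L[ℂ] H) (d : H →L[ℂ] H) :
    star (block a b c d) = block (a†) (c†) (b†) (d†) := by
  rw [ContinuousLinearMap.star_eq_adjoint]
  symm
  rw [ContinuousLinearMap.eq_adjoint_iff]
  intro x y
  simp [block, WithLp.prod_inner_apply, inner_add_left, inner_add_right,
    ContinuousLinearMap.adjoint_inner_left]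
  ring

/-- `⟨X X*⟩`, the closed linear span of the operators `x y*` with `x, y ∈ X`. -/
def TRO.leftSpan (X : TRO H K) : Submodule ℂ (K →L[ℂ] K) :=
  (Submodule.span ℂ {T | ∃ x ∈ X.toSubmodule, ∃ y ∈ X.toSubmodule,
    T = x ∘L y†}).topologicalClosure

/-- `⟨X* X⟩`, the closed linear span of the operators `x* y` with `x, y ∈ X`. -/
def TRO.rightSpan (X : TRO H K) : Submodule ℂ (H →L[ℂ] H) :=
  (Submodule.span ℂ {T | ∃ x ∈ X.toSubmodule, ∃ y ∈ X.toSubmodule,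
    T = x† ∘L y}).topologicalClosure

/-- The linking algebra `A_X = (⟨X X*⟩, X; X*, ⟨X* X⟩)` in `B(K ⊕ H)`. -/
def TRO.linkingAlgebra (X : TRO H K) : Set (WithLp 2 (K × H) →L[ℂ] WithLp 2 (K × H)) :=
  {T | ∃ a ∈ X.leftSpan, ∃ x ∈ X.toSubmodule, ∃ y ∈ X.toSubmodule, ∃ d ∈ X.rightSpan,
    T = block a x (y†) d}

theorem star_mem_closure_span {L : Type*} [NormedAddCommGroup L] [InnerProductSpace ℂ L]
    [CompleteSpace L] (S : Set (L →L[ℂ] L)) (hS : ∀ T ∈ S, star T ∈ S) (T : L →L[ℂ] L)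
    (hT : T ∈ (Submodule.span ℂ S).topologicalClosure) :
    star T ∈ (Submodule.span ℂ S).topologicalClosure := by
  have key : ∀ T ∈ Submodule.span ℂ S, star T ∈ Submodule.span ℂ S := by
    intro T hT
    induction hT using Submodule.span_induction with
    | mem x hx => exact Submodule.subset_span (hS x hx)
    | zero => simp
    | add x y _ _ hx hy => rw [star_add]; exact add_mem hx hy
    | smul c x _ hx => rw [star_smul]; exact Submodule.smul_mem _ _ hx
  exact map_mem_closure (s := (Submodule.span ℂ S : Set (L →L[ℂ] L))) continuous_star hT key

theorem TRO.star_mem_linkingAlgebra (X : TRO H K)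
    (T : WithLp 2 (K × H) →L[ℂ] WithLp 2 (K × H)) (hT : T ∈ X.linkingAlgebra) :
    star T ∈ X.linkingAlgebra := by
  obtain ⟨a, ha, x, hx, y, hy, d, hd, rfl⟩ := hT
  refine ⟨a†, ?_, y, hy, x, hx, d†, ?_, ?_⟩
  · refine star_mem_closure_span _ ?_ a ha
    rintro _ ⟨u, hu, v, hv, rfl⟩
    exact ⟨v, hv, u, hu, by
      rw [ContinuousLinearMap.star_eq_adjoint, ContinuousLinearMap.adjoint_comp,
        ContinuousLinearMap.adjoint_adjoint]⟩
  · refine star_mem_closure_span _ ?_ d hd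
    rintro _ ⟨u, hu, v, hv, rfl⟩
    exact ⟨v, hv, u, hu, by
      rw [ContinuousLinearMap.star_eq_adjoint, ContinuousLinearMap.adjoint_comp,
        ContinuousLinearMap.adjoint_adjoint]⟩
  · rw [star_block, ContinuousLinearMap.adjoint_adjoint]

/-- The double commutant of a self-adjoint set of operators, as a von Neumann algebra. -/
def doubleCommutant {L : Type*} [NormedAddCommGroup L] [InnerProductSpace ℂ L] [CompleteSpace L]
    (S : Set (L →L[ℂ] L)) (hS : ∀ T ∈ S, star T ∈ S) : VonNeumannAlgebra L where
  toSubalgebra := Subalgebra.centralizer ℂ (Set.centralizer S)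
  star_mem' := by
    have h : ∀ (U : Set (L →L[ℂ] L)), (∀ T ∈ U, star T ∈ U) →
        ∀ T ∈ Set.centralizer U, star T ∈ Set.centralizer U := by
      intro U hU T hT V hV
      have := congrArg star (hT (star V) (hU V hV))
      simpa using this.symm
    intro T hT
    exact h _ (h S hS) T hT
  centralizer_centralizer' := Set.centralizer_centralizer_centralizer (Set.centralizer S)

/-- The linking von Neumann algebra `R_X = A_X''` in `B(K ⊕ H)`. -/
def WStarTRO.linking (X : WStarTRO H K) : VonNeumannAlgebra (WithLp 2 (K × H)) :=
  doubleCommutant X.linkingAlgebra X.star_mem_linkingAlgebra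

/-- The inclusion of `X` in `R_X` as the upper right corner, `x ↦ (0, x; 0, 0)`. -/
def WStarTRO.corner (X : WStarTRO H K) (x : X.toSubmodule) : X.linking.toStarSubalgebra :=
  ⟨block 0 x 0 0, Set.subset_centralizer_centralizer
    ⟨0, zero_mem _, x, x.2, 0, zero_mem _, 0, zero_mem _, by simp⟩⟩

end Linking

section Action

variable {G : Type*} [Group G] [TopologicalSpace G]
  {H K : Type*} [NormedAddCommGroup H] [InnerProductSpace ℂ H] [CompleteSpace H]
  [NormedAddCommGroup K] [InnerProductSpace ℂ K] [CompleteSpace K]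

/-- A homomorphism `α` from `G` to the group of linear bijections of a W*-TRO `X` is a continuous
action of `G` on `X` if every `α s` is a normal (that is, weak* continuous) TRO morphism and all
the orbit maps `s ↦ α s x` are weak* continuous. -/
structure WStarTRO.IsAction (X : WStarTRO H K)
    (α : G →* (X.toSubmodule ≃ₗ[ℂ] X.toSubmodule)) : Prop where
  map_ternary : ∀ (s : G) (a b c : X.toSubmodule),
    α s (X.ternary a b c) = X.ternary (α s a) (α s b) (α s c)
  normal : ∀ s : G, Continuous[ultraweakOn X.toSubmodule, ultraweakOn X.toSubmodule] (α s)
  continuous_orbit : ∀ x : X.toSubmodule,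
    @Continuous G X.toSubmodule _ (ultraweakOn X.toSubmodule) (fun s : G => α s x)

/-- A homomorphism `β` from `G` to the group of `*`-automorphisms of a von Neumann algebra `M` is
a continuous action of `G` on `M` if every `β s` is normal and all the orbit maps `s ↦ β s z` are
weak* continuous. -/
structure IsVNAction (M : VonNeumannAlgebra H)
    (β : G →* (M.toStarSubalgebra ≃⋆ₐ[ℂ] M.toStarSubalgebra)) : Prop where
  normal : ∀ s : G,
    Continuous[ultraweakOn M.toStarSubalgebra, ultraweakOn M.toStarSubalgebra] (β s)
  continuous_orbit : ∀ z : M.toStarSubalgebra,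
    @Continuous G M.toStarSubalgebra _ (ultraweakOn M.toStarSubalgebra) (fun s : G => β s z)

end Action

end WStarTernary

end

noncomputable section

set_option linter.unusedSectionVars false
set_option linter.style.haveILetI false

namespace WStarTernary

open scoped InnerProduct Topology

/-! ### Amplification of operators to square-summable sequences -/

section Amplification

variable {H K : Type*} [NormedAddCommGroup H] [InnerProductSpace ℂ H]
  [NormedAddCommGroup K] [InnerProductSpace ℂ K]

/-! Write `L = K ⊕ H` and replace `X` by the selfadjoint weak* closed space `S` of operators `(0, x;
y*, 0)` with `x, y ∈ X`. It is closed under triple products and anticommutes with the symmetry `J =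
diag(1, -1)`. Since `S'' = R_X` and an action on `X` is the same thing as a *-preserving triple
action `a` on `S`, everything can be done for a pair `(J, S)` (`OddTriple`).

Structure of `S''`. The operators whose odd part lies in `S` and whose even part multiplies `S` into
itself on both sides form a weak* closed space containing the unital *-algebra generated by `S`. By
the weak* bicommutant theorem it contains `S''`. So each `z ∈ S''` is an even multiplier of `S` plus
an element of `S`.

Extension. The ranges of the operators in `S` and their common null space together span a dense
subspace of `L`. Hence the image `T` of `z` is determined by `T a(s) = a(z₀ s) + a(z₁) a(s)`, with
`z₀, z₁` the even and odd parts, and by `T = z` on the null space (`IsLift`). For even `d` such an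
operator exists and is bounded because `d*d + c*c = ‖d‖² 1` for some even `c`: the map `a(s)ξ ↦
a(ds)ξ` and its analogue for `c` have squared norms adding up to `‖d‖²` times the original one
(`exists_even_lift`). Uniqueness of lifts yields all algebraic identities, the group law included.

Normality. For fixed `s` and `ξ`, the vector `T a(s)ξ` depends normally on `z`. Such vectors, with
the null space, are total, and normal functionals on a weak* closed space form a norm closed set
(`isNormal_of_approx`), so normality passes to all sequences of vectors.

Continuity of orbits. For even `y` the function `s ↦ ‖β_s(y)h‖²` is lower semicontinuous: an
approximate unit built from `S` bounds it below by functions involving only orbits in `S`. Applying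
this also to the complement `c` of `y` gives upper semicontinuity. Polarization then handles all
even elements.

Uniqueness. Two normal *-automorphisms agreeing on `S` agree on the algebra generated by `S`, and
then on `S''` by the bicommutant theorem. -/

theorem memℓp_comp (T : H →L[ℂ] K) (h : lp (fun _ : ℕ => H) 2) :
    Memℓp (fun n => T (h n)) 2 := by
  have h2 := (memℓp_gen_iff (p := 2) (by norm_num)).1 (lp.memℓp h)
  refine memℓp_gen ((h2.mul_left (‖T‖ ^ 2)).of_nonneg_of_le (fun n => by positivity) fun n => ?_)
  simp only [ENNReal.toReal_ofNat, Real.rpow_ofNat]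
  rw [← mul_pow]
  exact pow_le_pow_left₀ (norm_nonneg _) (T.le_opNorm _) 2

theorem lp_norm_sq (h : lp (fun _ : ℕ => H) 2) : ‖h‖ ^ 2 = ∑' n, ‖h n‖ ^ 2 := by
  simpa using lp.norm_rpow_eq_tsum (p := 2) (by norm_num) h

theorem lp_summable_norm_sq (h : lp (fun _ : ℕ => H) 2) : Summable fun n => ‖h n‖ ^ 2 := by
  simpa using (memℓp_gen_iff (p := 2) (by norm_num)).1 (lp.memℓp h)

/-- The amplification `T ⊗ 1` of an operator, acting coordinatewise on square-summable
sequences. -/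
def ampl (T : H →L[ℂ] K) : lp (fun _ : ℕ => H) 2 →L[ℂ] lp (fun _ : ℕ => K) 2 :=
  LinearMap.mkContinuous
    { toFun := fun h => ⟨fun n => T (h n), memℓp_comp T h⟩
      map_add' := fun x y => by ext n; exact T.map_add (x n) (y n)
      map_smul' := fun c x => by ext n; simp }
    ‖T‖ (fun h => by
      rw [← abs_of_nonneg (norm_nonneg (_ : lp (fun _ : ℕ => K) 2)),
        ← abs_of_nonneg (show 0 ≤ ‖T‖ * ‖h‖ by positivity), ← sq_le_sq, mul_pow, lp_norm_sq,
        lp_norm_sq, ← tsum_mul_left]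
      refine Summable.tsum_le_tsum (fun n => ?_) (lp_summable_norm_sq _)
        ((lp_summable_norm_sq h).mul_left _)
      rw [← mul_pow]
      exact pow_le_pow_left₀ (norm_nonneg _) (T.le_opNorm _) 2)

@[simp] theorem ampl_apply (T : H →L[ℂ] K) (h : lp (fun _ : ℕ => H) 2) (n : ℕ) :
    ampl T h n = T (h n) := rfl

/-- A square-summable family of square-summable sequences, written as one sequence. -/
theorem exists_lp_pair (h : ℕ → lp (fun _ : ℕ => H) 2) (hs : Summable fun m => ‖h m‖ ^ 2) :
    ∃ h' : lp (fun _ : ℕ => H) 2, (∀ m n, h' (Nat.pair m n) = h m n) ∧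
      ‖h'‖ ^ 2 = ∑' m, ‖h m‖ ^ 2 := by
  have hp : Summable fun p : ℕ × ℕ => ‖h p.1 p.2‖ ^ 2 := by
    rw [summable_prod_of_nonneg (fun _ => by positivity)]
    exact ⟨fun m => lp_summable_norm_sq (h m), by simpa only [lp_norm_sq] using hs⟩
  have hq : Summable fun n : ℕ => ‖h (Nat.unpair n).1 (Nat.unpair n).2‖ ^ 2 :=
    Nat.pairEquiv.symm.summable_iff (f := fun p : ℕ × ℕ => ‖h p.1 p.2‖ ^ 2) |>.2 hp
  refine ⟨⟨fun n => h (Nat.unpair n).1 (Nat.unpair n).2, memℓp_gen (by simpa using hq)⟩,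
    fun m n => by simp, ?_⟩
  rw [lp_norm_sq]
  refine (Nat.pairEquiv.symm.tsum_eq (fun p : ℕ × ℕ => ‖h p.1 p.2‖ ^ 2)).trans ?_
  rw [hp.tsum_prod]
  simp only [lp_norm_sq]

end Amplification

/-! ### Functionals in the predual and the weak* topology -/

section NormalFunctional

variable {H K : Type*} [NormedAddCommGroup H] [InnerProductSpace ℂ H] [CompleteSpace H]
  [NormedAddCommGroup K] [InnerProductSpace ℂ K] [CompleteSpace K]

theorem normalFunctional_eq_inner (h : lp (fun _ : ℕ => H) 2) (k : lp (fun _ : ℕ => K) 2)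
    (T : H →L[ℂ] K) : normalFunctional h k T = inner ℂ k (ampl T h) :=
  (lp.inner_eq_tsum k (ampl T h)).symm

theorem summable_normalFunctional (h : lp (fun _ : ℕ => H) 2) (k : lp (fun _ : ℕ => K) 2)
    (T : H →L[ℂ] K) : Summable fun n => inner ℂ (k n) (T (h n)) :=
  lp.summable_inner k (ampl T h)

theorem ampl_norm_le (T : H →L[ℂ] K) : ‖ampl T‖ ≤ ‖T‖ :=
  LinearMap.mkContinuous_norm_le _ (norm_nonneg _) _

theorem norm_normalFunctional_le (h : lp (fun _ : ℕ => H) 2) (k : lp (fun _ : ℕ => K) 2)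
    (T : H →L[ℂ] K) : ‖normalFunctional h k T‖ ≤ ‖k‖ * ‖h‖ * ‖T‖ := by
  rw [normalFunctional_eq_inner]
  calc _ ≤ ‖k‖ * ‖ampl T h‖ := norm_inner_le_norm _ _
    _ ≤ ‖k‖ * (‖T‖ * ‖h‖) := by
        gcongr
        exact (ampl T).le_of_opNorm_le (ampl_norm_le T) h
    _ = _ := by ring

/-- `normalFunctional h k` as a linear map. -/
def normalFunctionalₗ (h : lp (fun _ : ℕ => H) 2) (k : lp (fun _ : ℕ => K) 2) :
    (H →L[ℂ] K) →ₗ[ℂ] ℂ where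
  toFun := normalFunctional h k
  map_add' S T := by
    simp only [normalFunctional_eq_inner, ← inner_add_right]; congr 1
  map_smul' c T := by
    simp only [normalFunctional_eq_inner, RingHom.id_apply, smul_eq_mul, ← inner_smul_right]
    congr 1

@[simp] theorem normalFunctionalₗ_apply (h : lp (fun _ : ℕ => H) 2) (k : lp (fun _ : ℕ => K) 2)
    (T : H →L[ℂ] K) : normalFunctionalₗ h k T = normalFunctional h k T := rfl

/-- The sequences are concatenated along a bijection `ℕ × ℕ ≃ ℕ`. This makes the normal functionals
stable under suitable infinite sums, which is what the completeness argument for the predual needs.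
-/
theorem exists_normalFunctional_tsum (h : ℕ → lp (fun _ : ℕ => H) 2)
    (k : ℕ → lp (fun _ : ℕ => K) 2)
    (hh : Summable fun m => ‖h m‖ ^ 2) (hk : Summable fun m => ‖k m‖ ^ 2) :
    ∃ h' k', ‖h'‖ ^ 2 = ∑' m, ‖h m‖ ^ 2 ∧ ‖k'‖ ^ 2 = ∑' m, ‖k m‖ ^ 2 ∧
      ∀ T : H →L[ℂ] K,
        HasSum (fun m => normalFunctional (h m) (k m) T) (normalFunctional h' k' T) := by
  obtain ⟨h', h1, h2⟩ := exists_lp_pair h hh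
  obtain ⟨k', k1, k2⟩ := exists_lp_pair k hk
  refine ⟨h', k', h2, k2, fun T => ?_⟩
  have hs := (summable_normalFunctional h' k' T).hasSum
  rw [← Nat.pairEquiv.hasSum_iff] at hs
  refine hs.prod_fiberwise fun m => ?_
  convert (summable_normalFunctional (h m) (k m) T).hasSum using 2 with n
  · change _ = inner ℂ (k m n) (T (h m n))
    rw [← h1, ← k1]
    rfl
  · rfl

theorem hasSum_ite_pair {E : Type*} [AddCommMonoid E] [TopologicalSpace E] (a b : E) :
    HasSum (fun n : ℕ => if n = 0 then a else if n = 1 then b else 0) (a + b) := by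
  convert hasSum_sum_of_ne_finset_zero (s := Finset.range 2) (L := .unconditional ℕ) ?_ using 1
  · simp [Finset.sum_range_succ]
  · intro n hn
    simp only [Finset.mem_range, not_lt] at hn
    rw [if_neg (by omega), if_neg (by omega)]

theorem norm_sq_ite_pair {E : Type*} [NormedAddCommGroup E] (a b : E) :
    (fun n : ℕ => ‖if n = 0 then a else if n = 1 then b else 0‖ ^ 2) =
      fun n : ℕ => if n = 0 then ‖a‖ ^ 2 else if n = 1 then ‖b‖ ^ 2 else 0 := by
  ext n; split_ifs <;> simp

/-- The exact norms are recorded because convexity of the set of functionals given by unit-ball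
sequences depends on them. -/
theorem exists_normalFunctional_add (h h' : lp (fun _ : ℕ => H) 2)
    (k k' : lp (fun _ : ℕ => K) 2) :
    ∃ h'' k'', ‖h''‖ ^ 2 = ‖h‖ ^ 2 + ‖h'‖ ^ 2 ∧ ‖k''‖ ^ 2 = ‖k‖ ^ 2 + ‖k'‖ ^ 2 ∧
      ∀ T : H →L[ℂ] K,
        normalFunctional h'' k'' T = normalFunctional h k T + normalFunctional h' k' T := by
  obtain ⟨h'', k'', h1, k1, H1⟩ := exists_normalFunctional_tsum
    (fun n => if n = 0 then h else if n = 1 then h' else 0)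
    (fun n => if n = 0 then k else if n = 1 then k' else 0)
    (by rw [norm_sq_ite_pair]; exact (hasSum_ite_pair _ _).summable) (by rw [norm_sq_ite_pair]; exact (hasSum_ite_pair _ _).summable)
  refine ⟨h'', k'', ?_, ?_, fun T => (H1 T).unique ?_⟩
  · rw [h1, norm_sq_ite_pair, (hasSum_ite_pair _ _).tsum_eq]
  · rw [k1, norm_sq_ite_pair, (hasSum_ite_pair _ _).tsum_eq]
  · convert hasSum_ite_pair (normalFunctional h k T) (normalFunctional h' k' T) using 2 with n
    split_ifs <;> simp [normalFunctional]

theorem normalFunctional_smul_left (c : ℂ) (h : lp (fun _ : ℕ => H) 2)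
    (k : lp (fun _ : ℕ => K) 2) (T : H →L[ℂ] K) :
    normalFunctional (c • h) k T = c * normalFunctional h k T := by
  rw [normalFunctional_eq_inner, normalFunctional_eq_inner, map_smul, inner_smul_right]

theorem normalFunctional_smul_right (c : ℂ) (h : lp (fun _ : ℕ => H) 2)
    (k : lp (fun _ : ℕ => K) 2) (T : H →L[ℂ] K) :
    normalFunctional h (c • k) T = (starRingEnd ℂ) c * normalFunctional h k T := by
  rw [normalFunctional_eq_inner, normalFunctional_eq_inner, inner_smul_left]

theorem normalFunctional_adjoint (h : lp (fun _ : ℕ => H) 2) (k : lp (fun _ : ℕ => K) 2)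
    (T : K →L[ℂ] H) :
    normalFunctional h k (T†) = (starRingEnd ℂ) (normalFunctional k h T) := by
  simp only [normalFunctional, ContinuousLinearMap.adjoint_inner_right, Complex.conj_tsum,
    inner_conj_symm]

theorem normalFunctional_comp {H' K' : Type*} [NormedAddCommGroup H'] [InnerProductSpace ℂ H']
    [CompleteSpace H'] [NormedAddCommGroup K'] [InnerProductSpace ℂ K'] [CompleteSpace K']
    (a : K →L[ℂ] K') (b : H' →L[ℂ] H) (h : lp (fun _ : ℕ => H') 2)
    (k : lp (fun _ : ℕ => K') 2) (T : H →L[ℂ] K) :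
    normalFunctional h k (a ∘L T ∘L b) = normalFunctional (ampl b h) (ampl (a†) k) T := by
  simp [normalFunctional, ContinuousLinearMap.adjoint_inner_left]

theorem normalFunctional_single (x : H) (y : K) (T : H →L[ℂ] K) :
    normalFunctional (lp.single 2 0 x) (lp.single 2 0 y) T = inner ℂ y (T x) := by
  rw [normalFunctional, tsum_eq_single 0]
  · simp
  · intro n hn
    rw [lp.single_apply_ne _ _ _ hn]; simp

/-- A linear functional is normal along `j : E →ₗ B(H; K)` if it is the pullback of a functional
in the predual of `B(H; K)`. -/
def IsNormal {E : Type*} [AddCommGroup E] [Module ℂ E] (j : E →ₗ[ℂ] (H →L[ℂ] K))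
    (φ : E →ₗ[ℂ] ℂ) : Prop :=
  ∃ h k, ∀ x, φ x = normalFunctional h k (j x)

/-- The normal functionals along `j` form a subspace. -/
def normals {E : Type*} [AddCommGroup E] [Module ℂ E] (j : E →ₗ[ℂ] (H →L[ℂ] K)) :
    Submodule ℂ (E →ₗ[ℂ] ℂ) where
  carrier := {φ | IsNormal j φ}
  add_mem' := by
    rintro φ ψ ⟨h, k, hφ⟩ ⟨h', k', hψ⟩
    obtain ⟨h'', k'', -, -, H⟩ := exists_normalFunctional_add h h' k k'
    exact ⟨h'', k'', fun x => by simp [hφ, hψ, H]⟩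
  zero_mem' := ⟨0, 0, fun x => by simp [normalFunctional]⟩
  smul_mem' := by
    rintro c φ ⟨h, k, hφ⟩
    exact ⟨c • h, k, fun x => by simp [hφ, normalFunctional_smul_left]⟩

theorem mem_normals {E : Type*} [AddCommGroup E] [Module ℂ E] {j : E →ₗ[ℂ] (H →L[ℂ] K)}
    {φ : E →ₗ[ℂ] ℂ} : φ ∈ normals j ↔ IsNormal j φ := Iff.rfl

theorem induced_ultraweak {E : Type*} (j : E → (H →L[ℂ] K)) :
    TopologicalSpace.induced j (ultraweak H K) =
      ⨅ p : lp (fun _ : ℕ => H) 2 × lp (fun _ : ℕ => K) 2,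
        TopologicalSpace.induced (fun x => normalFunctional p.1 p.2 (j x)) inferInstance := by
  simp only [ultraweak, induced_iInf, induced_compose, iInf_prod, Function.comp_def]

theorem continuous_induced_ultraweak_iff {E Y : Type*} [tY : TopologicalSpace Y]
    (j : E → (H →L[ℂ] K)) (f : Y → E) :
    Continuous[tY, TopologicalSpace.induced j (ultraweak H K)] f ↔
      ∀ h k, Continuous fun y => normalFunctional h k (j (f y)) := by
  rw [induced_ultraweak, continuous_iInf_rng, Prod.forall]
  simp only [continuous_induced_rng, Function.comp_def]

/-- A linear functional continuous for the topology induced by a family of functionals is in their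
linear span; here the family is already a subspace, so a single pair of sequences suffices. -/
theorem isNormal_iff_continuous {E : Type*} [AddCommGroup E] [Module ℂ E]
    (j : E →ₗ[ℂ] (H →L[ℂ] K)) (φ : E →ₗ[ℂ] ℂ) :
    IsNormal j φ ↔
      Continuous[TopologicalSpace.induced j (ultraweak H K), inferInstance] φ := by
  rw [induced_ultraweak]
  refine Iff.trans ?_ (LinearMap.mem_span_iff_continuous (f := fun p :
    lp (fun _ : ℕ => H) 2 × lp (fun _ : ℕ => K) 2 => normalFunctionalₗ p.1 p.2 ∘ₗ j) φ)
  rw [← mem_normals]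
  constructor
  · rintro ⟨h, k, H⟩
    exact Submodule.subset_span ⟨(h, k), by ext x; simp [H]⟩
  · intro hφ
    refine (Submodule.span_le.2 ?_) hφ
    rintro _ ⟨p, rfl⟩
    exact ⟨p.1, p.2, fun x => rfl⟩

/-- Points are separated from weak* closed subspaces by functionals in the predual. -/
theorem exists_normalFunctional_ne_zero (N : Submodule ℂ (H →L[ℂ] K))
    (hN : IsClosed[ultraweak H K] (N : Set (H →L[ℂ] K))) {T : H →L[ℂ] K} (hT : T ∉ N) :
    ∃ h k, (∀ S ∈ N, normalFunctional h k S = 0) ∧ normalFunctional h k T ≠ 0 := by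
  -- Stated for a bare vector space, so that the weak topology can be made the ambient one without
  -- competing with the norm topology of `B(H; K)`.
  have gen : ∀ (E : Type _) [AddCommGroup E] [Module ℂ E] (ι : Type _) (f : ι → E →ₗ[ℂ] ℂ)
      (N : Submodule ℂ E)
      (t : TopologicalSpace E) (_ : t = ⨅ i, TopologicalSpace.induced (f i) inferInstance)
      (_ : IsClosed[t] (N : Set E)) (x : E) (_ : x ∉ N),
        ∃ φ ∈ Submodule.span ℂ (Set.range f), (∀ y ∈ N, φ y = 0) ∧ φ x ≠ 0 := by
    rintro E _ _ ι f N _ rfl hN x hx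
    letI tE : TopologicalSpace E := ⨅ i, TopologicalSpace.induced (f i) inferInstance
    haveI : IsTopologicalAddGroup E :=
      topologicalAddGroup_iInf fun _ ↦ topologicalAddGroup_induced _
    haveI : ContinuousSMul ℂ E := continuousSMul_iInf fun _ ↦ continuousSMul_induced _
    haveI : LocallyConvexSpace ℝ E :=
      LocallyConvexSpace.iInf fun i => LocallyConvexSpace.induced ((f i).restrictScalars ℝ)
    haveI : ContinuousSMul ℝ E := IsScalarTower.continuousSMul ℂ
    obtain ⟨F, u, h1, h2⟩ := RCLike.geometric_hahn_banach_point_closed (𝕜 := ℂ)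
      (N.restrictScalars ℝ).convex hN hx
    have h0 : u < 0 := by simpa using h2 0 N.zero_mem
    -- A functional bounded below on a subspace vanishes there: otherwise some multiple of `y` would
    -- take the forbidden value `u`.
    have hF : ∀ y ∈ N, F y = 0 := by
      intro y hy
      by_contra hne
      have := h2 (((u : ℂ) / F y) • y) (N.smul_mem _ hy)
      rw [map_smul, smul_eq_mul, div_mul_cancel₀ _ hne] at this
      simp at this
    refine ⟨F.toLinearMap, (LinearMap.mem_span_iff_continuous _).2 F.cont, hF, fun hz => ?_⟩
    change F x = 0 at hz
    rw [hz] at h1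
    simp only [map_zero] at h1
    linarith
  obtain ⟨φ, hφ, h1, h2⟩ := gen _ _ (fun p : lp (fun _ : ℕ => H) 2 × lp (fun _ : ℕ => K) 2 =>
    normalFunctionalₗ p.1 p.2) N (ultraweak H K) (by rw [iInf_prod]; rfl) hN T hT
  have : φ ∈ normals (LinearMap.id : (H →L[ℂ] K) →ₗ[ℂ] _) := by
    refine (Submodule.span_le.2 ?_) hφ
    rintro _ ⟨p, rfl⟩
    exact ⟨p.1, p.2, fun x => rfl⟩
  obtain ⟨h, k, H⟩ := this
  exact ⟨h, k, fun S hS => by simpa [H] using h1 S hS, by simpa [H] using h2⟩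

end NormalFunctional

/-! ### Norm closedness of the predual of a weak* closed space -/

section Predual

variable {L : Type*} [NormedAddCommGroup L] [InnerProductSpace ℂ L] [CompleteSpace L]
  {E : Type*} [NormedAddCommGroup E] [NormedSpace ℂ E]

/-- The restriction of `normalFunctional h k` to a subspace, as a bounded functional. -/
def restrictedFunctional (j : E →ₗᵢ[ℂ] (L →L[ℂ] L)) (h k : lp (fun _ : ℕ => L) 2) :
    StrongDual ℂ E :=
  LinearMap.mkContinuous (normalFunctionalₗ h k ∘ₗ j.toLinearMap) (‖k‖ * ‖h‖)
    fun T => (norm_normalFunctional_le h k (j T)).trans_eq (by rw [j.norm_map])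

@[simp] theorem restrictedFunctional_apply (j : E →ₗᵢ[ℂ] (L →L[ℂ] L))
    (h k : lp (fun _ : ℕ => L) 2) (T : E) :
    restrictedFunctional j h k T = normalFunctional h k (j T) := rfl

/-- The restriction of `T ↦ ⟪k, T h⟫` to a subspace. -/
def rankOneFunctional (j : E →ₗᵢ[ℂ] (L →L[ℂ] L)) (h k : L) : StrongDual ℂ E :=
  innerSL ℂ k ∘L ContinuousLinearMap.apply ℂ L h ∘L j.toContinuousLinearMap

@[simp] theorem rankOneFunctional_apply (j : E →ₗᵢ[ℂ] (L →L[ℂ] L)) (h k : L) (T : E) :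
    rankOneFunctional j h k T = inner ℂ k ((j T) h) := rfl

theorem norm_rankOneFunctional_le (j : E →ₗᵢ[ℂ] (L →L[ℂ] L)) (h k : L) :
    ‖rankOneFunctional j h k‖ ≤ ‖k‖ * ‖h‖ := by
  refine ContinuousLinearMap.opNorm_le_bound _ (by positivity) fun T => ?_
  rw [rankOneFunctional_apply]
  calc _ ≤ ‖k‖ * ‖(j T) h‖ := norm_inner_le_norm _ _
    _ ≤ ‖k‖ * (‖(j T)‖ * ‖h‖) := by gcongr; exact ContinuousLinearMap.le_opNorm _ _
    _ = _ := by rw [j.norm_map]; ring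

theorem hasSum_rankOneFunctional (j : E →ₗᵢ[ℂ] (L →L[ℂ] L)) (h k : lp (fun _ : ℕ => L) 2) :
    HasSum (fun n => rankOneFunctional j (h n) (k n)) (restrictedFunctional j h k) := by
  have hs : Summable fun n => rankOneFunctional j (h n) (k n) := by
    refine Summable.of_norm_bounded
      (((lp_summable_norm_sq k).add (lp_summable_norm_sq h)).mul_left (1 / 2)) fun n => ?_
    refine (norm_rankOneFunctional_le _ _ _).trans ?_
    nlinarith [sq_nonneg (‖k n‖ - ‖h n‖)]
  convert hs.hasSum using 1
  ext T
  have := (ContinuousLinearMap.apply ℂ ℂ T).hasSum hs.hasSum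
  exact (summable_normalFunctional h k (j T)).hasSum.unique this

/-- A functional on the dual of a space of operators is, on the restrictions of functionals in the
predual, given by an operator. -/
theorem exists_operator (j : E →ₗᵢ[ℂ] (L →L[ℂ] L)) (F : StrongDual ℂ (StrongDual ℂ E)) :
    ∃ T : L →L[ℂ] L, ∀ h k, F (restrictedFunctional j h k) = normalFunctional h k T := by
  -- The values of `F` on rank one functionals form a bounded sesquilinear form, hence come from an
  -- operator; the norm convergent expansion into rank one functionals carries this over to all
  -- restricted functionals.
  let b : L →ₗ⋆[ℂ] L →ₗ[ℂ] ℂ := LinearMap.mk₂'ₛₗ (starRingEnd ℂ) (RingHom.id ℂ)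
    (fun k h => F (rankOneFunctional j h k))
    (fun k k' h => by rw [← map_add]; congr 1; ext T; simp only [rankOneFunctional_apply, add_apply, inner_add_left])
    (fun c k h => by rw [← map_smul]; congr 1; ext T; simp only [rankOneFunctional_apply, smul_apply, inner_smul_left, smul_eq_mul])
    (fun k h h' => by rw [← map_add]; congr 1; ext T; simp only [rankOneFunctional_apply, add_apply, map_add, inner_add_right])
    (fun c k h => by
      rw [RingHom.id_apply, ← map_smul]; congr 1; ext T; simp only [rankOneFunctional_apply, smul_apply, map_smul, inner_smul_right, smul_eq_mul])
  let B : L →L⋆[ℂ] L →L[ℂ] ℂ := b.mkContinuous₂ ‖F‖ fun k h => by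
    refine (F.le_opNorm _).trans ?_
    rw [mul_assoc]
    exact mul_le_mul_of_nonneg_left (norm_rankOneFunctional_le j h k) (norm_nonneg _)
  refine ⟨(InnerProductSpace.continuousLinearMapOfBilin B)†, fun h k => ?_⟩
  have h1 := F.hasSum (hasSum_rankOneFunctional j h k)
  rw [← h1.tsum_eq, normalFunctional]
  refine tsum_congr fun n => ?_
  rw [ContinuousLinearMap.adjoint_inner_right,
    InnerProductSpace.continuousLinearMapOfBilin_apply]
  rfl

/-- The restrictions to `M` of the functionals in the predual given by sequences in the unit
ball. -/
def unitFunctionals (j : E →ₗᵢ[ℂ] (L →L[ℂ] L)) : Set (StrongDual ℂ E) :=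
  {c | ∃ h k, ‖h‖ ≤ 1 ∧ ‖k‖ ≤ 1 ∧ c = restrictedFunctional j h k}

/-- A convex combination is realised by concatenating the sequences with weights `√a` and `√b`; the
squared norms then average to at most `1`. -/
theorem convex_unitFunctionals (j : E →ₗᵢ[ℂ] (L →L[ℂ] L)) :
    Convex ℝ (unitFunctionals j) := by
  rintro _ ⟨h, k, hh, hk, rfl⟩ _ ⟨h', k', hh', hk', rfl⟩ a b ha hb hab
  have hsq : ∀ (x y : lp (fun _ : ℕ => L) 2), ‖x‖ ≤ 1 → ‖y‖ ≤ 1 →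
      ‖((√a : ℝ) : ℂ) • x‖ ^ 2 + ‖((√b : ℝ) : ℂ) • y‖ ^ 2 ≤ 1 := by
    intro x y hx hy
    rw [norm_smul, norm_smul, mul_pow, mul_pow]
    simp only [Complex.norm_real, Real.norm_eq_abs, sq_abs, Real.sq_sqrt ha, Real.sq_sqrt hb]
    have := pow_le_one₀ (n := 2) (norm_nonneg x) hx
    have := pow_le_one₀ (n := 2) (norm_nonneg y) hy
    nlinarith
  obtain ⟨h'', k'', h1, k1, H⟩ := exists_normalFunctional_add (((√a : ℝ) : ℂ) • h)
    (((√b : ℝ) : ℂ) • h') (((√a : ℝ) : ℂ) • k) (((√b : ℝ) : ℂ) • k')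
  refine ⟨h'', k'', ?_, ?_, ?_⟩
  · have := hsq h h' hh hh'
    rw [← h1] at this
    exact (sq_le_one_iff₀ (norm_nonneg _)).1 this
  · have := hsq k k' hk hk'
    rw [← k1] at this
    exact (sq_le_one_iff₀ (norm_nonneg _)).1 this
  · ext T
    simp only [add_apply, smul_apply,
      restrictedFunctional_apply, H, normalFunctional_smul_left, normalFunctional_smul_right,
      Complex.conj_ofReal, ← mul_assoc, ← Complex.ofReal_mul, Real.mul_self_sqrt ha,
      Real.mul_self_sqrt hb, Complex.real_smul]

/-- The restrictions to `M` of the functionals in the predual. -/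
def restrictedFunctionals (j : E →ₗᵢ[ℂ] (L →L[ℂ] L)) : Submodule ℂ (StrongDual ℂ E) :=
  (normals j.toLinearMap).comap (ContinuousLinearMap.coeLM ℂ)

theorem mem_restrictedFunctionals {j : E →ₗᵢ[ℂ] (L →L[ℂ] L)} {φ : StrongDual ℂ E} :
    φ ∈ restrictedFunctionals j ↔ ∃ h k, φ = restrictedFunctional j h k := by
  constructor
  · rintro ⟨h, k, H⟩
    exact ⟨h, k, by ext T; exact H T⟩
  · rintro ⟨h, k, rfl⟩
    exact ⟨h, k, fun T => rfl⟩

/-- Hahn–Banach: a functional `F` on the dual separating `φ` from the convex set is represented on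
normal functionals by an operator, which weak* closedness puts into the space itself. The separation
constant then dominates the norm of that operator, contradicting `‖φ‖ ≤ 1`. -/
theorem mem_closure_unitFunctionals (j : E →ₗᵢ[ℂ] (L →L[ℂ] L))
    (hM : IsClosed[ultraweak L L] (Set.range j)) {φ : StrongDual ℂ E}
    (hφ : φ ∈ (restrictedFunctionals j).topologicalClosure) (h1 : ‖φ‖ ≤ 1) :
    φ ∈ closure (unitFunctionals j) := by
  by_contra hn
  obtain ⟨F, u, hu, huφ⟩ := RCLike.geometric_hahn_banach_closed_point (𝕜 := ℂ)
    (convex_unitFunctionals j).closure isClosed_closure hn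
  obtain ⟨T, hT⟩ := exists_operator j F
  -- A normal functional vanishing on the space restricts to zero, so `F`, and with it the operator
  -- `T`, is annihilated by it.
  obtain ⟨t, rfl⟩ : T ∈ LinearMap.range j.toLinearMap := by
    by_contra hTM
    obtain ⟨h, k, h0, hne⟩ := exists_normalFunctional_ne_zero _ hM hTM
    refine hne ?_
    rw [← hT, show restrictedFunctional j h k = 0 from by ext S; exact h0 _ ⟨S, rfl⟩, map_zero]
  have hFT : ∀ ψ ∈ (restrictedFunctionals j).topologicalClosure, F ψ = ψ t := by
    intro ψ hψ
    refine closure_minimal (t := {ψ : StrongDual ℂ E | F ψ = ψ t}) ?_ ?_ hψ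
    · intro ψ hψ
      obtain ⟨h, k, rfl⟩ := mem_restrictedFunctionals.1 hψ
      exact hT h k
    · exact isClosed_eq F.continuous (ContinuousLinearMap.apply ℂ ℂ (t)).continuous
  have hu0 : 0 < u := by
    have := hu 0 (subset_closure ⟨0, 0, by simp, by simp, by ext S; simp [normalFunctional]⟩)
    simpa using this
  -- The rank one functionals of unit vectors belong to the set; a phase makes the value real and
  -- nonnegative.
  have key : ∀ x y : L, ‖x‖ = 1 → ‖y‖ = 1 → ‖inner ℂ y (j t x)‖ ≤ u := by
    intro x y hx hy
    by_cases h0 : inner ℂ y (j t x) = 0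
    · simp [h0, hu0.le]
    set z : ℂ := inner ℂ y (j t x)
    have hz : ‖(‖z‖ : ℂ)‖ = ‖z‖ := by simp
    have hz0 : (‖z‖ : ℂ) ≠ 0 := by simpa using h0
    have := hu _ (subset_closure ⟨((‖z‖ : ℂ) / z) • lp.single 2 0 x, lp.single 2 0 y, ?_, ?_, rfl⟩)
    · rw [hT, normalFunctional_smul_left, normalFunctional_single] at this
      change RCLike.re ((‖z‖ : ℂ) / z * z) < u at this
      rw [div_mul_cancel₀ _ h0] at this
      simpa using this.le
    · rw [norm_smul, lp.norm_single (by norm_num), hx, norm_div, hz, div_self (by simpa using h0),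
        one_mul]
    · rw [lp.norm_single (by norm_num), hy]
  have hTn : ‖t‖ ≤ u := by
    rw [← j.norm_map]
    refine (j t).opNorm_le_of_unit_norm hu0.le fun x hx => ?_
    by_cases h0 : j t x = 0
    · simp [h0, hu0.le]
    have := key x (((‖j t x‖⁻¹ : ℝ) : ℂ) • j t x) hx (by
      rw [norm_smul]; simp [h0])
    rw [inner_smul_left, inner_self_eq_norm_sq_to_K, norm_mul] at this
    simp only [Complex.conj_ofReal, Complex.norm_real, norm_inv, norm_norm, Complex.coe_algebraMap,
      norm_pow] at this
    rwa [sq, ← mul_assoc, inv_mul_cancel₀ (by simpa using h0), one_mul] at this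
  rw [hFT φ hφ] at huφ
  have h3 : RCLike.re (φ t) ≤ ‖φ‖ * ‖t‖ :=
    (RCLike.re_le_norm _).trans (φ.le_opNorm t)
  nlinarith [norm_nonneg φ, norm_nonneg t]

/-- The restrictions of predual functionals to a weak* closed subspace of `B(L)` form a norm closed
space of functionals. -/
theorem isClosed_restrictedFunctionals (j : E →ₗᵢ[ℂ] (L →L[ℂ] L))
    (hM : IsClosed[ultraweak L L] (Set.range j)) {φ : StrongDual ℂ E}
    (hφ : φ ∈ (restrictedFunctionals j).topologicalClosure) :
    φ ∈ restrictedFunctionals j := by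
  set W := (restrictedFunctionals j).topologicalClosure
  -- Rescaling to the unit ball: the error left after subtracting one normal functional is at most
  -- half the previous bound.
  have step : ∀ (r : ℝ) (ψ : W), 0 < r → ‖(ψ : StrongDual ℂ E)‖ ≤ r →
      ∃ h k, ‖h‖ ≤ 1 ∧ ‖k‖ ≤ 1 ∧
        ‖(ψ : StrongDual ℂ E) - (r : ℂ) • restrictedFunctional j h k‖ ≤ r / 2 := by
    intro r ψ hr hψ
    have h1 : ‖((r⁻¹ : ℝ) : ℂ) • (ψ : StrongDual ℂ E)‖ ≤ 1 := by
      rw [norm_smul, Complex.norm_real, Real.norm_of_nonneg (by positivity)]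
      rw [inv_mul_le_iff₀ hr]; simpa using hψ
    obtain ⟨_, ⟨h, k, hh, hk, rfl⟩, hd⟩ := Metric.mem_closure_iff.1
      (mem_closure_unitFunctionals j hM (W.smul_mem _ ψ.2) h1) (1 / 2) (by norm_num)
    refine ⟨h, k, hh, hk, ?_⟩
    have : (ψ : StrongDual ℂ E) - (r : ℂ) • restrictedFunctional j h k =
        (r : ℂ) • (((r⁻¹ : ℝ) : ℂ) • (ψ : StrongDual ℂ E) - restrictedFunctional j h k) := by
      rw [smul_sub, smul_smul, ← Complex.ofReal_mul, mul_inv_cancel₀ hr.ne', Complex.ofReal_one,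
        one_smul]
    rw [this, norm_smul, Complex.norm_real, Real.norm_of_nonneg hr.le]
    rw [dist_eq_norm] at hd
    nlinarith
  obtain ⟨r, hr0, hr⟩ : ∃ r : ℝ, 0 < r ∧ ‖φ‖ ≤ r := ⟨‖φ‖ + 1, by positivity, by linarith⟩
  choose! h k hh hk hd using step
  have hmem : ∀ (r : ℝ) (ψ : W),
      (ψ : StrongDual ℂ E) - (r : ℂ) • restrictedFunctional j (h r ψ) (k r ψ) ∈ W := fun r ψ =>
    W.sub_mem ψ.2 (W.smul_mem _ ((restrictedFunctionals j).le_topologicalClosure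
      (mem_restrictedFunctionals.2 ⟨_, _, rfl⟩)))
  obtain ⟨ψ, hψ0, hψs⟩ : ∃ ψ : ℕ → W, (ψ 0).1 = φ ∧ ∀ n, (ψ (n + 1)).1 = (ψ n).1 -
      ((r / 2 ^ n : ℝ) : ℂ) •
        restrictedFunctional j (h (r / 2 ^ n) (ψ n)) (k (r / 2 ^ n) (ψ n)) :=
    ⟨fun n => Nat.rec (motive := fun _ => W) ⟨φ, hφ⟩ (fun n ψ => ⟨_, hmem (r / 2 ^ n) ψ⟩) n,
      rfl, fun n => rfl⟩
  have hψn : ∀ n, ‖(ψ n).1‖ ≤ r / 2 ^ n := by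
    intro n
    induction n with
    | zero => rw [hψ0]; simpa using hr
    | succ n ih =>
      rw [hψs]
      refine (hd _ _ (by positivity) ih).trans (le_of_eq ?_)
      rw [pow_succ]; field_simp
  -- The weight `r / 2 ^ n` of the `n`-th correction is shared equally as square roots between the
  -- two sequences, so that both families are square-summable.
  let c : ℕ → ℂ := fun n => ((√(r / 2 ^ n) : ℝ) : ℂ)
  have hc : ∀ n, ‖c n‖ ^ 2 = r * (1 / 2) ^ n := by
    intro n
    simp only [c, Complex.norm_real, Real.norm_eq_abs, sq_abs]
    rw [Real.sq_sqrt (by positivity), one_div, inv_pow]; rfl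
  have hsum : ∀ v : ℕ → lp (fun _ : ℕ => L) 2, (∀ n, ‖v n‖ ≤ 1) →
      Summable fun n => ‖c n • v n‖ ^ 2 := by
    intro v hv
    refine Summable.of_nonneg_of_le (fun _ => by positivity) (fun n => ?_)
      ((summable_geometric_of_lt_one (r := (1 / 2 : ℝ)) (by norm_num) (by norm_num)).mul_left r)
    rw [norm_smul, mul_pow, hc]
    exact mul_le_of_le_one_right (by positivity) (pow_le_one₀ (norm_nonneg _) (hv n))
  obtain ⟨h', k', -, -, H⟩ := exists_normalFunctional_tsum
    (fun n => c n • h (r / 2 ^ n) (ψ n)) (fun n => c n • k (r / 2 ^ n) (ψ n))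
    (hsum _ fun n => hh _ _ (by positivity) (hψn n))
    (hsum _ fun n => hk _ _ (by positivity) (hψn n))
  refine mem_restrictedFunctionals.2 ⟨h', k', ?_⟩
  ext T
  have hterm : ∀ n, (ψ n).1 T - (ψ (n + 1)).1 T = normalFunctional (c n • h (r / 2 ^ n) (ψ n))
      (c n • k (r / 2 ^ n) (ψ n)) (j T) := by
    intro n
    rw [hψs]
    simp only [sub_apply, smul_apply,
      restrictedFunctional_apply, normalFunctional_smul_left, normalFunctional_smul_right,
      sub_sub_cancel, c, Complex.conj_ofReal, ← mul_assoc, ← Complex.ofReal_mul, smul_eq_mul]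
    rw [Real.mul_self_sqrt (by positivity)]
  refine HasSum.unique (L := .unconditional ℕ) (f := fun n : ℕ => ((ψ n).1 T - (ψ (n + 1)).1 T))
    ?_ ?_
  · have hlim : Filter.Tendsto (fun n => (ψ n).1 T) Filter.atTop (𝓝 0) := by
      refine squeeze_zero_norm (a := fun n => r * (1 / 2) ^ n * ‖T‖) (fun n => ?_) ?_
      · refine ((ψ n).1.le_opNorm T).trans ?_
        gcongr
        refine (hψn n).trans (le_of_eq ?_)
        rw [one_div, inv_pow]; rfl
      · have := tendsto_pow_atTop_nhds_zero_of_lt_one (r := (1 / 2 : ℝ)) (by norm_num)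
          (by norm_num)
        simpa using (this.const_mul r).mul_const ‖T‖
    have hs : Summable fun n => (ψ n).1 T - (ψ (n + 1)).1 T := by
      convert (H (j T)).summable using 2 with n
      exact hterm n
    rw [hs.hasSum_iff_tendsto_nat]
    simp_rw [Finset.sum_range_sub' (fun n => (ψ n).1 T)]
    simpa [hψ0] using (tendsto_const_nhds (x := φ T)).sub hlim
  · simp_rw [hterm]
    exact H (j T)

/-- A functional on a weak* closed subspace that can be approximated in norm by normal functionals
is normal. -/
theorem isNormal_of_approx (j : E →ₗᵢ[ℂ] (L →L[ℂ] L))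
    (hM : IsClosed[ultraweak L L] (Set.range j)) (φ : E →ₗ[ℂ] ℂ)
    (h : ∀ ε > 0, ∃ ψ, IsNormal j.toLinearMap ψ ∧ ∀ x, ‖φ x - ψ x‖ ≤ ε * ‖x‖) :
    IsNormal j.toLinearMap φ := by
  obtain ⟨ψ, ⟨a, b, hψ⟩, hφψ⟩ := h 1 one_pos
  have hb : ∀ x, ‖φ x‖ ≤ (1 + ‖b‖ * ‖a‖) * ‖x‖ := by
    intro x
    have h1 := hφψ x
    have h2 : ‖ψ x‖ ≤ ‖b‖ * ‖a‖ * ‖x‖ := by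
      rw [hψ]
      exact (norm_normalFunctional_le a b (j x)).trans_eq (by rw [j.norm_map])
    calc ‖φ x‖ = ‖(φ x - ψ x) + ψ x‖ := by rw [sub_add_cancel]
      _ ≤ _ := (norm_add_le _ _).trans (by linarith)
  obtain ⟨h', k', H⟩ := mem_restrictedFunctionals.1 <|
    isClosed_restrictedFunctionals j hM (φ := φ.mkContinuous _ hb) <| by
    rw [← SetLike.mem_coe, Submodule.topologicalClosure_coe, Metric.mem_closure_iff]
    intro ε hε
    obtain ⟨ψ, ⟨a, b, hψ⟩, hφψ⟩ := h (ε / 2) (half_pos hε)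
    refine ⟨restrictedFunctional j a b, mem_restrictedFunctionals.2 ⟨a, b, rfl⟩, ?_⟩
    rw [dist_eq_norm]
    refine (ContinuousLinearMap.opNorm_le_bound _ (half_pos hε).le fun x => ?_).trans_lt
      (half_lt_self hε)
    have := hφψ x
    rw [hψ] at this
    exact this
  exact ⟨h', k', fun x => DFunLike.congr_fun H x⟩

end Predual

/-! ### The bicommutant theorem in the weak* topology -/

section Bicommutant

variable {L : Type*} [NormedAddCommGroup L] [InnerProductSpace ℂ L] [CompleteSpace L]

theorem ampl_star_inner (T : L →L[ℂ] L) (h k : lp (fun _ : ℕ => L) 2) :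
    inner ℂ (ampl (star T) h) k = inner ℂ h (ampl T k) := by
  simp [lp.inner_eq_tsum, ContinuousLinearMap.star_eq_adjoint,
    ContinuousLinearMap.adjoint_inner_left]

/-- The bicommutant theorem for the weak* topology: a functional in the predual that vanishes on a
unital `*`-algebra of operators vanishes on its double commutant. -/
theorem normalFunctional_eq_zero_of_bicommutant (A : StarSubalgebra ℂ (L →L[ℂ] L))
    {z : L →L[ℂ] L} (hz : z ∈ Set.centralizer (Set.centralizer (A : Set (L →L[ℂ] L))))
    {h k : lp (fun _ : ℕ => L) 2} (h0 : ∀ w ∈ A, normalFunctional h k w = 0) :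
    normalFunctional h k z = 0 := by
  let V₀ : Submodule ℂ (lp (fun _ : ℕ => L) 2) :=
    { carrier := {v | ∃ w ∈ A, v = ampl w h}
      add_mem' := by
        rintro _ _ ⟨w, hw, rfl⟩ ⟨w', hw', rfl⟩
        exact ⟨w + w', add_mem hw hw', rfl⟩
      zero_mem' := ⟨0, zero_mem A, rfl⟩
      smul_mem' := by
        rintro c _ ⟨w, hw, rfl⟩
        exact ⟨c • w, A.smul_mem hw c, rfl⟩ }
  -- `V` is the cyclic subspace generated by `h` under the amplified algebra; its projection
  -- commutes with that algebra.
  let V := V₀.topologicalClosure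
  haveI : CompleteSpace V := V₀.isClosed_topologicalClosure.completeSpace_coe
  have hV : ∀ w ∈ A, ∀ v ∈ V, ampl w v ∈ V := by
    intro w hw v hv
    refine map_mem_closure (ampl w).continuous hv ?_
    rintro _ ⟨w', hw', rfl⟩
    exact ⟨w * w', mul_mem hw hw', rfl⟩
  have hV' : ∀ w ∈ A, ∀ v ∈ Vᗮ, ampl w v ∈ Vᗮ := by
    intro w hw v hv u hu
    rw [← star_star w, ← inner_conj_symm, ampl_star_inner, inner_conj_symm]
    exact hv _ (hV _ (star_mem hw) u hu)
  let P := V.starProjection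
  have hP : ∀ w ∈ A, ∀ v, P (ampl w v) = ampl w (P v) := by
    intro w hw v
    refine (Submodule.eq_starProjection_of_mem_of_inner_eq_zero (u := ampl w v)
      (v := ampl w (P v)) (hV w hw _ ?_) ?_)
    · exact Submodule.starProjection_apply_mem V v
    · intro u hu
      have : v - P v ∈ Vᗮ := V.sub_starProjection_mem_orthogonal v
      have := hV' w hw _ this u hu
      rw [map_sub] at this
      exact inner_eq_zero_symm.1 this
  -- The matrix entries of the projection lie in the commutant of `A`, so `z` commutes with each of
  -- them and the amplification of `z` commutes with the projection.
  have hT : ∀ i j, lp.evalCLM ℂ (fun _ : ℕ => L) 2 i ∘L P ∘L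
      lp.singleContinuousLinearMap ℂ (fun _ : ℕ => L) 2 j ∈
      Set.centralizer (A : Set (L →L[ℂ] L)) := by
    intro i j w hw
    ext x
    have e : lp.single 2 j (w x) = ampl w (lp.single 2 j x) := by
      ext n
      by_cases hn : n = j
      · subst hn; simp
      · simp [hn]
    change w ((P (lp.single 2 j x)) i) = (P (lp.single 2 j (w x))) i
    rw [e, hP w hw]
    rfl
  have hPz : P ∘L ampl z = ampl z ∘L P := by
    refine lp.ext_continuousLinearMap (by norm_num) fun j => ?_
    ext x i
    have e : lp.single 2 j (z x) = ampl z (lp.single 2 j x) := by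
      ext n
      by_cases hn : n = j
      · subst hn; simp
      · simp [hn]
    change (P (ampl z (lp.single 2 j x))) i = z ((P (lp.single 2 j x)) i)
    rw [← e]
    exact DFunLike.congr_fun (hz _ (hT i j)) x
  have hh : h ∈ V := subset_closure ⟨1, one_mem A, rfl⟩
  have hzh : ampl z h ∈ V := by
    have := DFunLike.congr_fun hPz h
    simp only [ContinuousLinearMap.comp_apply] at this
    rw [show P h = h from Submodule.starProjection_eq_self_iff.2 hh] at this
    rw [← this]
    exact Submodule.starProjection_apply_mem V _
  rw [normalFunctional_eq_inner]
  refine closure_minimal (t := {v : lp (fun _ : ℕ => L) 2 | inner ℂ k v = 0}) ?_ ?_ hzh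
  · rintro _ ⟨w, hw, rfl⟩
    rw [Set.mem_ofPred_eq, ← normalFunctional_eq_inner]
    exact h0 w hw
  · exact isClosed_eq (by fun_prop) continuous_const

/-- A weak* closed subspace containing a unital `*`-algebra contains its double commutant. -/
theorem bicommutant_subset (A : StarSubalgebra ℂ (L →L[ℂ] L)) (N : Submodule ℂ (L →L[ℂ] L))
    (hN : IsClosed[ultraweak L L] (N : Set (L →L[ℂ] L))) (hAN : ∀ w ∈ A, w ∈ N)
    {z : L →L[ℂ] L} (hz : z ∈ Set.centralizer (Set.centralizer (A : Set (L →L[ℂ] L)))) :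
    z ∈ N := by
  by_contra hn
  obtain ⟨h, k, h0, hne⟩ := exists_normalFunctional_ne_zero N hN hn
  exact hne (normalFunctional_eq_zero_of_bicommutant A hz fun w hw => h0 w (hAN w hw))

/-- Commutants are weak* closed. -/
theorem isClosed_centralizer (S : Set (L →L[ℂ] L)) :
    IsClosed[ultraweak L L] (Set.centralizer S : Set (L →L[ℂ] L)) := by
  letI := ultraweak L L
  have hc : ∀ h k : lp (fun _ : ℕ => L) 2, Continuous (normalFunctional h k) := fun h k =>
    continuous_iff_le_induced.2 ((iInf_le _ h).trans (iInf_le _ k))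
  have : (Set.centralizer S : Set (L →L[ℂ] L)) = ⋂ a ∈ S, ⋂ x : L, ⋂ y : L,
      {T | normalFunctional (lp.single 2 0 x) (lp.single 2 0 (star a y)) T =
        normalFunctional (lp.single 2 0 (a x)) (lp.single 2 0 y) T} := by
    ext T
    simp only [Set.mem_centralizer_iff, Set.mem_iInter, Set.mem_ofPred_eq,
      normalFunctional_single, ContinuousLinearMap.star_eq_adjoint, ContinuousLinearMap.adjoint_inner_left]
    refine forall₂_congr fun a _ => ⟨fun h x y => ?_, fun h => ?_⟩
    · exact congrArg (fun U : L →L[ℂ] L => inner ℂ y (U x)) h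
    · ext x
      exact ext_inner_left ℂ fun y => h x y
  rw [this]
  exact isClosed_biInter fun a _ => isClosed_iInter fun x => isClosed_iInter fun y =>
    isClosed_eq (hc _ _) (hc _ _)

end Bicommutant

/-! ### Normal linear maps -/

section NormalMap

variable {H K : Type*} [NormedAddCommGroup H] [InnerProductSpace ℂ H] [CompleteSpace H]
  [NormedAddCommGroup K] [InnerProductSpace ℂ K] [CompleteSpace K]
  {H' K' : Type*} [NormedAddCommGroup H'] [InnerProductSpace ℂ H'] [CompleteSpace H']
  [NormedAddCommGroup K'] [InnerProductSpace ℂ K'] [CompleteSpace K']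
  {E F : Type*} [AddCommGroup E] [Module ℂ E] [AddCommGroup F] [Module ℂ F]

/-- A linear map is normal if it pulls back predual functionals to normal functionals. -/
def NormalMap (i : E →ₗ[ℂ] (H →L[ℂ] K)) (f : E →ₗ[ℂ] (H' →L[ℂ] K')) : Prop :=
  ∀ h k, IsNormal i (normalFunctionalₗ h k ∘ₗ f)

theorem normalMap_iff_continuous {i : E →ₗ[ℂ] (H →L[ℂ] K)} (j : F →ₗ[ℂ] (H' →L[ℂ] K'))
    (f : E →ₗ[ℂ] F) :
    NormalMap i (j ∘ₗ f) ↔ Continuous[TopologicalSpace.induced i (ultraweak H K),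
      TopologicalSpace.induced j (ultraweak H' K')] f := by
  letI := TopologicalSpace.induced i (ultraweak H K)
  rw [continuous_induced_ultraweak_iff]
  exact forall₂_congr fun h k => isNormal_iff_continuous i _

theorem NormalMap.add {i : E →ₗ[ℂ] (H →L[ℂ] K)} {f g : E →ₗ[ℂ] (H' →L[ℂ] K')}
    (hf : NormalMap i f) (hg : NormalMap i g) : NormalMap i (f + g) := by
  intro h k
  rw [LinearMap.comp_add]
  exact (normals i).add_mem (hf h k) (hg h k)

theorem NormalMap.smul {i : E →ₗ[ℂ] (H →L[ℂ] K)} {f : E →ₗ[ℂ] (H' →L[ℂ] K')}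
    (hf : NormalMap i f) (c : ℂ) : NormalMap i (c • f) := by
  intro h k
  rw [LinearMap.comp_smul]
  exact (normals i).smul_mem c (hf h k)

theorem NormalMap.comp {i : E →ₗ[ℂ] (H →L[ℂ] K)} {f : F →ₗ[ℂ] (H' →L[ℂ] K')} {g : E →ₗ[ℂ] F}
    {j : F →ₗ[ℂ] (H →L[ℂ] K)} (hf : NormalMap j f) (hg : NormalMap i (j ∘ₗ g)) :
    NormalMap i (f ∘ₗ g) := by
  intro h k
  obtain ⟨h', k', H⟩ := hf h k
  obtain ⟨h'', k'', H'⟩ := hg h' k'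
  exact ⟨h'', k'', fun x => (H (g x)).trans (H' x)⟩

theorem normalMap_self (i : E →ₗ[ℂ] (H →L[ℂ] K)) : NormalMap i i :=
  fun h k => ⟨h, k, fun _ => rfl⟩

theorem isClosed_comap {f : (H →L[ℂ] K) →ₗ[ℂ] (H' →L[ℂ] K')} (hf : NormalMap LinearMap.id f)
    {N : Submodule ℂ (H' →L[ℂ] K')} (hN : IsClosed[ultraweak H' K'] (N : Set (H' →L[ℂ] K'))) :
    IsClosed[ultraweak H K] (N.comap f : Set (H →L[ℂ] K)) := by
  have := (normalMap_iff_continuous LinearMap.id f).1 hf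
  have e : ∀ t : TopologicalSpace (H →L[ℂ] K),
      TopologicalSpace.induced (LinearMap.id : (H →L[ℂ] K) →ₗ[ℂ] _) t = t := fun t => induced_id
  have e' : ∀ t : TopologicalSpace (H' →L[ℂ] K'),
      TopologicalSpace.induced (LinearMap.id : (H' →L[ℂ] K') →ₗ[ℂ] _) t = t := fun t => induced_id
  rw [e, e'] at this
  exact @IsClosed.preimage _ _ (ultraweak H K) (ultraweak H' K') _ this _ hN

end NormalMap

/-! ### The double commutant of an odd selfadjoint triple system -/

section OddTriple

variable {L : Type*} [NormedAddCommGroup L] [InnerProductSpace ℂ L] [CompleteSpace L]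

theorem normalMap_mul {E : Type*} [AddCommGroup E] [Module ℂ E] {i f : E →ₗ[ℂ] (L →L[ℂ] L)}
    (hf : NormalMap i f) (a b : L →L[ℂ] L) :
    NormalMap i (LinearMap.mulLeft ℂ a ∘ₗ LinearMap.mulRight ℂ b ∘ₗ f) := by
  intro h k
  obtain ⟨h', k', H⟩ := hf (ampl b h) (ampl (a†) k)
  exact ⟨h', k', fun x => (normalFunctional_comp a b h k (f x)).trans (H x)⟩

/-- A selfadjoint weak* closed space of operators that is closed under triple products and odd with
respect to the symmetry `J`. -/
structure OddTriple (J : L →L[ℂ] L) (S : Submodule ℂ (L →L[ℂ] L)) : Prop where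
  star_mem : ∀ s ∈ S, star s ∈ S
  mul_mem : ∀ s ∈ S, ∀ t ∈ S, ∀ u ∈ S, s * t * u ∈ S
  sq_eq_one : J * J = 1
  star_eq : star J = J
  odd : ∀ s ∈ S, J * s * J = -s
  isClosed : IsClosed[ultraweak L L] (S : Set (L →L[ℂ] L))

/-- The even part of an operator with respect to a symmetry. -/
def evenPart (J : L →L[ℂ] L) : (L →L[ℂ] L) →ₗ[ℂ] (L →L[ℂ] L) :=
  (2⁻¹ : ℂ) • (LinearMap.id + LinearMap.mulLeft ℂ J ∘ₗ LinearMap.mulRight ℂ J ∘ₗ LinearMap.id)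

/-- The odd part of an operator with respect to a symmetry. -/
def oddPart (J : L →L[ℂ] L) : (L →L[ℂ] L) →ₗ[ℂ] (L →L[ℂ] L) :=
  (2⁻¹ : ℂ) • (LinearMap.id +
    (-1 : ℂ) • LinearMap.mulLeft ℂ J ∘ₗ LinearMap.mulRight ℂ J ∘ₗ LinearMap.id)

theorem evenPart_apply (J z : L →L[ℂ] L) : evenPart J z = (2⁻¹ : ℂ) • (z + J * z * J) := by
  simp [evenPart, mul_assoc]

theorem oddPart_apply (J z : L →L[ℂ] L) : oddPart J z = (2⁻¹ : ℂ) • (z - J * z * J) := by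
  simp [oddPart, mul_assoc, sub_eq_add_neg]

theorem normalMap_evenPart (J : L →L[ℂ] L) : NormalMap LinearMap.id (evenPart J) :=
  ((normalMap_self _).add (normalMap_mul (normalMap_self _) J J)).smul _

theorem normalMap_oddPart (J : L →L[ℂ] L) : NormalMap LinearMap.id (oddPart J) :=
  ((normalMap_self _).add ((normalMap_mul (normalMap_self _) J J).smul _)).smul _

theorem evenPart_add_oddPart (J z : L →L[ℂ] L) : evenPart J z + oddPart J z = z := by
  rw [evenPart_apply, oddPart_apply, ← smul_add]
  rw [show z + J * z * J + (z - J * z * J) = (2 : ℂ) • z by rw [two_smul]; abel, smul_smul]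
  norm_num

/-- The double commutant of a space of operators. -/
def bicommutant (S : Submodule ℂ (L →L[ℂ] L)) : Set (L →L[ℂ] L) :=
  Set.centralizer (Set.centralizer (S : Set (L →L[ℂ] L)))

/-- The operators whose odd part is in `S` and whose even part multiplies `S`. -/
def multipliers (J : L →L[ℂ] L) (S : Submodule ℂ (L →L[ℂ] L)) : Submodule ℂ (L →L[ℂ] L) :=
  S.comap (oddPart J) ⊓ ⨅ s : S,
    -- The factors `1` give both one-sided multiplications the two-sided shape covered by
    -- `normalMap_mul`, whence weak* closedness.
    (S.comap (LinearMap.mulLeft ℂ 1 ∘ₗ LinearMap.mulRight ℂ (s : L →L[ℂ] L) ∘ₗ evenPart J) ⊓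
      S.comap (LinearMap.mulLeft ℂ (s : L →L[ℂ] L) ∘ₗ LinearMap.mulRight ℂ 1 ∘ₗ evenPart J))

namespace OddTriple

variable {J : L →L[ℂ] L} {S : Submodule ℂ (L →L[ℂ] L)} (hS : OddTriple J S)

include hS

theorem conj_conj (z : L →L[ℂ] L) : J * (J * z * J) * J = z := by
  rw [← mul_assoc, ← mul_assoc, hS.sq_eq_one, one_mul, mul_assoc, hS.sq_eq_one, mul_one]

theorem conj_mul (z w : L →L[ℂ] L) : J * (z * w) * J = (J * z * J) * (J * w * J) := by
  calc J * (z * w) * J = J * z * 1 * w * J := by simp only [mul_one, mul_assoc]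
    _ = _ := by rw [← hS.sq_eq_one]; simp only [mul_assoc]

theorem conj_star (z : L →L[ℂ] L) : J * star z * J = star (J * z * J) := by
  simp only [star_mul, hS.star_eq, mul_assoc]

theorem conj_evenPart (z : L →L[ℂ] L) : J * evenPart J z * J = evenPart J z := by
  rw [evenPart_apply, mul_smul_comm, smul_mul_assoc, mul_add, add_mul, hS.conj_conj, add_comm]

theorem conj_oddPart (z : L →L[ℂ] L) : J * oddPart J z * J = -oddPart J z := by
  rw [oddPart_apply, mul_smul_comm, smul_mul_assoc, mul_sub, sub_mul, hS.conj_conj, ← smul_neg,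
    neg_sub]

theorem evenPart_of_even {z : L →L[ℂ] L} (hz : J * z * J = z) : evenPart J z = z := by
  rw [evenPart_apply, hz, ← two_smul ℂ z, smul_smul]; norm_num

theorem oddPart_of_even {z : L →L[ℂ] L} (hz : J * z * J = z) : oddPart J z = 0 := by
  rw [oddPart_apply, hz, sub_self, smul_zero]

theorem evenPart_of_odd {z : L →L[ℂ] L} (hz : J * z * J = -z) : evenPart J z = 0 := by
  rw [evenPart_apply, hz, add_neg_cancel, smul_zero]

theorem oddPart_of_odd {z : L →L[ℂ] L} (hz : J * z * J = -z) : oddPart J z = z := by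
  rw [oddPart_apply, hz, sub_neg_eq_add, ← two_smul ℂ z, smul_smul]; norm_num

theorem evenPart_star (z : L →L[ℂ] L) : evenPart J (star z) = star (evenPart J z) := by
  rw [evenPart_apply, evenPart_apply, hS.conj_star, star_smul, star_add]; simp

theorem oddPart_star (z : L →L[ℂ] L) : oddPart J (star z) = star (oddPart J z) := by
  rw [oddPart_apply, oddPart_apply, hS.conj_star, star_smul, star_sub]; simp

theorem evenPart_mul (z w : L →L[ℂ] L) : evenPart J (z * w) =
    evenPart J z * evenPart J w + oddPart J z * oddPart J w := by
  have h : z * w = (evenPart J z * evenPart J w + oddPart J z * oddPart J w) +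
      (evenPart J z * oddPart J w + oddPart J z * evenPart J w) := by
    conv_lhs => rw [← evenPart_add_oddPart J z, ← evenPart_add_oddPart J w]
    simp only [mul_add, add_mul]; abel
  have key : ∀ {x y : L →L[ℂ] L}, J * x * J = x → J * y * J = -y → evenPart J (x + y) = x := by
    intro x y hx hy
    rw [map_add, hS.evenPart_of_even hx, hS.evenPart_of_odd hy, add_zero]
  rw [h, key]
  · simp only [mul_add, add_mul, hS.conj_mul, hS.conj_evenPart, hS.conj_oddPart, mul_neg, neg_mul,
      neg_neg]
  · simp only [mul_add, add_mul, hS.conj_mul, hS.conj_evenPart, hS.conj_oddPart, mul_neg, neg_mul]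
    abel

theorem oddPart_mul (z w : L →L[ℂ] L) : oddPart J (z * w) =
    evenPart J z * oddPart J w + oddPart J z * evenPart J w := by
  have h := evenPart_add_oddPart J (z * w)
  rw [hS.evenPart_mul] at h
  refine add_left_cancel (h.trans ?_)
  conv_lhs => rw [← evenPart_add_oddPart J z, ← evenPart_add_oddPart J w]
  simp only [mul_add, add_mul]; abel

theorem norm_J_le : ‖J‖ ≤ 1 := by
  have h : ‖J‖ * ‖J‖ = ‖(1 : L →L[ℂ] L)‖ := by
    rw [← CStarRing.norm_star_mul_self, hS.star_eq, hS.sq_eq_one]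
  have h1 : ‖(1 : L →L[ℂ] L)‖ ≤ 1 := ContinuousLinearMap.norm_id_le
  nlinarith [norm_nonneg J]

theorem norm_conj_le (z : L →L[ℂ] L) : ‖J * z * J‖ ≤ ‖z‖ := by
  calc ‖J * z * J‖ ≤ ‖J‖ * ‖z‖ * ‖J‖ := norm_mul₃_le
    _ ≤ 1 * ‖z‖ * 1 := by gcongr <;> exact hS.norm_J_le
    _ = ‖z‖ := by ring

theorem norm_evenPart_le (z : L →L[ℂ] L) : ‖evenPart J z‖ ≤ ‖z‖ := by
  rw [evenPart_apply, norm_smul]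
  have := norm_add_le z (J * z * J)
  have := hS.norm_conj_le z
  norm_num
  linarith

theorem norm_oddPart_le (z : L →L[ℂ] L) : ‖oddPart J z‖ ≤ ‖z‖ := by
  rw [oddPart_apply, norm_smul]
  have := norm_sub_le z (J * z * J)
  have := hS.norm_conj_le z
  norm_num
  linarith

/-- Conjugation by `J` acts on `S` as `-1`, so it preserves the commutant of `S` and then the double
commutant, although `J` itself need not belong to the latter. -/
theorem conj_mem_centralizer {T : L →L[ℂ] L} (hT : T ∈ Set.centralizer (S : Set (L →L[ℂ] L))) :
    J * T * J ∈ Set.centralizer (S : Set (L →L[ℂ] L)) := by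
  intro s hs
  have h1 : s = J * (-s) * J := by rw [← hS.odd s hs, hS.conj_conj]
  rw [h1, ← hS.conj_mul, ← hS.conj_mul, hT _ (S.neg_mem hs)]

theorem conj_mem {z : L →L[ℂ] L} (hz : z ∈ bicommutant S) : J * z * J ∈ bicommutant S := by
  intro T hT
  have := hz _ (hS.conj_mem_centralizer hT)
  rw [← hS.conj_conj T, ← hS.conj_mul, ← hS.conj_mul, this]

/-- The double commutant as a star subalgebra. -/
def algebra : StarSubalgebra ℂ (L →L[ℂ] L) :=
  (doubleCommutant (S : Set (L →L[ℂ] L)) hS.star_mem).toStarSubalgebra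

theorem mem_algebra {z : L →L[ℂ] L} : z ∈ hS.algebra ↔ z ∈ bicommutant S := Iff.rfl

theorem evenPart_mem {z : L →L[ℂ] L} (hz : z ∈ bicommutant S) : evenPart J z ∈ bicommutant S := by
  rw [← hS.mem_algebra, evenPart_apply]
  exact hS.algebra.smul_mem (add_mem (hS.mem_algebra.2 hz) (hS.mem_algebra.2 (hS.conj_mem hz))) _

theorem mem_of_mem {s : L →L[ℂ] L} (hs : s ∈ S) : s ∈ bicommutant S :=
  Set.subset_centralizer_centralizer hs

theorem mem_multipliers {z : L →L[ℂ] L} : z ∈ multipliers J S ↔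
    oddPart J z ∈ S ∧ ∀ s ∈ S, evenPart J z * s ∈ S ∧ s * evenPart J z ∈ S := by
  simp [multipliers, Submodule.mem_iInf]

theorem isClosed_multipliers :
    IsClosed[ultraweak L L] (multipliers J S : Set (L →L[ℂ] L)) := by
  letI := ultraweak L L
  simp only [multipliers, Submodule.coe_inf, Submodule.coe_iInf]
  exact (isClosed_comap (normalMap_oddPart J) hS.isClosed).inter (isClosed_iInter fun s =>
    (isClosed_comap (normalMap_mul (normalMap_evenPart J) _ _) hS.isClosed).inter
      (isClosed_comap (normalMap_mul (normalMap_evenPart J) _ _) hS.isClosed))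

/-- The delicate case is a product: its even part contains the product of two odd parts, which
multiplies `S` into itself by the triple product. -/
theorem adjoin_le_multipliers {w : L →L[ℂ] L}
    (hw : w ∈ StarAlgebra.adjoin ℂ (S : Set (L →L[ℂ] L))) : w ∈ multipliers J S := by
  induction hw using StarAlgebra.adjoin_induction with
  | mem s hs =>
    rw [hS.mem_multipliers, hS.oddPart_of_odd (hS.odd s hs), hS.evenPart_of_odd (hS.odd s hs)]
    exact ⟨hs, fun t _ => by simp⟩
  | algebraMap c =>
    have h : J * algebraMap ℂ (L →L[ℂ] L) c * J = algebraMap ℂ (L →L[ℂ] L) c := by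
      rw [← Algebra.commutes, mul_assoc, hS.sq_eq_one, mul_one]
    rw [hS.mem_multipliers, hS.oddPart_of_even h, hS.evenPart_of_even h]
    refine ⟨S.zero_mem, fun s hs => ⟨?_, ?_⟩⟩
    · rw [← Algebra.smul_def]; exact S.smul_mem c hs
    · rw [← Algebra.commutes, ← Algebra.smul_def]; exact S.smul_mem c hs
  | add x y _ _ hx hy => exact add_mem hx hy
  | mul x y _ _ hx hy =>
    rw [hS.mem_multipliers] at *
    obtain ⟨ox, ex⟩ := hx
    obtain ⟨oy, ey⟩ := hy
    rw [hS.oddPart_mul, hS.evenPart_mul]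
    refine ⟨S.add_mem (ex _ oy).1 (ey _ ox).2, fun s hs => ⟨?_, ?_⟩⟩
    · rw [add_mul, mul_assoc]
      exact S.add_mem (ex _ (ey _ hs).1).1 (hS.mul_mem _ ox _ oy _ hs)
    · rw [mul_add, ← mul_assoc, ← mul_assoc]
      exact S.add_mem (ey _ (ex _ hs).2).2 (hS.mul_mem _ hs _ ox _ oy)
  | star x _ hx =>
    rw [hS.mem_multipliers] at *
    rw [hS.oddPart_star, hS.evenPart_star]
    refine ⟨hS.star_mem _ hx.1, fun s hs => ⟨?_, ?_⟩⟩
    · simpa using hS.star_mem _ (hx.2 _ (hS.star_mem _ hs)).2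
    · simpa using hS.star_mem _ (hx.2 _ (hS.star_mem _ hs)).1

theorem bicommutant_subset_adjoin : bicommutant S ⊆ Set.centralizer
    (Set.centralizer (StarAlgebra.adjoin ℂ (S : Set (L →L[ℂ] L)) : Set (L →L[ℂ] L))) :=
  Set.centralizer_subset (Set.centralizer_subset (StarAlgebra.subset_adjoin ℂ _))

theorem mem_multipliers_of_mem {z : L →L[ℂ] L} (hz : z ∈ bicommutant S) : z ∈ multipliers J S :=
  bicommutant_subset _ _ hS.isClosed_multipliers (fun _ hw => hS.adjoin_le_multipliers hw)
    (hS.bicommutant_subset_adjoin hz)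

theorem oddPart_mem {z : L →L[ℂ] L} (hz : z ∈ bicommutant S) : oddPart J z ∈ S :=
  (hS.mem_multipliers.1 (hS.mem_multipliers_of_mem hz)).1

theorem even_mul_mem {d s : L →L[ℂ] L} (hd : d ∈ bicommutant S) (hJ : J * d * J = d)
    (hs : s ∈ S) : d * s ∈ S := by
  have := ((hS.mem_multipliers.1 (hS.mem_multipliers_of_mem hd)).2 s hs).1
  rwa [hS.evenPart_of_even hJ] at this

theorem mul_even_mem {d s : L →L[ℂ] L} (hd : d ∈ bicommutant S) (hJ : J * d * J = d)
    (hs : s ∈ S) : s * d ∈ S := by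
  have := ((hS.mem_multipliers.1 (hS.mem_multipliers_of_mem hd)).2 s hs).2
  rwa [hS.evenPart_of_even hJ] at this

/-- The even part of the double commutant, as a star subalgebra. -/
def evenAlgebra : StarSubalgebra ℂ (L →L[ℂ] L) where
  carrier := {d | d ∈ bicommutant S ∧ J * d * J = d}
  mul_mem' := fun ⟨h1, h2⟩ ⟨h3, h4⟩ =>
    ⟨MulMemClass.mul_mem (S := StarSubalgebra ℂ (L →L[ℂ] L)) (s := hS.algebra) h1 h3, by
      rw [hS.conj_mul, h2, h4]⟩
  add_mem' := fun ⟨h1, h2⟩ ⟨h3, h4⟩ =>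
    ⟨AddMemClass.add_mem (S := StarSubalgebra ℂ (L →L[ℂ] L)) (s := hS.algebra) h1 h3, by
      rw [mul_add, add_mul, h2, h4]⟩
  algebraMap_mem' := fun c => ⟨hS.algebra.algebraMap_mem c, by
    rw [← Algebra.commutes, mul_assoc, hS.sq_eq_one, mul_one]⟩
  star_mem' := fun ⟨h1, h2⟩ =>
    ⟨StarMemClass.star_mem (S := StarSubalgebra ℂ (L →L[ℂ] L)) (s := hS.algebra) h1, by
      rw [hS.conj_star, h2]⟩

theorem evenPart_mem_evenAlgebra {z : L →L[ℂ] L} (hz : z ∈ bicommutant S) :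
    evenPart J z ∈ hS.evenAlgebra := ⟨hS.evenPart_mem hz, hS.conj_evenPart z⟩

theorem mul_mem_evenAlgebra {s t : L →L[ℂ] L} (hs : s ∈ S) (ht : t ∈ S) :
    s * t ∈ hS.evenAlgebra :=
  ⟨MulMemClass.mul_mem (S := StarSubalgebra ℂ (L →L[ℂ] L)) (s := hS.algebra) (hS.mem_of_mem hs)
    (hS.mem_of_mem ht), by rw [hS.conj_mul, hS.odd s hs, hS.odd t ht, neg_mul_neg]⟩

/-- The even algebra is closed under functional calculus, in the form: it contains every operator
commuting with the commutant of one of its elements. -/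
theorem mem_evenAlgebra_of_commute {d c : L →L[ℂ] L} (hd : d ∈ hS.evenAlgebra)
    (hc : ∀ T, Commute d T → Commute c T) : c ∈ hS.evenAlgebra := by
  refine ⟨fun T hT => ((hc T (hd.1 T hT).symm).symm), ?_⟩
  have h : Commute d J := by
    have := congrArg (· * J) hd.2
    simp only [mul_assoc, hS.sq_eq_one, mul_one] at this
    exact this.symm
  have h2 : c * J = J * c := hc J h
  rw [← h2, mul_assoc, hS.sq_eq_one, mul_one]

theorem exists_sqrt {p : L →L[ℂ] L} (hp : p ∈ hS.evenAlgebra) (h0 : 0 ≤ p) :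
    ∃ c ∈ hS.evenAlgebra, star c = c ∧ c * c = p := by
  refine ⟨CFC.sqrt p, hS.mem_evenAlgebra_of_commute hp fun T hT => ?_,
    (CFC.sqrt_nonneg p).isSelfAdjoint, CFC.sqrt_mul_sqrt_self p h0⟩
  rw [CFC.sqrt]
  exact hT.cfcₙ_nnreal _

/-- The square root of `‖d‖² 1 - d*d` stays in the even algebra. The identity turns one-sided
estimates for `d` into two-sided ones; it is used for boundedness of lifts and again for upper
semicontinuity of orbits. -/
theorem exists_complement {d : L →L[ℂ] L} (hd : d ∈ hS.evenAlgebra) :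
    ∃ c ∈ hS.evenAlgebra, star c = c ∧ star d * d + c * c = ((‖d‖ ^ 2 : ℝ) : ℂ) • 1 := by
  have h0 : star d * d ≤ ((‖d‖ ^ 2 : ℝ) : ℂ) • (1 : L →L[ℂ] L) := by
    have := CStarAlgebra.star_mul_le_algebraMap_norm_sq (a := d)
    rwa [Algebra.algebraMap_eq_smul_one] at this
  obtain ⟨c, hc, hc', hcc⟩ := hS.exists_sqrt (p := ((‖d‖ ^ 2 : ℝ) : ℂ) • 1 - star d * d)
    (sub_mem (hS.evenAlgebra.smul_mem (one_mem _) _) (MulMemClass.mul_mem (StarMemClass.star_mem hd) hd))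
    (sub_nonneg.2 h0)
  exact ⟨c, hc, hc', by rw [hcc]; abel⟩

end OddTriple

end OddTriple

/-! ### Lifting even multipliers along a triple automorphism -/

section Lift

variable {L : Type*} [NormedAddCommGroup L] [InnerProductSpace ℂ L] [CompleteSpace L]

/-- The vectors annihilated by all operators in `S`. -/
def nullSpace (S : Submodule ℂ (L →L[ℂ] L)) : Submodule ℂ L where
  carrier := {ξ | ∀ s ∈ S, s ξ = 0}
  add_mem' := fun ha hb s hs => by rw [map_add, ha s hs, hb s hs, add_zero]
  zero_mem' := fun s _ => map_zero s
  smul_mem' := fun c ξ h s hs => by rw [map_smul, h s hs, smul_zero]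

theorem mem_nullSpace {S : Submodule ℂ (L →L[ℂ] L)} {ξ : L} :
    ξ ∈ nullSpace S ↔ ∀ s ∈ S, s ξ = 0 := Iff.rfl

theorem isClosed_nullSpace (S : Submodule ℂ (L →L[ℂ] L)) :
    IsClosed ((nullSpace S : Submodule ℂ L) : Set L) := by
  have : ((nullSpace S : Submodule ℂ L) : Set L) = ⋂ s ∈ S, {ξ | s ξ = 0} := by
    ext ξ; simp [mem_nullSpace]
  rw [this]
  exact isClosed_biInter fun s _ => isClosed_eq s.continuous continuous_const

instance (S : Submodule ℂ (L →L[ℂ] L)) : CompleteSpace (nullSpace S) :=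
  (isClosed_nullSpace S).completeSpace_coe

theorem inner_star_apply (T : L →L[ℂ] L) (x y : L) :
    inner ℂ (star T x) y = inner ℂ x (T y) := by
  rw [ContinuousLinearMap.star_eq_adjoint, ContinuousLinearMap.adjoint_inner_left]

theorem inner_apply_star (T : L →L[ℂ] L) (x y : L) :
    inner ℂ x (star T y) = inner ℂ (T x) y := by
  rw [ContinuousLinearMap.star_eq_adjoint, ContinuousLinearMap.adjoint_inner_right]

/-- A linear map of operators that restricts to a `*`-preserving automorphism of the triple
structure on `S`. -/
structure TripleAut (S : Submodule ℂ (L →L[ℂ] L)) (a : (L →L[ℂ] L) →ₗ[ℂ] (L →L[ℂ] L)) :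
    Prop where
  map_mem : ∀ s ∈ S, a s ∈ S
  surj : ∀ t ∈ S, ∃ s ∈ S, a s = t
  map_mul : ∀ s ∈ S, ∀ t ∈ S, ∀ u ∈ S, a (s * t * u) = a s * a t * a u
  map_star : ∀ s ∈ S, a (star s) = star (a s)

namespace OddTriple

variable {J : L →L[ℂ] L} {S : Submodule ℂ (L →L[ℂ] L)} (hS : OddTriple J S)

include hS

/-- The range of `S` and its null space span a dense subspace. -/
theorem eq_top_of_range_of_nullSpace (W : Submodule ℂ L) (hW : IsClosed (W : Set L))
    (h1 : ∀ s ∈ S, ∀ ξ, s ξ ∈ W) (h2 : nullSpace S ≤ W) : W = ⊤ := by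
  haveI : CompleteSpace W := hW.completeSpace_coe
  rw [← Submodule.orthogonal_eq_bot_iff, Submodule.eq_bot_iff]
  intro v hv
  have h : v ∈ nullSpace S := by
    intro s hs
    refine ext_inner_left ℂ fun x => ?_
    rw [← inner_star_apply, inner_zero_right]
    exact hv _ (h1 _ (hS.star_mem s hs) x)
  exact inner_self_eq_zero.1 (hv v (h2 h))

theorem ext_of_range_of_nullSpace {T T' : L →L[ℂ] L} (h1 : ∀ s ∈ S, T * s = T' * s)
    (h2 : ∀ ξ ∈ nullSpace S, T ξ = T' ξ) : T = T' := by
  have := hS.eq_top_of_range_of_nullSpace (LinearMap.eqLocus (T : L →ₗ[ℂ] L) (T' : L →ₗ[ℂ] L))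
    (isClosed_eq T.continuous T'.continuous)
    (fun s hs ξ => DFunLike.congr_fun (h1 s hs) ξ) h2
  ext ξ
  have h : ξ ∈ LinearMap.eqLocus (T : L →ₗ[ℂ] L) (T' : L →ₗ[ℂ] L) := by
    rw [this]; exact Submodule.mem_top
  exact h

/-- The projection onto the null space commutes with `S`. -/
theorem bicommutant_nullSpace {z : L →L[ℂ] L} (hz : z ∈ bicommutant S) {ξ : L}
    (hξ : ξ ∈ nullSpace S) : z ξ ∈ nullSpace S := by
  let P : L →L[ℂ] L := (nullSpace S).starProjection
  have hP : P ∈ Set.centralizer (S : Set (L →L[ℂ] L)) := by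
    intro s hs
    ext η
    change s (P η) = P (s η)
    rw [show s (P η) = 0 from Submodule.starProjection_apply_mem (nullSpace S) η s hs]
    refine ((nullSpace S).starProjection_apply_eq_zero_iff.2 fun v hv => ?_).symm
    rw [← inner_star_apply, hv _ (hS.star_mem s hs), inner_zero_left]
  have h : P (z ξ) = z (P ξ) := DFunLike.congr_fun (hz P hP) ξ
  rw [show P ξ = ξ from Submodule.starProjection_eq_self_iff.2 hξ] at h
  exact h ▸ Submodule.starProjection_apply_mem (nullSpace S) _

variable {a : (L →L[ℂ] L) →ₗ[ℂ] (L →L[ℂ] L)} (ha : TripleAut S a)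

include ha

/-- Two operators agree if they agree on the range of the image of `a` and on the null space. -/
theorem ext_of_lift {T T' : L →L[ℂ] L} (h1 : ∀ s ∈ S, T * a s = T' * a s)
    (h2 : ∀ ξ ∈ nullSpace S, T ξ = T' ξ) : T = T' := by
  refine hS.ext_of_range_of_nullSpace (fun s hs => ?_) h2
  obtain ⟨t, ht, rfl⟩ := ha.surj s hs
  exact h1 t ht

/-- The triple identity gives equality only after multiplying by `a(w)` on the left. The adjoint of
the difference `Δ` is itself a combination of products ending in such factors, so `Δ*Δ = 0` and the
C*-identity finishes. -/
theorem map_mul_even {d s t : L →L[ℂ] L} (hd : d ∈ hS.evenAlgebra) (ht : t ∈ S) (hs : s ∈ S) :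
    a (t * d) * a s = a t * a (d * s) := by
  have htd : t * d ∈ S := hS.mul_even_mem hd.1 hd.2 ht
  have hds : d * s ∈ S := hS.even_mul_mem hd.1 hd.2 hs
  set Δ := a (t * d) * a s - a t * a (d * s)
  have h : ∀ w ∈ S, a w * Δ = 0 := by
    intro w hw
    rw [mul_sub, ← mul_assoc, ← mul_assoc, ← ha.map_mul _ hw _ htd _ hs,
      ← ha.map_mul _ hw _ ht _ hds]
    simp only [mul_assoc, sub_self]
  have h2 : star Δ * Δ = 0 := by
    simp only [Δ, star_sub, star_mul, sub_mul]
    rw [← ha.map_star _ hs, ← ha.map_star _ htd, ← ha.map_star _ hds, ← ha.map_star _ ht,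
      mul_assoc, mul_assoc]
    change a (star s) * (a (star (t * d)) * Δ) - a (star (d * s)) * (a (star t) * Δ) = 0
    rw [h _ (hS.star_mem _ htd), h _ (hS.star_mem _ ht), mul_zero, mul_zero, sub_zero]
  exact sub_eq_zero.1 ((CStarRing.star_mul_self_eq_zero_iff Δ).1 h2)

theorem apply_nullSpace {s : L →L[ℂ] L} (hs : s ∈ S) {ξ : L} (hξ : ξ ∈ nullSpace S) :
    a s ξ = 0 := hξ _ (ha.map_mem s hs)

/-- An even operator `d` is carried to an operator `T` with `T a(s) = a(d s)`. -/
theorem exists_even_lift {d : L →L[ℂ] L} (hd : d ∈ hS.evenAlgebra) :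
    ∃ T : L →L[ℂ] L, (∀ s ∈ S, T * a s = a (d * s)) ∧ (∀ ξ ∈ nullSpace S, T ξ = d ξ) ∧
      ‖T‖ ≤ ‖d‖ := by
  -- `Ψ d` is the would-be operator `a(s)ξ ↦ a(ds)ξ` on formal sums, before its well-definedness is
  -- known; `Ψ 1` evaluates the formal sum in `L`.
  let Ψ : (L →L[ℂ] L) → (S →₀ L) →ₗ[ℂ] L := fun d =>
    Finsupp.lsum ℂ fun s : S => ((a (d * s) : L →L[ℂ] L) : L →ₗ[ℂ] L)
  have hΨ : ∀ d f, Ψ d f = f.sum fun s ξ => a (d * s) ξ := fun d f => rfl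
  have hadd : ∀ d d' f, Ψ (d + d') f = Ψ d f + Ψ d' f := by
    intro d d' f
    simp only [hΨ, add_mul, map_add, add_apply, Finsupp.sum_add]
  have hsmul : ∀ (c : ℂ) d f, Ψ (c • d) f = c • Ψ d f := by
    intro c d f
    simp only [hΨ, smul_mul_assoc, map_smul, smul_apply, Finsupp.smul_sum]
  have hinner : ∀ d ∈ hS.evenAlgebra, ∀ f,
      inner ℂ (Ψ d f) (Ψ d f) = inner ℂ (Ψ 1 f) (Ψ (star d * d) f) := by
    intro d hd f
    simp only [hΨ, Finsupp.sum, sum_inner, inner_sum]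
    refine Finset.sum_congr rfl fun t _ => Finset.sum_congr rfl fun s _ => ?_
    have hds : d * (t : L →L[ℂ] L) ∈ S := hS.even_mul_mem hd.1 hd.2 t.2
    have hdt : d * (s : L →L[ℂ] L) ∈ S := hS.even_mul_mem hd.1 hd.2 s.2
    rw [one_mul, ← inner_apply_star (a (d * (s : L →L[ℂ] L))), ← inner_apply_star (a s)]
    congr 1
    have := hS.map_mul_even ha (StarMemClass.star_mem hd) (hS.star_mem _ s.2) hds
    rw [← star_mul, ha.map_star _ hdt, ha.map_star _ s.2, ← mul_assoc] at this
    exact DFunLike.congr_fun this (f t)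
  -- With the complement `c` of `d`, `‖Ψ d f‖² + ‖Ψ c f‖² = ‖d‖² ‖Ψ 1 f‖²`.
  have hnorm : ∀ f, ‖Ψ d f‖ ^ 2 ≤ ‖d‖ ^ 2 * ‖Ψ 1 f‖ ^ 2 := by
    intro f
    obtain ⟨c, hc, hc', hcd⟩ := hS.exists_complement hd
    have h1 := hinner d hd f
    have h2 := hinner c hc f
    rw [hc'] at h2
    have h3 : inner ℂ (Ψ d f) (Ψ d f) + inner ℂ (Ψ c f) (Ψ c f) =
        ((‖d‖ ^ 2 : ℝ) : ℂ) * inner ℂ (Ψ 1 f) (Ψ 1 f) := by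
      rw [h1, h2, ← inner_add_right, ← hadd, hcd, hsmul, inner_smul_right]
    simp only [inner_self_eq_norm_sq_to_K] at h3
    have h4 : ‖Ψ d f‖ ^ 2 + ‖Ψ c f‖ ^ 2 = ‖d‖ ^ 2 * ‖Ψ 1 f‖ ^ 2 := by
      apply Complex.ofReal_injective
      simpa using h3
    nlinarith [sq_nonneg ‖Ψ c f‖]
  have horth : ∀ d ∈ hS.evenAlgebra, ∀ f, ∀ ξ ∈ nullSpace S, inner ℂ (Ψ d f) ξ = 0 := by
    intro d hd f ξ hξ
    simp only [hΨ, Finsupp.sum, sum_inner]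
    refine Finset.sum_eq_zero fun s _ => ?_
    have hds : d * (s : L →L[ℂ] L) ∈ S := hS.even_mul_mem hd.1 hd.2 s.2
    rw [← star_star (a _), inner_star_apply, ← ha.map_star _ hds,
      hS.apply_nullSpace ha (hS.star_mem _ hds) hξ, inner_zero_right]
  -- On the null space the lift acts as `d`. Both pieces of the source and both pieces of the image
  -- are orthogonal, so the bound `‖d‖` survives adding them.
  let e : ((S →₀ L) × nullSpace S) →ₗ[ℂ] L := (Ψ 1).coprod (nullSpace S).subtype
  let g : ((S →₀ L) × nullSpace S) →ₗ[ℂ] L :=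
    (Ψ d).coprod ((d : L →ₗ[ℂ] L) ∘ₗ (nullSpace S).subtype)
  have hsingle : ∀ d' (s : S) ξ, Ψ d' (Finsupp.single s ξ) = a (d' * s) ξ := by
    intro d' s ξ
    rw [hΨ, Finsupp.sum_single_index (by simp)]
  have hdense : DenseRange e := by
    have := hS.eq_top_of_range_of_nullSpace (LinearMap.range e).topologicalClosure
      (Submodule.isClosed_topologicalClosure _) (fun s hs ξ => ?_) (fun ξ hξ => ?_)
    · rw [DenseRange, ← LinearMap.coe_range]
      exact (Submodule.dense_iff_topologicalClosure_eq_top (s := LinearMap.range e)).2 this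
    · obtain ⟨t, ht, rfl⟩ := ha.surj s hs
      refine Submodule.le_topologicalClosure _ ⟨(Finsupp.single ⟨t, ht⟩ ξ, 0), ?_⟩
      simp [e, hsingle]
    · exact Submodule.le_topologicalClosure _ ⟨(0, ⟨ξ, hξ⟩), by simp [e]⟩
  have hpyth : ∀ x y : L, inner ℂ x y = 0 → ‖x + y‖ ^ 2 = ‖x‖ ^ 2 + ‖y‖ ^ 2 := by
    intro x y h
    simpa only [sq] using norm_add_sq_eq_norm_sq_add_norm_sq_of_inner_eq_zero x y h
  have hbound : ∀ x, ‖g x‖ ≤ ‖d‖ * ‖e x‖ := by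
    rintro ⟨f, ξ, hξ⟩
    refine le_of_sq_le_sq ?_ (by positivity)
    change ‖Ψ d f + d ξ‖ ^ 2 ≤ (‖d‖ * ‖Ψ 1 f + ξ‖) ^ 2
    rw [mul_pow, hpyth _ _ (horth d hd f _ (hS.bicommutant_nullSpace hd.1 hξ)),
      hpyth _ _ (horth 1 (one_mem _) f ξ hξ), mul_add]
    refine add_le_add (hnorm f) ?_
    rw [← mul_pow]
    exact pow_le_pow_left₀ (norm_nonneg _) (d.le_opNorm ξ) 2
  refine ⟨g.extendOfNorm e, fun s hs => ?_, fun ξ hξ => ?_,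
    LinearMap.opNorm_extendOfNorm_le hdense (norm_nonneg _) hbound⟩
  · ext ξ
    have := g.extendOfNorm_eq hdense ⟨_, hbound⟩ (Finsupp.single ⟨s, hs⟩ ξ, 0)
    simpa [e, g, hsingle] using this
  · have := g.extendOfNorm_eq hdense ⟨_, hbound⟩ (0, ⟨ξ, hξ⟩)
    simpa [e, g] using this

end OddTriple

end Lift

/-! ### Algebraic properties of lifts -/

section Lift

variable {L : Type*} [NormedAddCommGroup L] [InnerProductSpace ℂ L] [CompleteSpace L]

/-- `T` is the operator to which the extension of `a` carries `z`. -/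
structure IsLift (J : L →L[ℂ] L) (S : Submodule ℂ (L →L[ℂ] L))
    (a : (L →L[ℂ] L) →ₗ[ℂ] (L →L[ℂ] L)) (z T : L →L[ℂ] L) : Prop where
  mul : ∀ s ∈ S, T * a s = a (evenPart J z * s) + a (oddPart J z) * a s
  apply : ∀ ξ ∈ nullSpace S, T ξ = z ξ

namespace OddTriple

variable {J : L →L[ℂ] L} {S : Submodule ℂ (L →L[ℂ] L)} (hS : OddTriple J S)
  {a : (L →L[ℂ] L) →ₗ[ℂ] (L →L[ℂ] L)} (ha : TripleAut S a)

include hS ha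

theorem isLift_unique {z T T' : L →L[ℂ] L} (h : IsLift J S a z T) (h' : IsLift J S a z T') :
    T = T' :=
  hS.ext_of_lift ha (fun s hs => (h.mul s hs).trans (h'.mul s hs).symm)
    fun ξ hξ => (h.apply ξ hξ).trans (h'.apply ξ hξ).symm

/-- The operator `a(s)* a(s)` is the lift of the even element `s* s`, and even lifts do not increase
the norm. -/
theorem norm_le {s : L →L[ℂ] L} (hs : s ∈ S) : ‖a s‖ ≤ ‖s‖ := by
  have hss := hS.mul_mem_evenAlgebra (hS.star_mem s hs) hs
  obtain ⟨T, h1, h2, h3⟩ := hS.exists_even_lift ha hss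
  have hT : star (a s) * a s = T := by
    refine hS.ext_of_lift ha (fun t ht => ?_) fun ξ hξ => ?_
    · rw [h1 t ht, ha.map_mul _ (hS.star_mem s hs) _ hs _ ht, ha.map_star s hs]
    · rw [h2 ξ hξ]
      change star (a s) (a s ξ) = star s (s ξ)
      rw [hS.apply_nullSpace ha hs hξ, hξ s hs, map_zero, map_zero]
  rw [← hT, CStarRing.norm_star_mul_self, CStarRing.norm_star_mul_self] at h3
  exact abs_le_of_sq_le_sq' (by simpa only [sq] using h3) (norm_nonneg _) |>.2

/-- The even and odd parts are treated separately, each contributing at most `‖z‖`. The crude factor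
`2` is harmless: only some uniform bound is needed for the limit arguments. -/
theorem exists_isLift {z : L →L[ℂ] L} (hz : z ∈ bicommutant S) :
    ∃ T, IsLift J S a z T ∧ ‖T‖ ≤ 2 * ‖z‖ := by
  obtain ⟨T, h1, h2, h3⟩ := hS.exists_even_lift ha (hS.evenPart_mem_evenAlgebra hz)
  have ho := hS.oddPart_mem hz
  refine ⟨T + a (oddPart J z), ⟨fun s hs => by rw [add_mul, h1 s hs], fun ξ hξ => ?_⟩, ?_⟩
  · rw [add_apply, h2 ξ hξ, hS.apply_nullSpace ha ho hξ, add_zero]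
    conv_rhs => rw [← evenPart_add_oddPart J z, add_apply, hξ _ ho, add_zero]
  · have := norm_add_le T (a (oddPart J z))
    have := hS.norm_le ha ho
    have := hS.norm_oddPart_le z
    have := hS.norm_evenPart_le z
    linarith

theorem isLift_mem {z T : L →L[ℂ] L} (hz : z ∈ bicommutant S) (h : IsLift J S a z T) :
    T ∈ bicommutant S := by
  intro U hU
  have hU' : ∀ s ∈ S, U * a s = a s * U := fun s hs => (hU _ (ha.map_mem s hs)).symm
  refine hS.ext_of_lift ha (fun s hs => ?_) fun ξ hξ => ?_
  · have hds := hS.even_mul_mem (hS.evenPart_mem hz) (hS.conj_evenPart z) hs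
    rw [mul_assoc U, mul_assoc T, hU' s hs, ← mul_assoc T, h.mul s hs, mul_add, add_mul, hU' _ hds,
      ← mul_assoc U, hU' _ (hS.oddPart_mem hz), mul_assoc, hU' s hs, mul_assoc]
  · change U (T ξ) = T (U ξ)
    have hUξ : U ξ ∈ nullSpace S := by
      intro s hs
      have : s (U ξ) = U (s ξ) := DFunLike.congr_fun (hU s hs) ξ
      rw [this, hξ s hs, map_zero]
    rw [h.apply ξ hξ, h.apply _ hUξ]
    exact DFunLike.congr_fun (hz U hU) ξ

theorem isLift_of_mem {s : L →L[ℂ] L} (hs : s ∈ S) : IsLift J S a s (a s) := by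
  refine ⟨fun t ht => ?_, fun ξ hξ => ?_⟩
  · rw [hS.evenPart_of_odd (hS.odd s hs), hS.oddPart_of_odd (hS.odd s hs), zero_mul, map_zero,
      zero_add]
  · rw [hS.apply_nullSpace ha hs hξ, hξ s hs]

theorem isLift_one : IsLift J S a 1 1 := by
  have h : J * 1 * J = (1 : L →L[ℂ] L) := by rw [mul_one, hS.sq_eq_one]
  refine ⟨fun t ht => ?_, fun ξ hξ => rfl⟩
  rw [hS.evenPart_of_even h, hS.oddPart_of_even h, map_zero, zero_mul, add_zero, one_mul, one_mul]

theorem isLift_add {z w T U : L →L[ℂ] L} (h : IsLift J S a z T) (h' : IsLift J S a w U) :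
    IsLift J S a (z + w) (T + U) := by
  refine ⟨fun t ht => ?_, fun ξ hξ => ?_⟩
  · rw [add_mul, h.mul t ht, h'.mul t ht]
    simp only [map_add, add_mul]
    abel
  · rw [add_apply, add_apply, h.apply ξ hξ, h'.apply ξ hξ]

theorem isLift_smul {z T : L →L[ℂ] L} (c : ℂ) (h : IsLift J S a z T) :
    IsLift J S a (c • z) (c • T) := by
  refine ⟨fun t ht => ?_, fun ξ hξ => ?_⟩
  · rw [smul_mul_assoc, h.mul t ht, map_smul, map_smul, map_smul, smul_mul_assoc, smul_mul_assoc,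
      map_smul, smul_add]
  · rw [smul_apply, smul_apply, h.apply ξ hξ]

/-- Expanding `T U a(t)` produces the term `a(z₁) a(w₀ t)`, which `map_mul_even` turns into `a(z₁
w₀) a(t)`; the rest matches the even and odd parts of `z w`. -/
theorem isLift_mul {z w T U : L →L[ℂ] L} (hz : z ∈ bicommutant S) (hw : w ∈ bicommutant S)
    (h : IsLift J S a z T) (h' : IsLift J S a w U) : IsLift J S a (z * w) (T * U) := by
  refine ⟨fun t ht => ?_, fun ξ hξ => ?_⟩
  · have ez := hS.evenPart_mem_evenAlgebra hz
    have ew := hS.evenPart_mem_evenAlgebra hw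
    have oz := hS.oddPart_mem hz
    have ow := hS.oddPart_mem hw
    have ewt := hS.even_mul_mem ew.1 ew.2 ht
    rw [mul_assoc, h'.mul t ht, mul_add, h.mul _ ewt, ← mul_assoc, ← mul_assoc T, h.mul _ ow, add_mul,
      ← hS.map_mul_even ha ew oz ht, ← ha.map_mul _ oz _ ow _ ht, hS.evenPart_mul, hS.oddPart_mul,
      add_mul, map_add, map_add, add_mul]
    simp only [mul_assoc]
    abel
  · change T (U ξ) = z (w ξ)
    rw [h'.apply ξ hξ, h.apply _ (hS.bicommutant_nullSpace hw hξ)]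

/-- Both operators are tested on, and paired with, vectors `a(s)η` and null vectors, which are
total. The mixed pairings vanish, since both operators and their defining data respect the
orthogonal splitting into these two parts. -/
theorem isLift_star {z T U : L →L[ℂ] L} (hz : z ∈ bicommutant S) (h : IsLift J S a z T)
    (h' : IsLift J S a (star z) U) : U = star T := by
  have hz' : star z ∈ bicommutant S := StarMemClass.star_mem (s := hS.algebra) hz
  have ez := hS.evenPart_mem_evenAlgebra hz
  have oz := hS.oddPart_mem hz
  have hTnull : ∀ ξ ∈ nullSpace S, T ξ ∈ nullSpace S := fun ξ hξ => by
    rw [h.apply ξ hξ]; exact hS.bicommutant_nullSpace hz hξ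
  have hUnull : ∀ ξ ∈ nullSpace S, U ξ ∈ nullSpace S := fun ξ hξ => by
    rw [h'.apply ξ hξ]; exact hS.bicommutant_nullSpace hz' hξ
  -- both operators agree after multiplication by `star (a s)` on the left
  have key : ∀ s ∈ S, ∀ t ∈ S, star (T * a s) * a t = star (a s) * (U * a t) := by
    intro s hs t ht
    have hes := hS.even_mul_mem ez.1 ez.2 hs
    have := hS.map_mul_even ha (StarMemClass.star_mem ez) (hS.star_mem s hs) ht
    rw [← star_mul, ha.map_star _ hes, ha.map_star _ hs] at this
    rw [h.mul s hs, h'.mul t ht, star_add, add_mul, mul_add, star_mul, hS.evenPart_star,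
      hS.oddPart_star, this, ha.map_star _ oz, mul_assoc]
  have hzero : ∀ s ∈ S, ∀ η, ∀ ξ ∈ nullSpace S, inner ℂ (a s η) ξ = 0 := by
    intro s hs η ξ hξ
    rw [← star_star (a s), inner_star_apply, ← ha.map_star s hs,
      hS.apply_nullSpace ha (hS.star_mem s hs) hξ, inner_zero_right]
  have horth : ∀ x : L, (∀ s ∈ S, ∀ η, inner ℂ (a s η) x = 0) → (∀ ξ ∈ nullSpace S,
      inner ℂ ξ x = 0) → x = 0 := by
    intro x h1 h2
    have : x ∈ nullSpace S := by
      intro s hs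
      refine ext_inner_left ℂ fun y => ?_
      obtain ⟨t, ht, hst⟩ := ha.surj _ (hS.star_mem s hs)
      rw [inner_zero_right, ← inner_star_apply, ← hst, h1 t ht]
    exact inner_self_eq_zero.1 (h2 x this)
  have hTs : ∀ s ∈ S, ∀ η, ∀ ξ ∈ nullSpace S, inner ℂ (T (a s η)) ξ = 0 := by
    intro s hs η ξ hξ
    have : T (a s η) = a (evenPart J z * s) η + a (oddPart J z) (a s η) :=
      DFunLike.congr_fun (h.mul s hs) η
    rw [this, inner_add_left, hzero _ (hS.even_mul_mem ez.1 ez.2 hs) _ _ hξ,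
      hzero _ oz _ _ hξ, add_zero]
  have hUs : ∀ s ∈ S, ∀ η, ∀ ξ ∈ nullSpace S, inner ℂ ξ (U (a s η)) = 0 := by
    intro s hs η ξ hξ
    have ez' := hS.evenPart_mem_evenAlgebra hz'
    have : U (a s η) = a (evenPart J (star z) * s) η + a (oddPart J (star z)) (a s η) :=
      DFunLike.congr_fun (h'.mul s hs) η
    rw [this, ← inner_conj_symm, inner_add_left, hzero _ (hS.even_mul_mem ez'.1 ez'.2 hs) _ _ hξ,
      hzero _ (hS.oddPart_mem hz') _ _ hξ, add_zero, map_zero]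
  refine hS.ext_of_lift ha (fun t ht => ?_) fun ξ hξ => ?_
  · ext η
    refine sub_eq_zero.1 (horth _ (fun s hs ζ => ?_) fun ξ hξ => ?_)
    · change inner ℂ (a s ζ) (U (a t η) - star T (a t η)) = 0
      rw [inner_sub_right, sub_eq_zero, inner_apply_star]
      have : inner ℂ ζ (star (T * a s) (a t η)) = inner ℂ ζ (star (a s) (U (a t η))) :=
        congrArg (fun V : L →L[ℂ] L => inner ℂ ζ (V η)) (key s hs t ht)
      rw [inner_apply_star, inner_apply_star] at this
      exact this.symm
    · change inner ℂ ξ (U (a t η) - star T (a t η)) = 0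
      rw [inner_sub_right, inner_apply_star, hUs t ht η ξ hξ, ← inner_conj_symm,
        hzero t ht η _ (hTnull ξ hξ), map_zero, sub_zero]
  · refine sub_eq_zero.1 (horth _ (fun s hs ζ => ?_) fun ζ hζ => ?_)
    · rw [inner_sub_right, inner_apply_star, hTs s hs ζ ξ hξ, hzero s hs ζ _ (hUnull ξ hξ),
        sub_zero]
    · rw [inner_sub_right, inner_apply_star, h.apply ζ hζ, h'.apply ξ hξ, inner_apply_star,
        sub_self]

/-- This makes lifting compatible with the grading: even elements have even lifts, and the odd part
of a lift is the image of the odd part. -/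
theorem isLift_conj {z T : L →L[ℂ] L} (hz : z ∈ bicommutant S) (h : IsLift J S a z T) :
    IsLift J S a (J * z * J) (J * T * J) := by
  have he : evenPart J (J * z * J) = evenPart J z := by
    rw [evenPart_apply, evenPart_apply, hS.conj_conj, add_comm]
  have ho : oddPart J (J * z * J) = -oddPart J z := by
    rw [oddPart_apply, oddPart_apply, hS.conj_conj, ← smul_neg, neg_sub]
  refine ⟨fun s hs => ?_, fun ξ hξ => ?_⟩
  · have h1 : J * a s = -(a s * J) := by
      have := congrArg (· * J) (hS.odd _ (ha.map_mem s hs))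
      simpa only [mul_assoc, hS.sq_eq_one, mul_one, neg_mul] using this
    have h2 := hS.odd _ (ha.map_mem _
      (hS.even_mul_mem (hS.evenPart_mem hz) (hS.conj_evenPart z) hs))
    have h3 := hS.odd _ (ha.map_mem _ (hS.oddPart_mem hz))
    have h4 := hS.odd _ (ha.map_mem _ hs)
    rw [he, ho, map_neg, neg_mul, mul_assoc, h1, mul_neg, ← mul_assoc, mul_assoc J T,
      h.mul s hs, mul_add, add_mul, h2, hS.conj_mul, h3, h4]
    simp only [neg_mul_neg, neg_add_rev, neg_neg]
    abel
  · have hJ : J ξ ∈ nullSpace S := by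
      intro s hs
      have h5 : J (s (J ξ)) = -(s ξ) := DFunLike.congr_fun (hS.odd s hs) ξ
      have h6 : J (J (s (J ξ))) = s (J ξ) := DFunLike.congr_fun hS.sq_eq_one _
      rw [← h6, h5, hξ s hs, neg_zero, map_zero]
    change J (T (J ξ)) = J (z (J ξ))
    rw [h.apply _ hJ]

theorem isLift_comp {b : (L →L[ℂ] L) →ₗ[ℂ] (L →L[ℂ] L)} (hb : TripleAut S b)
    {z T U : L →L[ℂ] L} (hz : z ∈ bicommutant S)
    (h : IsLift J S b z T) (h' : IsLift J S a T U) : IsLift J S (a ∘ₗ b) z U := by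
  have hT := hS.isLift_mem hb hz h
  -- The odd part of `T` and `b (oddPart J z)` are both lifts of `oddPart J z`.
  have ho : oddPart J T = b (oddPart J z) := by
    have h1 := hS.isLift_smul hb 2⁻¹
      (hS.isLift_add hb h (hS.isLift_smul hb (-1) (hS.isLift_conj hb hz h)))
    have h2 := hS.isLift_of_mem hb (hS.oddPart_mem hz)
    rw [oddPart_apply] at h2
    rw [neg_one_smul, neg_one_smul, ← sub_eq_add_neg, ← sub_eq_add_neg] at h1
    rw [oddPart_apply J T, oddPart_apply J z]
    exact hS.isLift_unique hb h1 h2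
  refine ⟨fun s hs => ?_, fun ξ hξ => ?_⟩
  · have h1 := h.mul s hs
    conv_lhs at h1 => rw [← evenPart_add_oddPart J T, add_mul, ho]
    have h2 := add_right_cancel h1
    simp only [LinearMap.comp_apply]
    rw [h'.mul _ (hb.map_mem s hs), h2, ho]
  · rw [h'.apply ξ hξ, h.apply ξ hξ]

theorem eq_of_isLift_of_id {z T : L →L[ℂ] L} (h : IsLift J S a z T)
    (hid : ∀ s ∈ S, a s = s) (hz : z ∈ bicommutant S) : T = z := by
  refine hS.isLift_unique ha h ⟨fun s hs => ?_, fun ξ hξ => rfl⟩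
  rw [hid s hs, hid _ (hS.even_mul_mem (hS.evenPart_mem hz) (hS.conj_evenPart z) hs),
    hid _ (hS.oddPart_mem hz), ← add_mul, evenPart_add_oddPart]

end OddTriple

end Lift

/-! ### The lift as a normal star homomorphism -/

section Lift

variable {L : Type*} [NormedAddCommGroup L] [InnerProductSpace ℂ L] [CompleteSpace L]

namespace OddTriple

variable {J : L →L[ℂ] L} {S : Submodule ℂ (L →L[ℂ] L)} (hS : OddTriple J S)
  {a : (L →L[ℂ] L) →ₗ[ℂ] (L →L[ℂ] L)} (ha : TripleAut S a)

/-- The extension of a triple automorphism of `S` to the double commutant of `S`. -/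
def lift : hS.algebra →⋆ₐ[ℂ] hS.algebra :=
  have h := fun z : hS.algebra => (hS.exists_isLift ha z.2).choose_spec.1
  { toFun := fun z => ⟨(hS.exists_isLift ha z.2).choose, hS.isLift_mem ha z.2 (h z)⟩
    map_one' := Subtype.ext (hS.isLift_unique ha (h 1) (hS.isLift_one ha))
    map_mul' := fun z w => Subtype.ext
      (hS.isLift_unique ha (h (z * w)) (hS.isLift_mul ha z.2 w.2 (h z) (h w)))
    map_zero' := Subtype.ext (hS.isLift_unique ha (h 0) (by
      simpa using hS.isLift_smul ha 0 (h 0)))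
    map_add' := fun z w => Subtype.ext
      (hS.isLift_unique ha (h (z + w)) (hS.isLift_add ha (h z) (h w)))
    commutes' := fun c => Subtype.ext (hS.isLift_unique ha (h (algebraMap ℂ _ c)) (by
      have := hS.isLift_smul ha c (hS.isLift_one ha)
      rw [← Algebra.algebraMap_eq_smul_one] at this
      exact this))
    map_star' := fun z => Subtype.ext (hS.isLift_star ha z.2 (h z) (h (star z))) }

theorem isLift_lift (z : hS.algebra) : IsLift J S a z (hS.lift ha z) :=
  (hS.exists_isLift ha z.2).choose_spec.1

theorem norm_lift_le (z : hS.algebra) : ‖(hS.lift ha z : L →L[ℂ] L)‖ ≤ 2 * ‖(z : L →L[ℂ] L)‖ :=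
  (hS.exists_isLift ha z.2).choose_spec.2

theorem lift_of_mem {z : hS.algebra} (hz : (z : L →L[ℂ] L) ∈ S) :
    (hS.lift ha z : L →L[ℂ] L) = a z :=
  hS.isLift_unique ha (hS.isLift_lift ha z) (hS.isLift_of_mem ha hz)

theorem lift_congr {b : (L →L[ℂ] L) →ₗ[ℂ] (L →L[ℂ] L)} (hb : TripleAut S b)
    (hab : ∀ s ∈ S, a s = b s) (z : hS.algebra) : hS.lift ha z = hS.lift hb z := by
  refine Subtype.ext (hS.isLift_unique ha (hS.isLift_lift ha z)
    ⟨fun s hs => ?_, (hS.isLift_lift hb z).apply⟩)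
  rw [hab s hs, hab _ (hS.even_mul_mem (hS.evenPart_mem z.2) (hS.conj_evenPart z) hs),
    hab _ (hS.oddPart_mem z.2)]
  exact (hS.isLift_lift hb z).mul s hs

theorem lift_comp {b c : (L →L[ℂ] L) →ₗ[ℂ] (L →L[ℂ] L)} (hb : TripleAut S b)
    (hc : TripleAut S c) (habc : ∀ s ∈ S, c s = a (b s)) (z : hS.algebra) :
    hS.lift hc z = hS.lift ha (hS.lift hb z) := by
  have h := hS.isLift_comp ha hb z.2 (hS.isLift_lift hb z) (hS.isLift_lift ha _)
  refine Subtype.ext (hS.isLift_unique hc (hS.isLift_lift hc z) ⟨fun s hs => ?_, h.apply⟩)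
  rw [habc s hs, habc _ (hS.even_mul_mem (hS.evenPart_mem z.2) (hS.conj_evenPart z) hs),
    habc _ (hS.oddPart_mem z.2)]
  exact h.mul s hs

theorem lift_of_id (hid : ∀ s ∈ S, a s = s) (z : hS.algebra) : hS.lift ha z = z :=
  Subtype.ext (hS.eq_of_isLift_of_id ha (hS.isLift_lift ha z) hid z.2)

/-- The inclusion of the double commutant, as a linear isometry. -/
def incl : hS.algebra →ₗᵢ[ℂ] (L →L[ℂ] L) where
  toFun := Subtype.val
  map_add' _ _ := rfl
  map_smul' _ _ := rfl
  norm_map' _ := rfl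

theorem isClosed_range_incl : IsClosed[ultraweak L L] (Set.range hS.incl) := by
  have : Set.range hS.incl = Set.centralizer (Set.centralizer (S : Set (L →L[ℂ] L))) :=
    Subtype.range_coe
  rw [this]
  exact isClosed_centralizer _

@[simp] theorem incl_apply (z : hS.algebra) : hS.incl z = z := rfl

/-- The extension of `a`, as a linear map into `B(L)`. -/
def liftₗ : hS.algebra →ₗ[ℂ] (L →L[ℂ] L) where
  toFun z := hS.lift ha z
  map_add' z w := by rw [map_add]; rfl
  map_smul' c z := by rw [map_smul]; rfl

@[simp] theorem liftₗ_apply (z : hS.algebra) : hS.liftₗ ha z = hS.lift ha z := rfl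

/-- The square-summable sequences `h` such that all functionals `normalFunctional h k` are normal
along the extension of `a`. -/
def normalSequences : Submodule ℂ (lp (fun _ : ℕ => L) 2) where
  carrier := {h | ∀ k, IsNormal hS.incl.toLinearMap (normalFunctionalₗ h k ∘ₗ hS.liftₗ ha)}
  add_mem' := by
    intro h h' hh hh' k
    rw [← mem_normals]
    convert (normals hS.incl.toLinearMap).add_mem (hh k) (hh' k) using 1
    ext z
    simp [normalFunctional_eq_inner]
  zero_mem' := by
    intro k
    rw [← mem_normals]
    convert (normals hS.incl.toLinearMap).zero_mem using 1
    ext z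
    simp [normalFunctional_eq_inner]
  smul_mem' := by
    intro c h hh k
    rw [← mem_normals]
    convert (normals hS.incl.toLinearMap).smul_mem c (hh k) using 1
    ext z
    simp [normalFunctional_smul_left]

/-- Norm approximation of `h` gives norm approximation of the pulled back functionals, because lifts
are uniformly bounded; normal functionals on the weak* closed double commutant are norm closed. -/
theorem isClosed_normalSequences : IsClosed (hS.normalSequences ha : Set (lp (fun _ : ℕ => L) 2)) := by
  rw [← closure_subset_iff_isClosed]
  intro h hh k
  refine isNormal_of_approx hS.incl hS.isClosed_range_incl _ fun ε hε => ?_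
  -- The `2` cancels the bound `2 ‖z‖` for lifts, and `+ 1` avoids dividing by zero.
  obtain ⟨h', hh', hd⟩ := Metric.mem_closure_iff.1 hh (ε / (2 * (‖k‖ + 1))) (by positivity)
  refine ⟨_, hh' k, fun z => ?_⟩
  simp only [LinearMap.comp_apply, normalFunctionalₗ_apply, liftₗ_apply, normalFunctional_eq_inner]
  rw [← inner_sub_right, ← map_sub, ← normalFunctional_eq_inner]
  rw [dist_eq_norm] at hd
  calc _ ≤ ‖k‖ * ‖h - h'‖ * ‖(hS.lift ha z : L →L[ℂ] L)‖ := norm_normalFunctional_le _ _ _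
    _ ≤ (‖k‖ + 1) * (ε / (2 * (‖k‖ + 1))) * (2 * ‖(z : L →L[ℂ] L)‖) := by
        gcongr
        · linarith
        · exact hS.norm_lift_le ha z
    _ = ε * ‖z‖ := by field_simp; rfl

/-- On a vector `a(s)ξ` the lift is given by values of `a` on elements of `S` depending normally on
`z`; on the null space it is `z` itself. These vectors are total and the admissible ones form a
closed subspace. -/
theorem single_mem_normalSequences
    (hn : NormalMap S.subtype (a ∘ₗ S.subtype)) (n : ℕ) (x : L) :
    lp.single 2 n x ∈ hS.normalSequences ha := by
  have hfun : ∀ x k (T : L →L[ℂ] L),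
      normalFunctional (lp.single 2 n x) k T = inner ℂ (k n) (T x) := by
    intro x k T
    rw [normalFunctional, tsum_eq_single n]
    · simp
    · intro m hm
      rw [lp.single_apply_ne _ _ _ hm]; simp
  have htop := hS.eq_top_of_range_of_nullSpace
    ((hS.normalSequences ha).comap
      (lp.singleContinuousLinearMap ℂ (fun _ : ℕ => L) 2 n).toLinearMap)
    ((hS.isClosed_normalSequences ha).preimage
      (lp.singleContinuousLinearMap ℂ (fun _ : ℕ => L) 2 n).continuous) ?_ ?_
  · have : x ∈ (hS.normalSequences ha).comap
      (lp.singleContinuousLinearMap ℂ (fun _ : ℕ => L) 2 n).toLinearMap := by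
      rw [htop]; exact Submodule.mem_top
    exact this
  · intro t ht ξ
    obtain ⟨s, hs, rfl⟩ := ha.surj t ht
    change lp.single 2 n (a s ξ) ∈ hS.normalSequences ha
    intro k
    let g₁ : hS.algebra →ₗ[ℂ] S :=
      { toFun := fun z => ⟨evenPart J z * s,
          hS.even_mul_mem (hS.evenPart_mem z.2) (hS.conj_evenPart z) hs⟩
        map_add' := fun z w => Subtype.ext (by simp [add_mul])
        map_smul' := fun c z => Subtype.ext (by simp) }
    let g₂ : hS.algebra →ₗ[ℂ] S :=
      { toFun := fun z => ⟨oddPart J z, hS.oddPart_mem z.2⟩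
        map_add' := fun z w => Subtype.ext (by simp)
        map_smul' := fun c z => Subtype.ext (by simp) }
    have h₁ : NormalMap hS.incl.toLinearMap (S.subtype ∘ₗ g₁) := by
      have := (normalMap_mul (normalMap_evenPart J) 1 s).comp
        (i := hS.incl.toLinearMap) (g := hS.incl.toLinearMap) (normalMap_self _)
      convert this using 1
      ext z
      simp [g₁]
    have h₂ : NormalMap hS.incl.toLinearMap (S.subtype ∘ₗ g₂) :=
      (normalMap_oddPart J).comp (i := hS.incl.toLinearMap) (g := hS.incl.toLinearMap)
        (normalMap_self _)
    have k₁ := (hn.comp h₁) (lp.single 2 n ξ) k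
    have k₂ := (hn.comp h₂) (lp.single 2 n (a s ξ)) k
    rw [← mem_normals]
    convert (normals hS.incl.toLinearMap).add_mem k₁ k₂ using 1
    ext z
    have := DFunLike.congr_fun ((hS.isLift_lift ha z).mul s hs) ξ
    change (hS.lift ha z : L →L[ℂ] L) (a s ξ) = a (evenPart J z * s) ξ +
      a (oddPart J z) (a s ξ) at this
    simp only [LinearMap.comp_apply, LinearMap.add_apply, normalFunctionalₗ_apply, liftₗ_apply,
      hfun, this, inner_add_right]
    rfl
  · intro ξ hξ
    change lp.single 2 n ξ ∈ hS.normalSequences ha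
    intro k
    refine ⟨lp.single 2 n ξ, k, fun z => ?_⟩
    simp only [LinearMap.comp_apply, normalFunctionalₗ_apply, liftₗ_apply, hfun]
    rw [(hS.isLift_lift ha z).apply ξ hξ]
    rfl

/-- The extension of a normal triple automorphism is normal. -/
theorem normalMap_lift (hn : NormalMap S.subtype (a ∘ₗ S.subtype)) :
    NormalMap hS.incl.toLinearMap (hS.liftₗ ha) := by
  intro h k
  have : h ∈ hS.normalSequences ha := by
    refine (hS.isClosed_normalSequences ha).mem_of_tendsto
      (lp.hasSum_single (by norm_num) h) (Filter.Eventually.of_forall fun F => ?_)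
    exact Submodule.sum_mem _ fun n _ => hS.single_mem_normalSequences ha hn n _
  exact this k

end OddTriple

end Lift

/-! ### Approximate units built from the triple system -/

section Orbit

variable {L : Type*} [NormedAddCommGroup L] [InnerProductSpace ℂ L] [CompleteSpace L]

theorem norm_sq_of_sum_eq_one {ι : Type*} (F : Finset ι) (v : ι → L →L[ℂ] L) (c : L →L[ℂ] L)
    (h : ∑ i ∈ F, star (v i) * v i + star c * c = 1) (x : L) :
    ∑ i ∈ F, ‖v i x‖ ^ 2 + ‖c x‖ ^ 2 = ‖x‖ ^ 2 := by
  have h1 := congrArg (fun T : L →L[ℂ] L => inner ℂ x (T x)) h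
  have h2 : ∀ T : L →L[ℂ] L, inner ℂ x ((star T * T) x) = ((‖T x‖ ^ 2 : ℝ) : ℂ) := by
    intro T
    change inner ℂ x (star T (T x)) = _
    rw [inner_apply_star, inner_self_eq_norm_sq_to_K]
    simp
  simp only [add_apply, sum_apply, inner_add_right, inner_sum, h2] at h1
  rw [show ((1 : L →L[ℂ] L) x) = x from rfl, inner_self_eq_norm_sq_to_K] at h1
  apply Complex.ofReal_injective
  simpa using h1

namespace OddTriple

variable {J : L →L[ℂ] L} {S : Submodule ℂ (L →L[ℂ] L)} (hS : OddTriple J S)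

include hS

/-- Take `g = (p + δ)^(-1/2)`, which lies in the even algebra. -/
theorem exists_inv_sqrt {p : L →L[ℂ] L} (hp : p ∈ hS.evenAlgebra) (h0 : 0 ≤ p) {δ : ℝ}
    (hδ : 0 < δ) :
    ∃ g ∈ hS.evenAlgebra, star g = g ∧ g * p * g + (δ : ℂ) • (g * g) = 1 := by
  let q : L →L[ℂ] L := p + (δ : ℂ) • 1
  have hq : q ∈ hS.evenAlgebra := add_mem hp (hS.evenAlgebra.smul_mem (one_mem _) _)
  have hδ1 : (δ : ℂ) • (1 : L →L[ℂ] L) = algebraMap ℝ _ δ := by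
    rw [Algebra.algebraMap_eq_smul_one]; rfl
  have hle : algebraMap ℝ (L →L[ℂ] L) δ ≤ q := by
    rw [← hδ1]; exact le_add_of_nonneg_left h0
  have hpos : IsStrictlyPositive (algebraMap ℝ (L →L[ℂ] L) δ) := by
    exact IsStrictlyPositive.iff_of_unital.2 ⟨by
      rw [Algebra.algebraMap_eq_smul_one]; exact smul_nonneg hδ.le zero_le_one,
      (IsUnit.mk0 δ hδ.ne').map (algebraMap ℝ (L →L[ℂ] L))⟩
  have hqu : IsUnit q := CStarAlgebra.isUnit_of_le _ hle hpos
  obtain ⟨r, hr, hr', hrr⟩ := hS.exists_sqrt hq (hpos.nonneg.trans hle)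
  have hru : IsUnit r := by
    rw [← hrr] at hqu
    exact ((Commute.refl r).isUnit_mul_iff.1 hqu).1
  obtain ⟨u, rfl⟩ := hru
  have hu' : star (↑u⁻¹ : L →L[ℂ] L) = ↑u⁻¹ := by
    have h1 : star (↑u⁻¹ : L →L[ℂ] L) * (u : L →L[ℂ] L) = 1 := by
      conv_lhs => rw [← hr']
      rw [← star_mul, Units.mul_inv, star_one]
    calc star (↑u⁻¹ : L →L[ℂ] L) = star (↑u⁻¹ : L →L[ℂ] L) * ((u : L →L[ℂ] L) * ↑u⁻¹) := by
          rw [Units.mul_inv, mul_one]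
      _ = ↑u⁻¹ := by rw [← mul_assoc, h1, one_mul]
  refine ⟨↑u⁻¹, hS.mem_evenAlgebra_of_commute hr fun T hT => hT.units_inv_left, hu', ?_⟩
  calc (↑u⁻¹ : L →L[ℂ] L) * p * ↑u⁻¹ + (δ : ℂ) • ((↑u⁻¹ : L →L[ℂ] L) * ↑u⁻¹)
      = ↑u⁻¹ * q * ↑u⁻¹ := by
        simp only [q, mul_add, add_mul, mul_smul_comm, smul_mul_assoc, mul_one]
    _ = 1 := by
        rw [← hrr, ← mul_assoc, Units.inv_mul, one_mul, Units.mul_inv]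

theorem exists_finsupp_near {ζ : L} (hζ : ζ ∈ (nullSpace S)ᗮ) {ε : ℝ} (hε : 0 < ε) :
    ∃ f : S →₀ L, ‖ζ - f.sum fun s ξ => (s : L →L[ℂ] L) ξ‖ < ε := by
  let Ψ : (S →₀ L) →ₗ[ℂ] L :=
    Finsupp.lsum ℂ fun s : S => ((s : L →L[ℂ] L) : L →ₗ[ℂ] L)
  let W := (LinearMap.range Ψ).topologicalClosure
  haveI : CompleteSpace W := (Submodule.isClosed_topologicalClosure _).completeSpace_coe
  have hW : Wᗮ ≤ nullSpace S := by
    intro v hv s hs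
    refine ext_inner_left ℂ fun x => ?_
    rw [← inner_star_apply, inner_zero_right]
    refine hv _ (Submodule.le_topologicalClosure _
      ⟨Finsupp.single ⟨star s, hS.star_mem s hs⟩ x, ?_⟩)
    simp [Ψ]
  have hmem : ζ ∈ W := by
    have := Submodule.orthogonal_le hW hζ
    rwa [Submodule.orthogonal_orthogonal] at this
  obtain ⟨_, ⟨f, rfl⟩, hf⟩ := Metric.mem_closure_iff.1 hmem ε hε
  exact ⟨f, by rw [← dist_eq_norm]; exact hf⟩

/-- An approximate unit built from elements of `S`, tested at one vector. -/
theorem exists_approx_unit (ζ : L) {ε : ℝ} (hε : 0 < ε) :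
    ∃ (F : Finset S) (v : S → hS.algebra) (c : hS.algebra),
      (∀ i, (v i : L →L[ℂ] L) ∈ S) ∧ (c : L →L[ℂ] L) ∈ hS.evenAlgebra ∧
      ∑ i ∈ F, star (v i) * v i + star c * c = 1 ∧
      ‖(c : L →L[ℂ] L) ζ‖ ^ 2 ≤ ‖(nullSpace S).starProjection ζ‖ ^ 2 + ε ∧
      ∀ ξ ∈ nullSpace S, ‖(c : L →L[ℂ] L) ξ‖ = ‖ξ‖ := by
  set P := (nullSpace S).starProjection
  have hζ : ζ - P ζ ∈ (nullSpace S)ᗮ := Submodule.sub_starProjection_mem_orthogonal _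
  have hη : 0 < √ε / 2 := by positivity
  obtain ⟨f, hf⟩ := hS.exists_finsupp_near hζ hη
  -- With `p = ∑ s s*` and `g = (p + t²)^(-1/2)`, the elements `v_s = s* g` and `c = t g` satisfy `∑
  -- v_s* v_s + c* c = g p g + t² g² = 1`.
  let p : L →L[ℂ] L := ∑ s ∈ f.support, (s : L →L[ℂ] L) * star (s : L →L[ℂ] L)
  have hp : p ∈ hS.evenAlgebra :=
    sum_mem fun s _ => hS.mul_mem_evenAlgebra s.2 (hS.star_mem _ s.2)
  have hp0 : 0 ≤ p := Finset.sum_nonneg fun s _ => mul_star_self_nonneg _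
  let m : ℝ := ∑ s ∈ f.support, ‖f s‖
  have hm : 0 ≤ m := Finset.sum_nonneg fun _ _ => norm_nonneg _
  -- Since `‖g s‖ = ‖v_s‖ ≤ 1`, one has `‖c s x‖ ≤ t ‖x‖`. Hence `c` moves the approximating sum to
  -- a vector of norm at most `t m ≤ √ε / 2`.
  let t : ℝ := √ε / 2 / (m + 1)
  have ht : 0 < t := by positivity
  obtain ⟨g, hg, hg', hgp⟩ := hS.exists_inv_sqrt hp hp0 (δ := t ^ 2) (by positivity)
  let v : S → L →L[ℂ] L := fun s => star (s : L →L[ℂ] L) * g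
  let c : L →L[ℂ] L := (t : ℂ) • g
  have hv : ∀ s, v s ∈ S := fun s => hS.mul_even_mem hg.1 hg.2 (hS.star_mem _ s.2)
  have hc : c ∈ hS.evenAlgebra := hS.evenAlgebra.smul_mem hg _
  have hsum : ∑ s ∈ f.support, star (v s) * v s + star c * c = 1 := by
    rw [← hgp]
    congr 1
    · simp only [v, p, star_mul, star_star, hg', Finset.mul_sum, Finset.sum_mul, mul_assoc]
    · simp only [c, star_smul, hg', smul_mul_smul_comm]
      congr 1
      simp [sq]
  have hnorm := norm_sq_of_sum_eq_one f.support v c hsum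
  have hvn : ∀ s ∈ f.support, ‖v s‖ ≤ 1 := by
    intro s hs
    refine ContinuousLinearMap.opNorm_le_bound _ zero_le_one fun x => ?_
    rw [one_mul]
    refine le_of_sq_le_sq ?_ (norm_nonneg _)
    rw [← hnorm x]
    have := Finset.single_le_sum (f := fun s => ‖v s x‖ ^ 2) (fun _ _ => by positivity) hs
    nlinarith [sq_nonneg ‖c x‖]
  have hcn : ∀ x, ‖c x‖ ≤ ‖x‖ := by
    intro x
    refine le_of_sq_le_sq ?_ (norm_nonneg _)
    rw [← hnorm x]
    have := Finset.sum_nonneg (s := f.support) (f := fun s => ‖v s x‖ ^ 2)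
      fun _ _ => by positivity
    linarith
  have hcs : ∀ s ∈ f.support, ∀ x, ‖c ((s : L →L[ℂ] L) x)‖ ≤ t * ‖x‖ := by
    intro s hs x
    have h1 : ‖g * (s : L →L[ℂ] L)‖ ≤ 1 := by
      rw [← norm_star, star_mul, hg']; exact hvn s hs
    change ‖(t : ℂ) • (g * (s : L →L[ℂ] L)) x‖ ≤ _
    rw [norm_smul, Complex.norm_real, Real.norm_of_nonneg ht.le]
    gcongr
    simpa using (g * (s : L →L[ℂ] L)).le_of_opNorm_le h1 x
  have hc1 : ‖c (ζ - P ζ)‖ ≤ √ε := by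
    set w := f.sum fun s ξ => (s : L →L[ℂ] L) ξ with hw
    have h1 : ‖c w‖ ≤ √ε / 2 := by
      rw [hw, Finsupp.sum, map_sum]
      calc _ ≤ ∑ s ∈ f.support, ‖c ((s : L →L[ℂ] L) (f s))‖ := norm_sum_le _ _
        _ ≤ ∑ s ∈ f.support, t * ‖f s‖ := Finset.sum_le_sum fun s hs => hcs s hs _
        _ = t * m := by rw [Finset.mul_sum]
        _ ≤ √ε / 2 := by
            rw [div_mul_eq_mul_div, div_le_iff₀ (by positivity)]
            nlinarith
    calc ‖c (ζ - P ζ)‖ = ‖c (ζ - P ζ - w) + c w‖ := by rw [← map_add, sub_add_cancel]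
      _ ≤ ‖c (ζ - P ζ - w)‖ + ‖c w‖ := norm_add_le _ _
      _ ≤ √ε / 2 + √ε / 2 := add_le_add ((hcn _).trans hf.le) h1
      _ = √ε := by ring
  have hPn : P ζ ∈ nullSpace S := Submodule.starProjection_apply_mem _ _
  refine ⟨f.support, fun s => ⟨v s, hS.mem_of_mem (hv s)⟩, ⟨c, hc.1⟩, hv, hc, Subtype.ext ?_, ?_,
    fun ξ hξ => ?_⟩
  · simpa using hsum
  · have horth : inner ℂ (c (P ζ)) (c (ζ - P ζ)) = 0 := by
      rw [← inner_star_apply]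
      exact hζ _ (hS.bicommutant_nullSpace (StarMemClass.star_mem (s := hS.algebra) hc.1)
        (hS.bicommutant_nullSpace hc.1 hPn))
    have h2 := norm_add_sq_eq_norm_sq_add_norm_sq_of_inner_eq_zero _ _ horth
    rw [← map_add, add_sub_cancel] at h2
    change ‖c ζ‖ ^ 2 ≤ _
    have h3 := hcn (P ζ)
    have h4 : ‖c (ζ - P ζ)‖ ^ 2 ≤ ε := by
      calc _ ≤ √ε ^ 2 := pow_le_pow_left₀ (norm_nonneg _) hc1 2
        _ = ε := Real.sq_sqrt hε.le
    have h5 := pow_le_pow_left₀ (norm_nonneg _) h3 2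
    nlinarith
  · change ‖c ξ‖ = ‖ξ‖
    have := hnorm ξ
    rw [Finset.sum_eq_zero fun s _ => by rw [hξ _ (hv s), norm_zero, sq, zero_mul], zero_add] at this
    exact (sq_eq_sq₀ (norm_nonneg _) (norm_nonneg _)).1 this

variable {a : (L →L[ℂ] L) →ₗ[ℂ] (L →L[ℂ] L)} (ha : TripleAut S a)

/-- Lifts of `star z` agree with `star z` on the null space, so by duality the null component of the
image vector is independent of the automorphism. -/
theorem starProjection_lift (z : hS.algebra) (h : L) :
    (nullSpace S).starProjection ((hS.lift ha z : L →L[ℂ] L) h) =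
      (nullSpace S).starProjection ((z : L →L[ℂ] L) h) := by
  rw [← sub_eq_zero, ← map_sub, Submodule.starProjection_apply_eq_zero_iff]
  intro ξ hξ
  have h1 : inner ℂ ξ ((hS.lift ha z : L →L[ℂ] L) h) =
      inner ℂ ((hS.lift ha (star z) : L →L[ℂ] L) ξ) h := by
    rw [map_star]; exact (inner_star_apply _ _ _).symm
  rw [inner_sub_right, h1, (hS.isLift_lift ha (star z)).apply ξ hξ]
  change inner ℂ (star (z : L →L[ℂ] L) ξ) h - _ = 0
  rw [inner_star_apply, sub_self]

theorem norm_lift_sq (F : Finset S) (v : S → hS.algebra) (c y : hS.algebra)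
    (hsum : ∑ i ∈ F, star (v i) * v i + star c * c = 1) (h : L) :
    ‖(hS.lift ha y : L →L[ℂ] L) h‖ ^ 2 =
      ∑ i ∈ F, ‖(hS.lift ha (v i * y) : L →L[ℂ] L) h‖ ^ 2 +
        ‖(hS.lift ha (c * y) : L →L[ℂ] L) h‖ ^ 2 := by
  have h1 := congrArg (fun z => (hS.lift ha z : L →L[ℂ] L)) hsum
  simp only [map_add, map_sum, map_mul, map_star, map_one] at h1
  rw [← norm_sq_of_sum_eq_one F (fun i => hS.lift ha (v i)) (hS.lift ha c) (by simpa using h1)]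
  simp only [map_mul]
  rfl

end OddTriple

end Orbit

/-! ### Continuity of the extended orbits -/

section Orbit

variable {L : Type*} [NormedAddCommGroup L] [InnerProductSpace ℂ L] [CompleteSpace L]
  {G : Type*} [Group G] [TopologicalSpace G]

/-- A weak* continuous action by triple automorphisms of `S`, each given by a linear map of
operators. -/
structure TripleAction (S : Submodule ℂ (L →L[ℂ] L))
    (a : G → (L →L[ℂ] L) →ₗ[ℂ] (L →L[ℂ] L)) : Prop where
  aut : ∀ s, TripleAut S (a s)
  map_one : ∀ x ∈ S, a 1 x = x
  map_mul : ∀ s t, ∀ x ∈ S, a (s * t) x = a s (a t x)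
  normal : ∀ s, NormalMap S.subtype (a s ∘ₗ S.subtype)
  continuous : ∀ x ∈ S, ∀ h k : L, Continuous fun s => inner ℂ k (a s x h)

namespace OddTriple

variable {J : L →L[ℂ] L} {S : Submodule ℂ (L →L[ℂ] L)} (hS : OddTriple J S)
  {a : G → (L →L[ℂ] L) →ₗ[ℂ] (L →L[ℂ] L)} (ha : TripleAction S a)

/-- The extension of an action on `S` to its double commutant. -/
def liftAction : G →* (hS.algebra ≃⋆ₐ[ℂ] hS.algebra) :=
  have h : ∀ s t z, hS.lift (ha.aut (s * t)) z = hS.lift (ha.aut s) (hS.lift (ha.aut t) z) :=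
    fun s t => hS.lift_comp (ha.aut s) (ha.aut t) (ha.aut (s * t)) (ha.map_mul s t)
  have h1 : ∀ z, hS.lift (ha.aut 1) z = z := hS.lift_of_id (ha.aut 1) ha.map_one
  { toFun := fun s => StarAlgEquiv.ofStarAlgHom (hS.lift (ha.aut s)) (hS.lift (ha.aut s⁻¹))
      (by
        ext z : 1
        change hS.lift (ha.aut s⁻¹) (hS.lift (ha.aut s) z) = z
        rw [← h]
        exact (hS.lift_congr _ (ha.aut 1) (by simp) z).trans (h1 z))
      (by
        ext z : 1
        change hS.lift (ha.aut s) (hS.lift (ha.aut s⁻¹) z) = z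
        rw [← h]
        exact (hS.lift_congr _ (ha.aut 1) (by simp) z).trans (h1 z))
    map_one' := by ext z : 1; exact h1 z
    map_mul' := fun s t => by ext z : 1; exact h s t z }

theorem liftAction_apply (s : G) (z : hS.algebra) :
    hS.liftAction ha s z = hS.lift (ha.aut s) z := rfl

variable [IsTopologicalGroup G]

/-- The approximate unit splits `‖β_s(y)h‖²` into terms `‖β_s(v_i y)h‖²` with `v_i y ∈ S` and a
remainder. Each term is bounded below by linearization, the remainder by its constant null
component; at `s = 1` almost nothing is lost. -/
theorem exists_minorant {y : hS.algebra} (hy : (y : L →L[ℂ] L) ∈ hS.evenAlgebra) (h : L) {ε : ℝ}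
    (hε : 0 < ε) : ∃ ℓ : G → ℝ, Continuous ℓ ∧
      (∀ s, ℓ s ≤ ‖(hS.liftAction ha s y : L →L[ℂ] L) h‖ ^ 2) ∧
      ‖(y : L →L[ℂ] L) h‖ ^ 2 - ε ≤ ℓ 1 := by
  obtain ⟨F, v, c, hv, hc, hsum, hcζ, hcn⟩ :=
    hS.exists_approx_unit ((y : L →L[ℂ] L) h) hε
  set P := (nullSpace S).starProjection with hP
  have hvy : ∀ i, ((v i * y : hS.algebra) : L →L[ℂ] L) ∈ S := fun i =>
    hS.mul_even_mem hy.1 hy.2 (hv i)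
  have hPc : ∀ (z : hS.algebra) x, P ((z : L →L[ℂ] L) x) = (z : L →L[ℂ] L) (P x) := by
    intro z x
    refine (Submodule.eq_starProjection_of_mem_of_inner_eq_zero
      (hS.bicommutant_nullSpace z.2 (Submodule.starProjection_apply_mem _ _)) fun ξ hξ => ?_)
    rw [← map_sub, ← star_star (z : L →L[ℂ] L), inner_star_apply]
    exact Submodule.inner_left_of_mem_orthogonal
      (hS.bicommutant_nullSpace (star z).2 hξ) (Submodule.sub_starProjection_mem_orthogonal x)
  -- From `‖u - w‖² ≥ 0`: `‖w‖² ≥ 2 Re⟨u, w⟩ - ‖u‖²`, with equality at `w = u`, and the right side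
  -- is weakly continuous in `w`.
  refine ⟨fun s => ∑ i ∈ F, (2 * RCLike.re (inner ℂ (((v i * y : hS.algebra) : L →L[ℂ] L) h)
      (a s (v i * y : hS.algebra) h)) - ‖((v i * y : hS.algebra) : L →L[ℂ] L) h‖ ^ 2) +
      ‖P ((y : L →L[ℂ] L) h)‖ ^ 2, ?_, fun s => ?_, ?_⟩
  · refine (continuous_finsetSum _ fun i _ => Continuous.sub (continuous_const.mul ?_)
      continuous_const).add continuous_const
    exact RCLike.continuous_re.comp (ha.continuous _ (hvy i) _ _)
  · rw [liftAction_apply, hS.norm_lift_sq (ha.aut s) F v c y hsum h]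
    refine add_le_add (Finset.sum_le_sum fun i _ => ?_) ?_
    · rw [hS.lift_of_mem (ha.aut s) (hvy i)]
      have := norm_sub_sq (𝕜 := ℂ) (((v i * y : hS.algebra) : L →L[ℂ] L) h)
        (a s (v i * y : hS.algebra) h)
      nlinarith [sq_nonneg ‖((v i * y : hS.algebra) : L →L[ℂ] L) h -
        a s (v i * y : hS.algebra) h‖]
    · have h1 := hS.starProjection_lift (ha.aut s) (c * y) h
      rw [← hP] at h1
      have h2 : ((c * y : hS.algebra) : L →L[ℂ] L) h = (c : L →L[ℂ] L) ((y : L →L[ℂ] L) h) := rfl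
      rw [h2, hPc c] at h1
      rw [← hcn _ (Submodule.starProjection_apply_mem (nullSpace S) _), ← h1]
      exact pow_le_pow_left₀ (norm_nonneg _) (Submodule.norm_starProjection_apply_le _ _) 2
  · have h1 : ∑ i ∈ F, ‖((v i * y : hS.algebra) : L →L[ℂ] L) h‖ ^ 2 +
        ‖(c : L →L[ℂ] L) ((y : L →L[ℂ] L) h)‖ ^ 2 = ‖(y : L →L[ℂ] L) h‖ ^ 2 :=
      norm_sq_of_sum_eq_one F (fun i => (v i : L →L[ℂ] L)) c
        (by simpa using congrArg (fun z : hS.algebra => (z : L →L[ℂ] L)) hsum) _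
    have h2 : ∀ i, 2 * RCLike.re (inner ℂ (((v i * y : hS.algebra) : L →L[ℂ] L) h)
      (a 1 (v i * y : hS.algebra) h)) - ‖((v i * y : hS.algebra) : L →L[ℂ] L) h‖ ^ 2 =
        ‖((v i * y : hS.algebra) : L →L[ℂ] L) h‖ ^ 2 := by
      intro i
      rw [ha.map_one _ (hvy i), inner_self_eq_norm_sq]
      ring
    simp only [h2]
    linarith

theorem lift_mem_evenAlgebra (s : G) {y : hS.algebra} (hy : (y : L →L[ℂ] L) ∈ hS.evenAlgebra) :
    (hS.liftAction ha s y : L →L[ℂ] L) ∈ hS.evenAlgebra := by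
  refine ⟨(hS.liftAction ha s y).2, ?_⟩
  have h := hS.isLift_lift (ha.aut s) y
  have h' := hS.isLift_conj (ha.aut s) y.2 h
  rw [hy.2] at h'
  exact hS.isLift_unique (ha.aut s) h' h

theorem lowerSemicontinuous_norm_lift {y : hS.algebra} (hy : (y : L →L[ℂ] L) ∈ hS.evenAlgebra)
    (h : L) : LowerSemicontinuous fun s : G => ‖(hS.liftAction ha s y : L →L[ℂ] L) h‖ ^ 2 := by
  intro t r hr
  -- A minorant sharp at the identity for `β_t(y)` is translated by `t` to give one sharp at `t` for
  -- `y`.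
  obtain ⟨ℓ, hℓ, h1, h2⟩ := hS.exists_minorant ha (hS.lift_mem_evenAlgebra ha t hy) h
    (half_pos (sub_pos.2 hr))
  have h3 : ∀ s, ℓ (s * t⁻¹) ≤ ‖(hS.liftAction ha s y : L →L[ℂ] L) h‖ ^ 2 := by
    intro s
    have := h1 (s * t⁻¹)
    rwa [← StarAlgEquiv.mul_apply, ← map_mul, inv_mul_cancel_right] at this
  have h4 : Continuous fun s => ℓ (s * t⁻¹) := hℓ.comp (continuous_id.mul continuous_const)
  have h5 : ∀ᶠ s in 𝓝 t, r < ℓ (s * t⁻¹) := by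
    refine h4.continuousAt.eventually (lt_mem_nhds ?_)
    simp only [mul_inv_cancel] at hr h2 ⊢
    linarith
  exact h5.mono fun s hs => hs.trans_le (h3 s)

/-- For the complement `c` of `y`, `‖β_s(y)h‖² + ‖β_s(c)h‖²` does not depend on `s`, so lower
semicontinuity for `c` is upper semicontinuity for `y`. -/
theorem continuous_norm_lift {y : hS.algebra} (hy : (y : L →L[ℂ] L) ∈ hS.evenAlgebra)
    (h : L) : Continuous fun s : G => ‖(hS.liftAction ha s y : L →L[ℂ] L) h‖ ^ 2 := by
  obtain ⟨c, hc, hc', hcy⟩ := hS.exists_complement hy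
  let c' : hS.algebra := ⟨c, hc.1⟩
  have hcy' : star y * y + star c' * c' = ((‖(y : L →L[ℂ] L)‖ ^ 2 : ℝ) : ℂ) • 1 := by
    refine Subtype.ext ?_
    change star (y : L →L[ℂ] L) * y + star c * c = ((‖(y : L →L[ℂ] L)‖ ^ 2 : ℝ) : ℂ) • 1
    rw [hc', hcy]
  have hsum : ∀ s, ‖(hS.liftAction ha s y : L →L[ℂ] L) h‖ ^ 2 +
      ‖(hS.liftAction ha s c' : L →L[ℂ] L) h‖ ^ 2 = ‖(y : L →L[ℂ] L)‖ ^ 2 * ‖h‖ ^ 2 := by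
    intro s
    have h1 := congrArg (fun z => inner ℂ h ((hS.liftAction ha s z : L →L[ℂ] L) h)) hcy'
    have h2 : ∀ z : hS.algebra, inner ℂ h ((hS.liftAction ha s (star z * z) : L →L[ℂ] L) h) =
        ((‖(hS.liftAction ha s z : L →L[ℂ] L) h‖ ^ 2 : ℝ) : ℂ) := by
      intro z
      rw [map_mul, map_star]
      change inner ℂ h (star (hS.liftAction ha s z : L →L[ℂ] L)
        ((hS.liftAction ha s z : L →L[ℂ] L) h)) = _
      rw [inner_apply_star, inner_self_eq_norm_sq_to_K]
      simp
    have h3 : inner ℂ h ((hS.liftAction ha s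
        (((‖(y : L →L[ℂ] L)‖ ^ 2 : ℝ) : ℂ) • 1) : L →L[ℂ] L) h) =
        ((‖(y : L →L[ℂ] L)‖ ^ 2 * ‖h‖ ^ 2 : ℝ) : ℂ) := by
      rw [map_smul, map_one]
      change inner ℂ h (((‖(y : L →L[ℂ] L)‖ ^ 2 : ℝ) : ℂ) • h) = _
      rw [inner_smul_right, inner_self_eq_norm_sq_to_K]
      simp
    have h4 : inner ℂ h ((hS.liftAction ha s (star y * y + star c' * c') : L →L[ℂ] L) h) =
        inner ℂ h ((hS.liftAction ha s (star y * y) : L →L[ℂ] L) h) +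
        inner ℂ h ((hS.liftAction ha s (star c' * c') : L →L[ℂ] L) h) := by
      rw [map_add, ← inner_add_right]; rfl
    simp only [h3, h4, h2] at h1
    exact_mod_cast h1
  refine continuous_iff_lower_upperSemicontinuous.2
    ⟨hS.lowerSemicontinuous_norm_lift ha hy h, ?_⟩
  have h5 := hS.lowerSemicontinuous_norm_lift ha (y := c') hc h
  intro t r hr
  have h6 := h5 t (‖(y : L →L[ℂ] L)‖ ^ 2 * ‖h‖ ^ 2 - r) (by
    have := hsum t
    simp only at hr ⊢
    linarith)
  refine h6.mono fun s hs => ?_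
  have := hsum s
  simp only at hs ⊢
  linarith

/-- The elements whose orbit is continuous for the weak operator topology. -/
def continuousOrbits : Submodule ℂ hS.algebra where
  carrier := {z | ∀ h k, Continuous fun s => inner ℂ k ((hS.liftAction ha s z : L →L[ℂ] L) h)}
  add_mem' := by
    intro z w hz hw h k
    simp only [map_add]
    simpa [inner_add_right] using! (hz h k).add (hw h k)
  zero_mem' := by
    intro h k
    simpa using continuous_const
  smul_mem' := by
    intro c z hz h k
    simp only [map_smul]
    simpa [inner_smul_right] using! (hz h k).const_smul c

theorem star_mul_mem_continuousOrbits {y : hS.algebra}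
    (hy : (y : L →L[ℂ] L) ∈ hS.evenAlgebra) : star y * y ∈ hS.continuousOrbits ha := by
  intro h k
  have key : ∀ x, Continuous fun s =>
      inner ℂ ((hS.liftAction ha s (star y * y) : L →L[ℂ] L) x) x := by
    intro x
    have : ∀ s, inner ℂ ((hS.liftAction ha s (star y * y) : L →L[ℂ] L) x) x =
        ((‖(hS.liftAction ha s y : L →L[ℂ] L) x‖ ^ 2 : ℝ) : ℂ) := by
      intro s
      rw [map_mul, map_star]
      change inner ℂ (star (hS.liftAction ha s y : L →L[ℂ] L)
        ((hS.liftAction ha s y : L →L[ℂ] L) x)) x = _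
      rw [inner_star_apply, inner_self_eq_norm_sq_to_K]
      simp
    simp only [this]
    exact Complex.continuous_ofReal.comp (hS.continuous_norm_lift ha hy x)
  have := fun s => inner_map_polarization
    ((hS.liftAction ha s (star y * y) : L →L[ℂ] L) : L →ₗ[ℂ] L) k h
  simp only [ContinuousLinearMap.coe_coe] at this
  have h2 : Continuous fun s => inner ℂ ((hS.liftAction ha s (star y * y) : L →L[ℂ] L) h) k := by
    simp only [this]
    exact (((key _).sub (key _)).add (continuous_const.mul (key _))).sub
      (continuous_const.mul (key _)) |>.div_const _
  simp only [← inner_conj_symm k]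
  exact Complex.continuous_conj.comp h2

theorem mem_continuousOrbits (z : hS.algebra) : z ∈ hS.continuousOrbits ha := by
  have heven : ∀ d : hS.algebra, (d : L →L[ℂ] L) ∈ hS.evenAlgebra →
      d ∈ hS.continuousOrbits ha := by
    intro d hd
    have hp : ∀ c : ℂ, star (1 + c • d) * (1 + c • d) ∈ hS.continuousOrbits ha := fun c =>
      hS.star_mul_mem_continuousOrbits ha (y := 1 + c • d)
        (add_mem (one_mem _) (hS.evenAlgebra.smul_mem hd c))
    -- Polarization of the pair `(1, d)`: it expresses any even `d` through elements `y* y` with `y`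
    -- even.
    have hd4 : d = (4⁻¹ : ℂ) • (star (1 + (1 : ℂ) • d) * (1 + (1 : ℂ) • d) -
        Complex.I • (star (1 + Complex.I • d) * (1 + Complex.I • d)) -
        star (1 + (-1 : ℂ) • d) * (1 + (-1 : ℂ) • d) +
        Complex.I • (star (1 + (-Complex.I) • d) * (1 + (-Complex.I) • d))) := by
      simp only [star_add, star_one, star_smul, add_mul, mul_add, one_mul, mul_one,
        smul_mul_smul_comm, smul_add, smul_smul]
      simp
      module
    rw [hd4]
    exact Submodule.smul_mem _ _ (add_mem (sub_mem (sub_mem (hp _)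
      (Submodule.smul_mem _ _ (hp _))) (hp _)) (Submodule.smul_mem _ _ (hp _)))
  have hodd : ∀ x : hS.algebra, (x : L →L[ℂ] L) ∈ S → x ∈ hS.continuousOrbits ha := by
    intro x hx h k
    simp only [liftAction_apply, hS.lift_of_mem (ha.aut _) hx]
    exact ha.continuous _ hx h k
  have hz : z = ⟨evenPart J z, hS.evenPart_mem z.2⟩ +
      ⟨oddPart J z, hS.mem_of_mem (hS.oddPart_mem z.2)⟩ :=
    Subtype.ext (evenPart_add_oddPart J z).symm
  rw [hz]
  exact add_mem (heven _ (hS.evenPart_mem_evenAlgebra z.2)) (hodd _ (hS.oddPart_mem z.2))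

/-- The extended action has weak* continuous orbits. -/
theorem continuous_liftAction (z : hS.algebra) (h k : lp (fun _ : ℕ => L) 2) :
    Continuous fun s => normalFunctional h k (hS.liftAction ha s z : L →L[ℂ] L) := by
  simp only [normalFunctional]
  -- Weak operator continuity of each term suffices, as the lifts are bounded uniformly in `s`.
  refine continuous_tsum (u := fun n => (‖k n‖ ^ 2 + ‖h n‖ ^ 2) * ‖(z : L →L[ℂ] L)‖)
    (fun n => hS.mem_continuousOrbits ha z _ _)
    (((lp_summable_norm_sq k).add (lp_summable_norm_sq h)).mul_right _) fun n s => ?_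
  calc _ ≤ ‖k n‖ * ‖(hS.liftAction ha s z : L →L[ℂ] L) (h n)‖ := norm_inner_le_norm _ _
    _ ≤ ‖k n‖ * (2 * ‖(z : L →L[ℂ] L)‖ * ‖h n‖) := by
        gcongr
        exact ContinuousLinearMap.le_of_opNorm_le _ (hS.norm_lift_le (ha.aut s) z) _
    _ ≤ _ := by nlinarith [mul_nonneg (sq_nonneg (‖k n‖ - ‖h n‖)) (norm_nonneg (z : L →L[ℂ] L))]

end OddTriple

end Orbit

/-! ### Existence and uniqueness for an abstract triple system -/

section Core

variable {L : Type*} [NormedAddCommGroup L] [InnerProductSpace ℂ L] [CompleteSpace L]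
  {G : Type*} [Group G] [TopologicalSpace G]

namespace OddTriple

variable {J : L →L[ℂ] L} {S : Submodule ℂ (L →L[ℂ] L)} (hS : OddTriple J S)
  {a : G → (L →L[ℂ] L) →ₗ[ℂ] (L →L[ℂ] L)} (ha : TripleAction S a)

theorem isVNAction_liftAction [IsTopologicalGroup G] :
    IsVNAction (doubleCommutant (S : Set (L →L[ℂ] L)) hS.star_mem) (hS.liftAction ha) where
  normal s := (normalMap_iff_continuous hS.incl.toLinearMap (E := hS.algebra)
    ((hS.lift (ha.aut s)).toAlgHom.toLinearMap)).1 (hS.normalMap_lift (ha.aut s) (ha.normal s))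
  continuous_orbit z := (continuous_induced_ultraweak_iff _ _).2 (hS.continuous_liftAction ha z)

/-- Normal `*`-homomorphisms of the double commutant are determined by their values on `S`. -/
theorem starAlgEquiv_ext {φ ψ : hS.algebra ≃⋆ₐ[ℂ] hS.algebra}
    (hφ : Continuous[ultraweakOn hS.algebra, ultraweakOn hS.algebra] φ)
    (hψ : Continuous[ultraweakOn hS.algebra, ultraweakOn hS.algebra] ψ)
    (h : ∀ z : hS.algebra, (z : L →L[ℂ] L) ∈ S → φ z = ψ z) : φ = ψ := by
  have hφ' : NormalMap hS.incl.toLinearMap (hS.incl.toLinearMap ∘ₗ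
      (φ.toAlgEquiv.toAlgHom.toLinearMap)) :=
    (normalMap_iff_continuous hS.incl.toLinearMap (E := hS.algebra) _).2 hφ
  have hψ' : NormalMap hS.incl.toLinearMap (hS.incl.toLinearMap ∘ₗ
      (ψ.toAlgEquiv.toAlgHom.toLinearMap)) :=
    (normalMap_iff_continuous hS.incl.toLinearMap (E := hS.algebra) _).2 hψ
  -- The difference of the two maps is normal and vanishes on the algebra generated by `S`, so the
  -- bicommutant theorem applies to its matrix coefficients.
  have hd := hφ'.add (hψ'.smul (-1))
  have hadj : StarAlgebra.adjoin ℂ (S : Set (L →L[ℂ] L)) ≤ hS.algebra :=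
    StarAlgebra.adjoin_le fun s hs => hS.mem_of_mem hs
  have hag : ∀ w (hw : w ∈ StarAlgebra.adjoin ℂ (S : Set (L →L[ℂ] L))),
      φ ⟨w, hadj hw⟩ = ψ ⟨w, hadj hw⟩ := by
    intro w hw
    induction hw using StarAlgebra.adjoin_induction with
    | mem s hs => exact h _ hs
    | algebraMap c =>
      exact (AlgEquiv.commutes φ.toAlgEquiv c).trans (AlgEquiv.commutes ψ.toAlgEquiv c).symm
    | add x y hx hy ihx ihy =>
      exact (map_add φ ⟨x, hadj hx⟩ ⟨y, hadj hy⟩).trans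
        ((congrArg₂ (· + ·) ihx ihy).trans (map_add ψ ⟨x, hadj hx⟩ ⟨y, hadj hy⟩).symm)
    | mul x y hx hy ihx ihy =>
      exact (map_mul φ ⟨x, hadj hx⟩ ⟨y, hadj hy⟩).trans
        ((congrArg₂ (· * ·) ihx ihy).trans (map_mul ψ ⟨x, hadj hx⟩ ⟨y, hadj hy⟩).symm)
    | star x hx ihx =>
      have hφs := map_star φ ⟨x, hadj hx⟩
      have hψs := map_star ψ ⟨x, hadj hx⟩
      rw [ihx, ← hψs] at hφs
      exact hφs
  ext z : 1
  refine Subtype.ext (sub_eq_zero.1 ?_)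
  ext x
  refine ext_inner_left ℂ fun y => ?_
  obtain ⟨h', k', H⟩ := hd (lp.single 2 0 x) (lp.single 2 0 y)
  have H' : ∀ w : hS.algebra, inner ℂ y (((φ w : L →L[ℂ] L) - ψ w) x) =
      normalFunctional h' k' (w : L →L[ℂ] L) := by
    intro w
    refine Eq.trans ?_ (H w)
    rw [← normalFunctional_single]
    simp only [LinearMap.comp_apply, LinearMap.add_apply, LinearMap.smul_apply,
      neg_one_smul, ← sub_eq_add_neg]
    rfl
  rw [H' z, normalFunctional_eq_zero_of_bicommutant (StarAlgebra.adjoin ℂ (S : Set (L →L[ℂ] L)))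
    (hS.bicommutant_subset_adjoin z.2)]
  · simp
  · intro w hw
    rw [← H' ⟨w, hadj hw⟩, hag w hw, sub_self]
    simp

/-- An action on `S` extends uniquely to its double commutant. -/
theorem existsUnique_action (ha : TripleAction S a) [IsTopologicalGroup G] {M : VonNeumannAlgebra L}
    (hM : M = doubleCommutant (S : Set (L →L[ℂ] L)) hS.star_mem) :
    ∃! β : G →* (M.toStarSubalgebra ≃⋆ₐ[ℂ] M.toStarSubalgebra),
      IsVNAction M β ∧ ∀ (s : G) (z : M.toStarSubalgebra), (z : L →L[ℂ] L) ∈ S →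
        (β s z : L →L[ℂ] L) = a s z := by
  subst hM
  refine ⟨hS.liftAction ha, ⟨hS.isVNAction_liftAction ha, fun s z hz =>
    hS.lift_of_mem (ha.aut s) hz⟩, fun β hβ => ?_⟩
  ext s : 1
  refine hS.starAlgEquiv_ext (hβ.1.normal s) ((hS.isVNAction_liftAction ha).normal s)
    fun z hz => Subtype.ext ?_
  exact (hβ.2 s z hz).trans (hS.lift_of_mem (ha.aut s) hz).symm

end OddTriple

end Core

/-! ### Block operators on the direct sum -/

section Block

variable {H K : Type*} [NormedAddCommGroup H] [InnerProductSpace ℂ H] [CompleteSpace H]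
  [NormedAddCommGroup K] [InnerProductSpace ℂ K] [CompleteSpace K]

theorem block_apply (a : K →L[ℂ] K) (b : H →L[ℂ] K) (c : K →L[ℂ] H) (d : H →L[ℂ] H)
    (v : WithLp 2 (K × H)) :
    block a b c d v = WithLp.toLp 2 (a v.fst + b v.snd, c v.fst + d v.snd) := rfl

theorem withLp_prod_ext {v w : WithLp 2 (K × H)} (h₁ : v.fst = w.fst) (h₂ : v.snd = w.snd) :
    v = w :=
  WithLp.ofLp_injective 2 (Prod.ext h₁ h₂)

theorem block_mul (a a' : K →L[ℂ] K) (b b' : H →L[ℂ] K) (c c' : K →L[ℂ] H) (d d' : H →L[ℂ] H) :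
    block a b c d * block a' b' c' d' =
      block (a ∘L a' + b ∘L c') (a ∘L b' + b ∘L d') (c ∘L a' + d ∘L c') (c ∘L b' + d ∘L d') := by
  refine ContinuousLinearMap.ext fun v => withLp_prod_ext ?_ ?_
  · simp [block_apply]; abel
  · simp [block_apply]; abel

theorem block_add (a a' : K →L[ℂ] K) (b b' : H →L[ℂ] K) (c c' : K →L[ℂ] H) (d d' : H →L[ℂ] H) :
    block a b c d + block a' b' c' d' = block (a + a') (b + b') (c + c') (d + d') := by
  refine ContinuousLinearMap.ext fun v => withLp_prod_ext ?_ ?_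
  · simp [block_apply]; abel
  · simp [block_apply]; abel

variable (H K) in
/-- The inclusion of the first summand. -/
def inlL : K →L[ℂ] WithLp 2 (K × H) :=
  (WithLp.prodContinuousLinearEquiv 2 ℂ K H).symm.toContinuousLinearMap ∘L
    ContinuousLinearMap.inl ℂ K H

variable (H K) in
/-- The inclusion of the second summand. -/
def inrL : H →L[ℂ] WithLp 2 (K × H) :=
  (WithLp.prodContinuousLinearEquiv 2 ℂ K H).symm.toContinuousLinearMap ∘L
    ContinuousLinearMap.inr ℂ K H

/-- The map `z ↦ a z b` between spaces of operators. -/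
def sandwich {E F E' F' : Type*} [NormedAddCommGroup E] [NormedSpace ℂ E] [NormedAddCommGroup F]
    [NormedSpace ℂ F] [NormedAddCommGroup E'] [NormedSpace ℂ E'] [NormedAddCommGroup F']
    [NormedSpace ℂ F'] (a : F →L[ℂ] F') (b : E' →L[ℂ] E) : (E →L[ℂ] F) →ₗ[ℂ] (E' →L[ℂ] F') where
  toFun z := a ∘L z ∘L b
  map_add' z w := by ext; simp
  map_smul' c z := by ext; simp

theorem sandwich_apply {E F E' F' : Type*} [NormedAddCommGroup E] [NormedSpace ℂ E]
    [NormedAddCommGroup F] [NormedSpace ℂ F] [NormedAddCommGroup E'] [NormedSpace ℂ E']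
    [NormedAddCommGroup F'] [NormedSpace ℂ F'] (a : F →L[ℂ] F') (b : E' →L[ℂ] E)
    (z : E →L[ℂ] F) : sandwich a b z = a ∘L z ∘L b := rfl

theorem normalMap_sandwich {H' K' : Type*} [NormedAddCommGroup H'] [InnerProductSpace ℂ H']
    [CompleteSpace H'] [NormedAddCommGroup K'] [InnerProductSpace ℂ K'] [CompleteSpace K']
    (a : K →L[ℂ] K') (b : H' →L[ℂ] H) : NormalMap LinearMap.id (sandwich a b) :=
  fun h k => ⟨ampl b h, ampl (a†) k, normalFunctional_comp a b h k⟩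

theorem block_sandwich (z : WithLp 2 (K × H) →L[ℂ] WithLp 2 (K × H)) :
    block (sandwich (WithLp.fstL 2 ℂ K H) (inlL H K) z)
      (sandwich (WithLp.fstL 2 ℂ K H) (inrL H K) z)
      (sandwich (WithLp.sndL 2 ℂ K H) (inlL H K) z)
      (sandwich (WithLp.sndL 2 ℂ K H) (inrL H K) z) = z := by
  have hv : ∀ v : WithLp 2 (K × H), inlL H K v.fst + inrL H K v.snd = v := fun v =>
    withLp_prod_ext (by simp [inlL, inrL]) (by simp [inlL, inrL])
  refine ContinuousLinearMap.ext fun v => ?_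
  conv_rhs => rw [← hv v, map_add]
  exact withLp_prod_ext rfl rfl

theorem sandwich_fst_inl (a : K →L[ℂ] K) (b : H →L[ℂ] K) (c : K →L[ℂ] H) (d : H →L[ℂ] H) :
    sandwich (WithLp.fstL 2 ℂ K H) (inlL H K) (block a b c d) = a := by
  ext v; simp [block_apply, sandwich_apply, inlL]

theorem sandwich_fst_inr (a : K →L[ℂ] K) (b : H →L[ℂ] K) (c : K →L[ℂ] H) (d : H →L[ℂ] H) :
    sandwich (WithLp.fstL 2 ℂ K H) (inrL H K) (block a b c d) = b := by
  ext v; simp [block_apply, sandwich_apply, inrL]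

theorem sandwich_snd_inl (a : K →L[ℂ] K) (b : H →L[ℂ] K) (c : K →L[ℂ] H) (d : H →L[ℂ] H) :
    sandwich (WithLp.sndL 2 ℂ K H) (inlL H K) (block a b c d) = c := by
  ext v; simp [block_apply, sandwich_apply, inlL]

theorem sandwich_snd_inr (a : K →L[ℂ] K) (b : H →L[ℂ] K) (c : K →L[ℂ] H) (d : H →L[ℂ] H) :
    sandwich (WithLp.sndL 2 ℂ K H) (inrL H K) (block a b c d) = d := by
  ext v; simp [block_apply, sandwich_apply, inrL]

theorem sandwich_inl_snd (b : H →L[ℂ] K) :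
    sandwich (inlL H K) (WithLp.sndL 2 ℂ K H) b = block 0 b 0 0 := by
  refine ContinuousLinearMap.ext fun v => withLp_prod_ext ?_ ?_ <;>
    simp [block_apply, sandwich_apply, inlL]

theorem sandwich_inr_fst (c : K →L[ℂ] H) :
    sandwich (inrL H K) (WithLp.fstL 2 ℂ K H) c = block 0 0 c 0 := by
  refine ContinuousLinearMap.ext fun v => withLp_prod_ext ?_ ?_ <;>
    simp [block_apply, sandwich_apply, inrL]

theorem continuous_normalFunctional (h : lp (fun _ : ℕ => H) 2) (k : lp (fun _ : ℕ => K) 2) :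
    Continuous[ultraweak H K, inferInstance] (normalFunctional h k) :=
  continuous_iff_le_induced.2 ((iInf_le _ h).trans (iInf_le _ k))

theorem isClosed_bot_ultraweak :
    IsClosed[ultraweak H K] ((⊥ : Submodule ℂ (H →L[ℂ] K)) : Set (H →L[ℂ] K)) := by
  letI := ultraweak H K
  have : ((⊥ : Submodule ℂ (H →L[ℂ] K)) : Set (H →L[ℂ] K)) = ⋂ x : H, ⋂ y : K,
      {T | normalFunctional (lp.single 2 0 x) (lp.single 2 0 y) T = 0} := by
    ext T
    simp only [SetLike.mem_coe, Submodule.mem_bot, Set.mem_iInter, Set.mem_ofPred_eq,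
      normalFunctional_single]
    refine ⟨fun h x y => by simp [h], fun h => ?_⟩
    ext x
    exact ext_inner_left ℂ fun y => by simpa using h x y
  rw [this]
  exact isClosed_iInter fun x => isClosed_iInter fun y => isClosed_eq (continuous_normalFunctional _ _) continuous_const

/-- The adjoints of the operators in a subspace. -/
def adjoints (X : Submodule ℂ (H →L[ℂ] K)) : Submodule ℂ (K →L[ℂ] H) where
  carrier := {y | y† ∈ X}
  add_mem' := fun ha hb => by
    simp only [Set.mem_ofPred_eq, map_add] at *
    exact X.add_mem ha hb
  zero_mem' := by simp
  smul_mem' := fun c y hy => by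
    simp only [Set.mem_ofPred_eq, map_smulₛₗ] at *
    exact X.smul_mem _ hy

theorem mem_adjoints {X : Submodule ℂ (H →L[ℂ] K)} {y : K →L[ℂ] H} :
    y ∈ adjoints X ↔ y† ∈ X := Iff.rfl

theorem isClosed_adjoints {X : Submodule ℂ (H →L[ℂ] K)}
    (hX : IsClosed[ultraweak H K] (X : Set (H →L[ℂ] K))) :
    IsClosed[ultraweak K H] (adjoints X : Set (K →L[ℂ] H)) := by
  have hc : Continuous[ultraweak K H, TopologicalSpace.induced id (ultraweak H K)]
      (fun y : K →L[ℂ] H => y†) := by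
    refine (@continuous_induced_ultraweak_iff H K _ _ _ _ _ _ _ _ (ultraweak K H) id _).2
      fun h k => ?_
    simp only [id, normalFunctional_adjoint]
    exact @Continuous.comp _ _ _ (ultraweak K H) _ _ _ _ Complex.continuous_conj
      (continuous_normalFunctional k h)
  rw [@induced_id _ (ultraweak H K)] at hc
  exact @IsClosed.preimage _ _ (ultraweak K H) (ultraweak H K) _ hc _ hX

end Block

/-! ### Transfer between the ternary ring and its off-diagonal corners -/

section Transfer

variable {H K : Type*} [NormedAddCommGroup H] [InnerProductSpace ℂ H] [CompleteSpace H]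
  [NormedAddCommGroup K] [InnerProductSpace ℂ K] [CompleteSpace K]

/-- The operators `(0, x; y*, 0)` with `x, y ∈ X`. -/
def corners (X : Submodule ℂ (H →L[ℂ] K)) :
    Submodule ℂ (WithLp 2 (K × H) →L[ℂ] WithLp 2 (K × H)) :=
  (((⊥ : Submodule ℂ (K →L[ℂ] K)).comap (sandwich (WithLp.fstL 2 ℂ K H) (inlL H K))) ⊓
    ((⊥ : Submodule ℂ (H →L[ℂ] H)).comap (sandwich (WithLp.sndL 2 ℂ K H) (inrL H K)))) ⊓
  (X.comap (sandwich (WithLp.fstL 2 ℂ K H) (inrL H K)) ⊓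
    (adjoints X).comap (sandwich (WithLp.sndL 2 ℂ K H) (inlL H K)))

theorem block_mem_corners {X : Submodule ℂ (H →L[ℂ] K)} {x y : H →L[ℂ] K} (hx : x ∈ X)
    (hy : y ∈ X) : block 0 x (y†) 0 ∈ corners X := by
  refine ⟨⟨?_, ?_⟩, ?_, ?_⟩
  · exact sandwich_fst_inl _ _ _ _
  · exact sandwich_snd_inr _ _ _ _
  · rw [SetLike.mem_coe, Submodule.mem_comap, sandwich_fst_inr]
    exact hx
  · rw [SetLike.mem_coe, Submodule.mem_comap, sandwich_snd_inl, mem_adjoints,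
      ContinuousLinearMap.adjoint_adjoint]
    exact hy

theorem mem_corners {X : Submodule ℂ (H →L[ℂ] K)}
    {z : WithLp 2 (K × H) →L[ℂ] WithLp 2 (K × H)} :
    z ∈ corners X ↔ ∃ x ∈ X, ∃ y ∈ X, z = block 0 x (y†) 0 := by
  constructor
  · rintro ⟨⟨h1, h2⟩, h3, h4⟩
    refine ⟨_, h3, _, h4, ?_⟩
    conv_lhs => rw [← block_sandwich z]
    rw [ContinuousLinearMap.adjoint_adjoint]
    rw [show sandwich (WithLp.fstL 2 ℂ K H) (inlL H K) z = 0 from h1,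
      show sandwich (WithLp.sndL 2 ℂ K H) (inrL H K) z = 0 from h2]
  · rintro ⟨x, hx, y, hy, rfl⟩
    exact block_mem_corners hx hy

theorem isClosed_corners {X : Submodule ℂ (H →L[ℂ] K)}
    (hX : IsClosed[ultraweak H K] (X : Set (H →L[ℂ] K))) :
    IsClosed[ultraweak (WithLp 2 (K × H)) (WithLp 2 (K × H))]
      (corners X : Set (WithLp 2 (K × H) →L[ℂ] WithLp 2 (K × H))) := by
  letI := ultraweak (WithLp 2 (K × H)) (WithLp 2 (K × H))
  simp only [corners, Submodule.coe_inf]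
  exact ((isClosed_comap (normalMap_sandwich _ _) isClosed_bot_ultraweak).inter
    (isClosed_comap (normalMap_sandwich _ _) isClosed_bot_ultraweak)).inter
    ((isClosed_comap (normalMap_sandwich _ _) hX).inter
      (isClosed_comap (normalMap_sandwich _ _) (isClosed_adjoints hX)))

variable (H K) in
/-- The symmetry of the graded space `K ⊕ H`. -/
def grading : WithLp 2 (K × H) →L[ℂ] WithLp 2 (K × H) := block 1 0 0 (-1)

/-- A product of three off-diagonal operators is off-diagonal, with corners `x y'* x''` and the
adjoint of `y'' x'* y`: ternary products in `X`. -/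
theorem oddTriple_corners (X : WStarTRO H K) :
    OddTriple (grading H K) (corners X.toSubmodule) where
  star_mem s hs := by
    obtain ⟨x, hx, y, hy, rfl⟩ := mem_corners.1 hs
    rw [star_block, ContinuousLinearMap.adjoint_adjoint, map_zero, map_zero]
    exact block_mem_corners hy hx
  mul_mem s hs t ht u hu := by
    obtain ⟨x, hx, y, hy, rfl⟩ := mem_corners.1 hs
    obtain ⟨x', hx', y', hy', rfl⟩ := mem_corners.1 ht
    obtain ⟨x'', hx'', y'', hy'', rfl⟩ := mem_corners.1 hu
    rw [block_mul, block_mul]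
    refine mem_corners.2 ⟨_, X.ternary_mem' x hx y' hy' x'' hx'', _,
      X.ternary_mem' y'' hy'' x' hx' y hy, ?_⟩
    simp [ContinuousLinearMap.adjoint_comp, ContinuousLinearMap.comp_assoc]
  sq_eq_one := by
    rw [grading, block_mul]
    refine ContinuousLinearMap.ext fun v => withLp_prod_ext ?_ ?_ <;> simp [block_apply]
  star_eq := by
    rw [grading, star_block]
    simp [← ContinuousLinearMap.star_eq_adjoint]
  odd s hs := by
    obtain ⟨x, hx, y, hy, rfl⟩ := mem_corners.1 hs
    refine ContinuousLinearMap.ext fun v => withLp_prod_ext ?_ ?_ <;> simp [block_apply, grading]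
  isClosed := isClosed_corners X.isClosed_ultraweak'

theorem corners_subset_linkingAlgebra (X : TRO H K) :
    (corners X.toSubmodule : Set _) ⊆ X.linkingAlgebra := by
  intro z hz
  obtain ⟨x, hx, y, hy, rfl⟩ := mem_corners.1 hz
  exact ⟨0, zero_mem _, x, hx, y, hy, 0, zero_mem _, rfl⟩

theorem sandwich_inl_fst (a : K →L[ℂ] K) :
    sandwich (inlL H K) (WithLp.fstL 2 ℂ K H) a = block a 0 0 0 := by
  refine ContinuousLinearMap.ext fun v => withLp_prod_ext ?_ ?_ <;>
    simp [block_apply, sandwich_apply, inlL]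

theorem sandwich_inr_snd (d : H →L[ℂ] H) :
    sandwich (inrL H K) (WithLp.sndL 2 ℂ K H) d = block 0 0 0 d := by
  refine ContinuousLinearMap.ext fun v => withLp_prod_ext ?_ ?_ <;>
    simp [block_apply, sandwich_apply, inrL]

theorem commute_of_mem_topologicalClosure_span {E A : Type*} [NormedAddCommGroup E]
    [NormedSpace ℂ E] [NormedRing A] [NormedAlgebra ℂ A] {f : E →ₗ[ℂ] A} (hf : Continuous f)
    {T : A} {s : Set E} (hs : ∀ x ∈ s, Commute T (f x)) {x : E}
    (hx : x ∈ (Submodule.span ℂ s).topologicalClosure) : Commute T (f x) := by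
  let N : Submodule ℂ E := LinearMap.ker
    ((LinearMap.mulLeft ℂ T - LinearMap.mulRight ℂ T) ∘ₗ f)
  have mem : ∀ y, y ∈ N ↔ T * f y = f y * T := fun y => by simp [N, sub_eq_zero]
  have hN : IsClosed (N : Set E) := by
    rw [show (N : Set E) = {y | T * f y = f y * T} from Set.ext mem]
    exact isClosed_eq (continuous_const.mul hf) (hf.mul continuous_const)
  exact (mem x).1 (Submodule.topologicalClosure_minimal _
    (Submodule.span_le.2 fun y hy => (mem y).2 (hs y hy)) hN hx)

theorem continuous_sandwich {H' K' : Type*} [NormedAddCommGroup H'] [NormedSpace ℂ H']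
    [NormedAddCommGroup K'] [NormedSpace ℂ K'] (a : K →L[ℂ] K') (b : H' →L[ℂ] H) :
    Continuous (sandwich a b) :=
  continuous_const.clm_comp (continuous_id.clm_comp continuous_const)

/-- The diagonal corners add nothing: they are norm limits of linear combinations of products of
off-diagonal ones. -/
theorem centralizer_linkingAlgebra (X : TRO H K) :
    Set.centralizer X.linkingAlgebra = Set.centralizer (corners X.toSubmodule : Set _) := by
  refine (Set.centralizer_subset (corners_subset_linkingAlgebra X)).antisymm fun T hT => ?_
  have hc : ∀ z ∈ corners X.toSubmodule, Commute T z := fun z hz => (hT z hz).symm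
  have hu : ∀ x ∈ X.toSubmodule, Commute T (block 0 x 0 0) := fun x hx => by
    simpa using hc _ (block_mem_corners hx (zero_mem _))
  have hl : ∀ y ∈ X.toSubmodule, Commute T (block 0 0 (y†) 0) := fun y hy =>
    hc _ (block_mem_corners (zero_mem _) hy)
  have h1 : ∀ a ∈ X.leftSpan, Commute T (block a 0 0 0) := fun a ha => by
    rw [← sandwich_inl_fst]
    refine commute_of_mem_topologicalClosure_span (continuous_sandwich _ _) ?_ ha
    rintro _ ⟨x, hx, y, hy, rfl⟩
    rw [sandwich_inl_fst]
    have := (hu x hx).mul_right (hl y hy)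
    rw [block_mul] at this
    simpa using this
  have h2 : ∀ d ∈ X.rightSpan, Commute T (block 0 0 0 d) := fun d hd => by
    rw [← sandwich_inr_snd]
    refine commute_of_mem_topologicalClosure_span (continuous_sandwich _ _) ?_ hd
    rintro _ ⟨x, hx, y, hy, rfl⟩
    rw [sandwich_inr_snd]
    have := (hl x hx).mul_right (hu y hy)
    rw [block_mul] at this
    simpa using this
  rintro _ ⟨a, ha, x, hx, y, hy, d, hd, rfl⟩
  have := ((h1 a ha).add_right (hc _ (block_mem_corners hx hy))).add_right (h2 d hd)
  rw [block_add, block_add] at this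
  simpa using this.symm.eq

theorem linking_eq (X : WStarTRO H K) : X.linking =
    doubleCommutant (corners X.toSubmodule : Set _) (oddTriple_corners X).star_mem :=
  SetLike.ext fun z => by
    change z ∈ Set.centralizer (Set.centralizer X.linkingAlgebra) ↔
      z ∈ Set.centralizer (Set.centralizer _)
    rw [centralizer_linkingAlgebra]

theorem normalMap_comp_subtype {S : Submodule ℂ (H →L[ℂ] H)}
    {f : (H →L[ℂ] H) →ₗ[ℂ] (H →L[ℂ] H)} (hf : ∀ h k, ∃ h' k', ∀ z ∈ S,
      normalFunctional h k (f z) = normalFunctional h' k' z) :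
    NormalMap S.subtype (f ∘ₗ S.subtype) := by
  intro h k
  obtain ⟨h', k', H'⟩ := hf h k
  exact ⟨h', k', fun z => H' z z.2⟩

theorem starAlgEquiv_add_star {M : StarSubalgebra ℂ (H →L[ℂ] H)} (b : M ≃⋆ₐ[ℂ] M) (u v : M) :
    b (u + star v) = b u + star (b v) := by
  rw [map_add, map_star]

/-- The action of a linear map `A` on the off-diagonal corners, by `A` on the upper right one and
by `y ↦ A(y*)*` on the lower left one. -/
def cornerMap (A : (H →L[ℂ] K) →ₗ[ℂ] (H →L[ℂ] K)) :
    (WithLp 2 (K × H) →L[ℂ] WithLp 2 (K × H)) →ₗ[ℂ] (WithLp 2 (K × H) →L[ℂ] WithLp 2 (K × H)) :=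
  sandwich (inlL H K) (WithLp.sndL 2 ℂ K H) ∘ₗ A ∘ₗ
      sandwich (WithLp.fstL 2 ℂ K H) (inrL H K) +
    sandwich (inrL H K) (WithLp.fstL 2 ℂ K H) ∘ₗ
      (ContinuousLinearMap.adjoint.toLinearEquiv.toLinearMap ∘ₛₗ A ∘ₛₗ
        ContinuousLinearMap.adjoint.toLinearEquiv.toLinearMap) ∘ₗ
      sandwich (WithLp.sndL 2 ℂ K H) (inlL H K)

theorem cornerMap_block (A : (H →L[ℂ] K) →ₗ[ℂ] (H →L[ℂ] K)) (x y : H →L[ℂ] K) :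
    cornerMap A (block 0 x (y†) 0) = block 0 (A x) ((A y)†) 0 := by
  simp [cornerMap, sandwich_fst_inr, sandwich_snd_inl, sandwich_inl_snd, sandwich_inr_fst,
    block_add]

section Action

variable {G : Type*} [Group G] [TopologicalSpace G] {X : WStarTRO H K}
  {α : G →* (X.toSubmodule ≃ₗ[ℂ] X.toSubmodule)} (hα : X.IsAction α)
  {A : G → (H →L[ℂ] K) →ₗ[ℂ] (H →L[ℂ] K)} (hA : ∀ s (x : X.toSubmodule), A s x = α s x)

include hα in
theorem exists_normalFunctional_action (s : G) (h : lp (fun _ : ℕ => H) 2)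
    (k : lp (fun _ : ℕ => K) 2) : ∃ h' k', ∀ x : X.toSubmodule,
      normalFunctional h k (α s x : H →L[ℂ] K) = normalFunctional h' k' (x : H →L[ℂ] K) :=
  (normalMap_iff_continuous (i := X.toSubmodule.subtype) X.toSubmodule.subtype
    (α s).toLinearMap).2 (hα.normal s) h k

include hα in
theorem continuous_inner_action (x : X.toSubmodule) (h : H) (k : K) :
    Continuous fun s => inner ℂ k ((α s x : H →L[ℂ] K) h) := by
  have := (continuous_induced_ultraweak_iff _ _).1 (hα.continuous_orbit x)
    (lp.single 2 0 h) (lp.single 2 0 k)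
  simpa only [normalFunctional_single] using this

include hA in
/-- A homomorphism of the linking algebra extends `α` on the corner `X` iff it extends the induced
map on both off-diagonal corners. -/
theorem extends_iff (s : G) (b : X.linking.toStarSubalgebra ≃⋆ₐ[ℂ] X.linking.toStarSubalgebra) :
    (∀ z : X.linking.toStarSubalgebra,
      (z : WithLp 2 (K × H) →L[ℂ] WithLp 2 (K × H)) ∈ corners X.toSubmodule →
        (b z : WithLp 2 (K × H) →L[ℂ] WithLp 2 (K × H)) = cornerMap (A s) z) ↔
      ∀ x : X.toSubmodule, b (X.corner x) = X.corner (α s x) := by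
  constructor
  · intro h x
    have e : (X.corner x : WithLp 2 (K × H) →L[ℂ] WithLp 2 (K × H)) =
        block 0 x ((0 : H →L[ℂ] K)†) 0 := by rw [map_zero]; rfl
    refine Subtype.ext ((h _ ?_).trans ?_)
    · rw [e]
      exact block_mem_corners x.2 (zero_mem _)
    · rw [e, cornerMap_block, hA, map_zero, map_zero]
      rfl
  · intro h z hz
    obtain ⟨x, hx, y, hy, e⟩ := mem_corners.1 hz
    have hb : ∀ u v : X.toSubmodule, ((X.corner u + star (X.corner v) :
        X.linking.toStarSubalgebra) : WithLp 2 (K × H) →L[ℂ] WithLp 2 (K × H)) =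
        block 0 u ((v : H →L[ℂ] K)†) 0 := fun u v => by
      change block 0 (u : H →L[ℂ] K) 0 0 + star (block 0 (v : H →L[ℂ] K) 0 0) = _
      rw [star_block, block_add]
      simp
    have hz' : z = X.corner ⟨x, hx⟩ + star (X.corner ⟨y, hy⟩) :=
      Subtype.ext (e.trans (hb ⟨x, hx⟩ ⟨y, hy⟩).symm)
    rw [e, cornerMap_block, hA s ⟨x, hx⟩, hA s ⟨y, hy⟩, hz', starAlgEquiv_add_star, h, h, hb]

include hα hA

theorem exists_normalFunctional_cornerMap (s : G) (h k : lp (fun _ : ℕ => WithLp 2 (K × H)) 2) :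
    ∃ h' k', ∀ z ∈ corners X.toSubmodule,
      normalFunctional h k (cornerMap (A s) z) = normalFunctional h' k' z := by
  obtain ⟨h₁, k₁, H₁⟩ := exists_normalFunctional_action hα s
    (ampl (WithLp.sndL 2 ℂ K H) h) (ampl ((inlL H K)†) k)
  -- The two sequences change roles because the lower left corner acts through adjoints, which
  -- conjugate the functional and swap its arguments.
  obtain ⟨h₂, k₂, H₂⟩ := exists_normalFunctional_action hα s
    (ampl ((inrL H K)†) k) (ampl (WithLp.fstL 2 ℂ K H) h)
  obtain ⟨h', k', -, -, H'⟩ := exists_normalFunctional_add (ampl (inrL H K) h₁)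
    (ampl (inlL H K) k₂) (ampl ((WithLp.fstL 2 ℂ K H)†) k₁) (ampl ((WithLp.sndL 2 ℂ K H)†) h₂)
  refine ⟨h', k', fun z hz => ?_⟩
  obtain ⟨x, hx, y, hy, rfl⟩ := mem_corners.1 hz
  have hd : cornerMap (A s) (block 0 x (y†) 0) = sandwich (inlL H K) (WithLp.sndL 2 ℂ K H) (A s x) +
      sandwich (inrL H K) (WithLp.fstL 2 ℂ K H) ((A s y)†) := by
    rw [cornerMap_block, sandwich_inl_snd, sandwich_inr_fst, block_add]
    simp
  have e1 : normalFunctional h k (sandwich (inlL H K) (WithLp.sndL 2 ℂ K H) (A s x)) =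
      normalFunctional h₁ k₁ x := by
    rw [sandwich_apply, normalFunctional_comp, hA s ⟨x, hx⟩, H₁]
  have e2 : normalFunctional h k (sandwich (inrL H K) (WithLp.fstL 2 ℂ K H) ((A s y)†)) =
      normalFunctional k₂ h₂ (y†) := by
    rw [sandwich_apply, normalFunctional_comp, normalFunctional_adjoint, hA s ⟨y, hy⟩, H₂,
      ← normalFunctional_adjoint]
  rw [H', ← normalFunctional_comp, ← normalFunctional_comp, ← sandwich_apply, ← sandwich_apply,
    sandwich_fst_inr, sandwich_snd_inl, ← e1, ← e2, hd]
  exact map_add (normalFunctionalₗ h k) _ _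

theorem tripleAction_cornerMap :
    TripleAction (corners X.toSubmodule) (fun s => cornerMap (A s)) where
  aut s := by
    have hm : ∀ x ∈ X.toSubmodule, A s x ∈ X.toSubmodule := fun x hx => by
      rw [hA s ⟨x, hx⟩]; exact (α s ⟨x, hx⟩).2
    have ht : ∀ x ∈ X.toSubmodule, ∀ y ∈ X.toSubmodule, ∀ z ∈ X.toSubmodule,
        A s (x ∘L y† ∘L z) = A s x ∘L (A s y)† ∘L A s z := fun x hx y hy z hz => by
      have := congrArg (Subtype.val) (hα.map_ternary s ⟨x, hx⟩ ⟨y, hy⟩ ⟨z, hz⟩)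
      rw [← hA] at this
      rw [hA s ⟨x, hx⟩, hA s ⟨y, hy⟩, hA s ⟨z, hz⟩]
      exact this
    refine ⟨fun z hz => ?_, fun t ht => ?_, fun z hz w hw u hu => ?_, fun z hz => ?_⟩
    · obtain ⟨x, hx, y, hy, rfl⟩ := mem_corners.1 hz
      rw [cornerMap_block]
      exact block_mem_corners (hm x hx) (hm y hy)
    · obtain ⟨x, hx, y, hy, rfl⟩ := mem_corners.1 ht
      refine ⟨_, block_mem_corners ((α s).symm ⟨x, hx⟩).2 ((α s).symm ⟨y, hy⟩).2, ?_⟩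
      rw [cornerMap_block, hA, hA, LinearEquiv.apply_symm_apply, LinearEquiv.apply_symm_apply]
    · obtain ⟨x, hx, y, hy, rfl⟩ := mem_corners.1 hz
      obtain ⟨x', hx', y', hy', rfl⟩ := mem_corners.1 hw
      obtain ⟨x'', hx'', y'', hy'', rfl⟩ := mem_corners.1 hu
      have key : ∀ p q r p' q' r' : H →L[ℂ] K,
          block 0 p (p'†) 0 * block 0 q (q'†) 0 * block 0 r (r'†) 0 =
            block 0 (p ∘L q'† ∘L r) ((r' ∘L q† ∘L p')†) 0 := fun p q r p' q' r' => by
        rw [block_mul, block_mul]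
        simp [ContinuousLinearMap.adjoint_comp, ContinuousLinearMap.comp_assoc]
      rw [key, cornerMap_block, cornerMap_block, cornerMap_block, cornerMap_block, key,
        ht x hx y' hy' x'' hx'', ht y'' hy'' x' hx' y hy]
    · obtain ⟨x, hx, y, hy, rfl⟩ := mem_corners.1 hz
      simp only [star_block, cornerMap_block, ContinuousLinearMap.adjoint_adjoint, map_zero]
  map_one z hz := by
    obtain ⟨x, hx, y, hy, rfl⟩ := mem_corners.1 hz
    rw [cornerMap_block, hA 1 ⟨x, hx⟩, hA 1 ⟨y, hy⟩, map_one]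
    rfl
  map_mul s t z hz := by
    obtain ⟨x, hx, y, hy, rfl⟩ := mem_corners.1 hz
    rw [cornerMap_block, cornerMap_block, cornerMap_block, hA (s * t) ⟨x, hx⟩,
      hA (s * t) ⟨y, hy⟩, hA t ⟨x, hx⟩, hA t ⟨y, hy⟩, hA, hA, map_mul]
    rfl
  normal s := normalMap_comp_subtype (exists_normalFunctional_cornerMap hα hA s)
  continuous z hz h k := by
    obtain ⟨x, hx, y, hy, rfl⟩ := mem_corners.1 hz
    have h1 := continuous_inner_action hα ⟨x, hx⟩ h.snd k.fst
    have h2 := Complex.continuous_conj.comp (continuous_inner_action hα ⟨y, hy⟩ k.snd h.fst)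
    refine (h1.add h2).congr fun s => ?_
    rw [cornerMap_block, hA s ⟨x, hx⟩, hA s ⟨y, hy⟩]
    simp [block_apply, WithLp.prod_inner_apply, ContinuousLinearMap.adjoint_inner_right]

end Action

end Transfer

end WStarTernary

end

theorem mainTheorem6 {G : Type*} [Group G] [TopologicalSpace G] [IsTopologicalGroup G]
    [LocallyCompactSpace G]
    {H K : Type*} [NormedAddCommGroup H] [InnerProductSpace ℂ H] [CompleteSpace H]
    [NormedAddCommGroup K] [InnerProductSpace ℂ K] [CompleteSpace K]
    (X : WStarTernary.WStarTRO H K)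
    (α : G →* (X.toSubmodule ≃ₗ[ℂ] X.toSubmodule)) (hα : X.IsAction α) :
    ∃! β : G →* (X.linking.toStarSubalgebra ≃⋆ₐ[ℂ] X.linking.toStarSubalgebra),
      WStarTernary.IsVNAction X.linking β ∧
        ∀ (s : G) (x : X.toSubmodule), β s (X.corner x) = X.corner (α s x) := by
  -- The abstract setting uses linear maps on all operators, so each `α s` is extended linearly,
  -- without any continuity; only the values on `X` matter.
  choose A hA using fun s : G =>
    LinearMap.exists_extend (X.toSubmodule.subtype ∘ₗ (α s).toLinearMap)
  have hA' : ∀ s (x : X.toSubmodule), A s x = α s x := fun s x => LinearMap.congr_fun (hA s) x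
  refine (existsUnique_congr fun β => and_congr_right fun _ => forall_congr' fun s =>
    WStarTernary.extends_iff hA' s (β s)).1 ?_
  exact (WStarTernary.oddTriple_corners X).existsUnique_action
    (WStarTernary.tripleAction_cornerMap hα hA') (WStarTernary.linking_eq X)
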